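/- Let $m>1$ be an integer with $m\not\equiv 2\pmod 4$, and write $m=q_1q_2\cdots q_t$ with $q_1,\dots,q_t$ pairwise coprime prime powers, all greater than $2$, listed in an arbitrary fixed order; let $p_i$ be the prime dividing $q_i$, and let $\varphi$ be Euler's function. For every $n\ge 1$ let $\zeta_n=e^{2\pi i/n}$, $G_n=\mathrm{Gal}(\mathbb{Q}(\zeta_n)/\mathbb{Q})$, let $\sigma_{s}\in G_n$ (for $(s,n)=1$) be the automorphism raising $n$-th roots of unity to the $s$-th power, and put $N_n=\sum_{\tau\in G_n}\tau$ and, for $a\in\mathbb{Z}$, $$\theta_n(a)=\sum_{0<s\le n,\ (s,n)=1}\Bigl\langle -\frac{as}{n}\Bigr\rangle\,\sigma_{s}^{-1}\in\mathbb{Q}[G_n],$$ where $\langle x\rangle$ is the fractional part of $x$. For $d\mid n$ let $\mathrm{res}_{n,d}\colon\mathbb{Q}[G_n]\to\mathbb{Q}[G_d]$ be the ring homomorphism induced by restriction of automorphisms, and $\mathrm{cor}_{n,d}\colon\mathbb{Q}[G_d]\to\mathbb{Q}[G_n]$ the linear map sending $\tau\in G_d$ to the sum of all $\sigma\in G_n$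 with $\sigma|_{\mathbb{Q}(\zeta_d)}=\tau$. Let $S'_m$ be the additive subgroup of $\mathbb{Q}[G_m]$ generated by all $\mathrm{cor}_{m,(m,n)}\bigl(\mathrm{res}_{n,(m,n)}(\theta_n(a))\bigr)$ with $a,n\in\mathbb{Z}$, $n>0$. Let $M_m$ be the set of all integers $a$ with $0<a<m$ and $\bigl(a,\tfrac{m}{(a,m)}\bigr)=1$ such that: (i) for every $i$, if $q_i\nmid a$ then $a\not\equiv-(a,m)\pmod{q_i}$; (ii) if $a\nmid m$ and $k=\max\{i: a\not\equiv(a,m)\pmod{q_i}\}$, then $\bigl\langle\tfrac{a}{(a,m)q_k}\bigr\rangle<\tfrac12$; (iii) if $a\mid m$, then the number of $i$ with $q_i\nmid a$ is odd. Let $$M'_m=\Bigl\{a\in M_m:\ \tfrac{m}{q_i}\nmid a\text{ for all }i\Bigr\}\cup\bigcup_{i=1}^{t}\Bigl\{\tfrac{mb}{q_i}:\ 1\le b\le\tfrac{\varphi(q_i)}{2}\Bigr\}.$$ For $0<b<m$ let $J'_b=\{i: q_i\nmid b\}$, which is non-empty, and let $r_b$ be the product of the $q_i$ dividing $b$. Define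 $\alpha_m(b)\in\mathbb{Q}[G_m]$ as follows. - If $|J'_b|>1$, put $u=q_{\min J'_b}$, $v=\tfrac{m}{ur_b}$, choose $x,y\in\mathbb{Z}$ with $ux+vy=-1$, and let $\alpha_m(b)=\theta_m(b)+\theta_m(bux)+\theta_m(bvy)-N_m$ (this does not depend on the choice of $x,y$). - If $J'_b=\{j\}$ and $b\neq\tfrac{m}{q_j}$, let $\alpha_m(b)=\theta_m(-b)+\theta_m\bigl(b-\tfrac{m}{q_j}\bigr)+\theta_m\bigl(\tfrac{m}{q_j}\bigr)-N_m$. - If $J'_b=\{j\}$ and $b=\tfrac{m}{q_j}$, let $\alpha_m(b)=2\,\theta_m\bigl(\tfrac{m\varphi(q_j)}{2q_j}\bigr)+\theta_m\bigl(\tfrac{m}{p_j}\bigr)-N_m$. Let $S''_m$ be the additive group generated by the elements $\alpha_m(a)$, $a\in M'_m$, together with $\tfrac12N_m$. Then $S''_m$ is a subgroup of $S'_m$, the elements $\alpha_m(a)$ ($a\in M'_m$) together with $\tfrac12N_m$ form a $\mathbb{Z}$-basis of $S''_m$ (in particular, they are pairwise distinct), and the index of $S''_m$ in $S'_m$ is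 finite and equal to $$[S'_m:S''_m]=\begin{cases}\tfrac m2&\text{if $m$ is even},\\ m&\text{if $m$ is odd}.\end{cases}$$ -/

import Mathlib

namespace ShortStickelberger

noncomputable section

/-- The `m`-th cyclotomic field `ℚ(ζ_m) ⊆ ℂ`, where `ζ_m = exp (2πi/m)`. -/
abbrev Cyc (m : ℕ) : IntermediateField ℚ ℂ :=
  IntermediateField.adjoin ℚ {Complex.exp (2 * Real.pi * Complex.I / m)}

/-- The Galois group `G_m` of `ℚ(ζ_m)` over `ℚ`. -/
abbrev GalCyc (m : ℕ) : Type := Gal(Cyc m/ℚ)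

instance isCyclotomicExtension_cyc (m : ℕ) [NeZero m] : IsCyclotomicExtension {m} ℚ (Cyc m) := by
  have hζ := Complex.isPrimitiveRoot_exp m (NeZero.ne m)
  change IsCyclotomicExtension {m} ℚ (Cyc m).toSubalgebra
  rw [IntermediateField.adjoin_simple_toSubalgebra_of_isAlgebraic
    (hζ.isIntegral (NeZero.pos m)).tower_top.isAlgebraic]
  exact hζ.adjoin_isCyclotomicExtension ℚ

instance numberField_cyc (m : ℕ) [NeZero m] : NumberField (Cyc m) :=
  IsCyclotomicExtension.numberField {m} ℚ (Cyc m)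

instance isGalois_cyc (m : ℕ) [NeZero m] : IsGalois ℚ (Cyc m) :=
  IsCyclotomicExtension.isGalois {m} ℚ (Cyc m)

/-- For `s` prime to `m`, the automorphism `σ_s` of `ℚ(ζ_m)` raising every `m`-th root of unity
to its `s`-th power (see `sigma_apply`); the identity if `s` is not prime to `m`. -/
def sigma (m : ℕ) [NeZero m] (s : ℕ) : GalCyc m :=
  if h : s.Coprime m then
    (IsCyclotomicExtension.autEquivPow (Cyc m)
      (Polynomial.cyclotomic.irreducible_rat (NeZero.pos m))).symm (ZMod.unitOfCoprime s h)
  else 1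

theorem sigma_apply (m : ℕ) [NeZero m] (s : ℕ) (h : s.Coprime m) (z : Cyc m) (hz : z ^ m = 1) :
    sigma m s z = z ^ s := by
  have hζ := IsCyclotomicExtension.zeta_spec m ℚ (Cyc m)
  have key : sigma m s (IsCyclotomicExtension.zeta m ℚ (Cyc m))
      = IsCyclotomicExtension.zeta m ℚ (Cyc m) ^ s := by
    rw [sigma, dif_pos h]
    have h1 := hζ.autToPow_spec ℚ ((IsCyclotomicExtension.autEquivPow (Cyc m)
      (Polynomial.cyclotomic.irreducible_rat (NeZero.pos m))).symm (ZMod.unitOfCoprime s h))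
    rw [← h1]
    have h2 := (IsCyclotomicExtension.autEquivPow (Cyc m)
      (Polynomial.cyclotomic.irreducible_rat (NeZero.pos m))).apply_symm_apply
        (ZMod.unitOfCoprime s h)
    change hζ.autToPow ℚ _ = _ at h2
    rw [h2, ZMod.coe_unitOfCoprime, ZMod.val_natCast]
    exact (pow_eq_pow_mod s hζ.pow_eq_one).symm
  obtain ⟨i, -, rfl⟩ := hζ.eq_pow_of_pow_eq_one hz
  rw [map_pow, key, ← pow_mul, ← pow_mul, mul_comm]

theorem cyc_le {d m : ℕ} [NeZero m] (h : d ∣ m) : Cyc d ≤ Cyc m := by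
  obtain ⟨k, rfl⟩ := h
  have hd : (d : ℂ) ≠ 0 := by
    have := NeZero.ne (d * k)
    exact_mod_cast left_ne_zero_of_mul this
  have hk : (k : ℂ) ≠ 0 := by
    have := NeZero.ne (d * k)
    exact_mod_cast right_ne_zero_of_mul this
  rw [IntermediateField.adjoin_simple_le_iff]
  have : Complex.exp (2 * Real.pi * Complex.I / d)
      = Complex.exp (2 * Real.pi * Complex.I / (d * k : ℕ)) ^ k := by
    rw [← Complex.exp_nat_mul]
    congr 1
    push_cast
    field_simp
  rw [this]
  exact pow_mem (IntermediateField.mem_adjoin_simple_self ℚ _) k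

/-- For `d ∣ m`, the field `ℚ(ζ_m)` as an extension of its subfield `ℚ(ζ_d)`. -/
abbrev cycAlgebra {d m : ℕ} [NeZero m] (h : d ∣ m) : Algebra (Cyc d) (Cyc m) :=
  (IntermediateField.inclusion (cyc_le h)).toRingHom.toAlgebra

/-- Restriction `G_m → G_d`, `σ ↦ σ|_{ℚ(ζ_d)}`, for `d ∣ m` (see `resGal_apply`). -/
def resGal {d m : ℕ} [NeZero d] [NeZero m] (h : d ∣ m) : GalCyc m →* GalCyc d :=
  letI := cycAlgebra h
  AlgEquiv.restrictNormalHom (Cyc d)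

theorem resGal_apply {d m : ℕ} [NeZero d] [NeZero m] (h : d ∣ m) (σ : GalCyc m) (x : Cyc d) :
    (resGal h σ x : ℂ) = σ ⟨x, cyc_le h x.2⟩ := by
  let := cycAlgebra h
  have key : algebraMap (Cyc d) (Cyc m) (σ.restrictNormal (Cyc d) x) =
    σ (algebraMap (Cyc d) (Cyc m) x) := AlgEquiv.restrictNormal_commutes σ (Cyc d) x
  have h1 : resGal h σ = σ.restrictNormal (Cyc d) := rfl
  have h2 : ∀ y : Cyc d, algebraMap (Cyc d) (Cyc m) y = ⟨y, cyc_le h y.2⟩ := fun _ => rfl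
  rw [h2, h2] at key
  rw [h1, ← key]

/-- The restriction map `res : ℚ[G_m] → ℚ[G_d]`, for `d ∣ m`. -/
def res {d m : ℕ} [NeZero d] [NeZero m] (h : d ∣ m) :
    MonoidAlgebra ℚ (GalCyc m) →+* MonoidAlgebra ℚ (GalCyc d) :=
  MonoidAlgebra.mapDomainRingHom ℚ (resGal h)

open scoped Classical in
/-- The corestriction map `cor : ℚ[G_d] → ℚ[G_m]`, for `d ∣ m`: the linear map sending `τ` to the
sum of all `σ ∈ G_m` that restrict to `τ`. -/
def cor {d m : ℕ} [NeZero d] [NeZero m] (h : d ∣ m) :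
    MonoidAlgebra ℚ (GalCyc d) →ₗ[ℚ] MonoidAlgebra ℚ (GalCyc m) :=
  (Finsupp.linearCombination ℚ fun τ : GalCyc d =>
      ∑ σ : GalCyc m with resGal h σ = τ, MonoidAlgebra.single σ (1 : ℚ)) ∘ₗ
    (MonoidAlgebra.coeffLinearEquiv ℚ).toLinearMap

/-- The element `θ_m(a) = ∑ ⟨-as/m⟩ σ_s⁻¹` of `ℚ[G_m]`, the sum being over the `s` with
`0 < s ≤ m` and `(s, m) = 1`. -/
def theta (m : ℕ) [NeZero m] (a : ℤ) : MonoidAlgebra ℚ (GalCyc m) :=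
  ∑ s ∈ Finset.Ioc 0 m with s.Coprime m,
    MonoidAlgebra.single (sigma m s)⁻¹ (Int.fract (-((a : ℚ) * s / m)))

/-- The absolute norm element `N_m = ∑_{τ ∈ G_m} τ`. -/
def normElt (m : ℕ) [NeZero m] : MonoidAlgebra ℚ (GalCyc m) :=
  ∑ τ : GalCyc m, MonoidAlgebra.single τ 1

/-- The element `θ_n^{(m)}(a) = cor (res (θ_n(a)))` of `ℚ[G_m]`, where `res` goes from `ℚ(ζ_n)`
down to `ℚ(ζ_d)` and `cor` from there up to `ℚ(ζ_m)`, with `d = (m, n)`. -/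
def thetaCor (m n : ℕ) [NeZero m] [NeZero n] (a : ℤ) : MonoidAlgebra ℚ (GalCyc m) :=
  haveI : NeZero (m.gcd n) := ⟨(Nat.gcd_pos_of_pos_left n (NeZero.pos m)).ne'⟩
  cor (Nat.gcd_dvd_left m n) (res (Nat.gcd_dvd_right m n) (theta n a))

/-- Sinnott's group `S'_m`. -/
def SPrime (m : ℕ) [NeZero m] : AddSubgroup (MonoidAlgebra ℚ (GalCyc m)) :=
  AddSubgroup.closure {x | ∃ (n : ℕ) (_ : NeZero n) (a : ℤ), x = thetaCor m n a}

/-- `X_m`: the integers `0 < a < m` with `(a, m / (a, m)) = 1`. -/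
def X (m : ℕ) : Set ℕ :=
  {a | 0 < a ∧ a < m ∧ a.Coprime (m / a.gcd m)}

variable {t : ℕ}

/-- `q` lists, in some order, the maximal prime power factors `q_1, …, q_t` of `m`, all of them
greater than `2`. -/
structure IsOrderedFactorization (m : ℕ) (q : Fin t → ℕ) : Prop where
  isPrimePow : ∀ i, IsPrimePow (q i)
  two_lt : ∀ i, 2 < q i
  coprime : Pairwise fun i j => (q i).Coprime (q j)
  prod_eq : ∏ i, q i = m

/-- `J_b = {i : q_i ∣ b}`. -/
def J (q : Fin t → ℕ) (b : ℕ) : Finset (Fin t) := {i | q i ∣ b}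

/-- `J'_b = {i : q_i ∤ b}`. -/
def J' (q : Fin t → ℕ) (b : ℕ) : Finset (Fin t) := {i | ¬ q i ∣ b}

/-- `r_b`: the product of the `q_i` that divide `b`. -/
def rPart (q : Fin t → ℕ) (b : ℕ) : ℕ := ∏ i ∈ J q b, q i

/-- The set `M_m`. -/
def M (m : ℕ) (q : Fin t → ℕ) : Set ℕ :=
  {a | a ∈ X m ∧
    (∀ i, ¬ q i ∣ a → ¬ (a : ℤ) ≡ -(a.gcd m : ℤ) [ZMOD q i]) ∧
    (¬ a ∣ m → ∀ k, IsGreatest {i | ¬ a ≡ a.gcd m [MOD q i]} k →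
      Int.fract ((a : ℚ) / (a.gcd m * q k)) < 1 / 2) ∧
    (a ∣ m → Odd (J' q a).card)}

/-- The set `M'_m`. -/
def M' (m : ℕ) (q : Fin t → ℕ) : Set ℕ :=
  {a | a ∈ M m q ∧ ∀ i, ¬ m / q i ∣ a} ∪
    ⋃ i, {a | ∃ b : ℕ, 1 ≤ b ∧ b ≤ (q i).totient / 2 ∧ a = m / q i * b}

/-- The element `α_m(b)`, for `0 < b < m` (zero if every `q_i` divides `b`). In the first case the
solution of `u x + v y = -1` is the one that the extended Euclidean algorithm provides; any other
solution gives the same element (see `alpha_eq`). -/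
def alpha (m : ℕ) [NeZero m] (q : Fin t → ℕ) (b : ℕ) : MonoidAlgebra ℚ (GalCyc m) :=
  if h : (J' q b).Nonempty then
    let j := (J' q b).min' h
    if 1 < (J' q b).card then
      let u := q j
      let v := m / (u * rPart q b)
      let x := -Nat.gcdA u v
      let y := -Nat.gcdB u v
      theta m b + theta m (b * u * x) + theta m (b * v * y) - normElt m
    else if b = m / q j then
      (2 : ℚ) • theta m (m / q j * ((q j).totient / 2) : ℕ) + theta m (m / (q j).minFac : ℕ)
        - normElt m
    else
      theta m (-b) + theta m (b - (m / q j : ℕ)) + theta m (m / q j : ℕ) - normElt m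
  else 0

/-- The group `S''_m`, generated by the `α_m(a)`, `a ∈ M'_m`, and `½ N_m`. -/
def SDoublePrime (m : ℕ) [NeZero m] (q : Fin t → ℕ) : AddSubgroup (MonoidAlgebra ℚ (GalCyc m)) :=
  AddSubgroup.closure (alpha m q '' M' m q ∪ {(1 / 2 : ℚ) • normElt m})

theorem theta_congr (m : ℕ) [NeZero m] {a b : ℤ} (h : a ≡ b [ZMOD m]) : theta m a = theta m b := by
  obtain ⟨k, hk⟩ := h.dvd
  have hm : (m : ℚ) ≠ 0 := by exact_mod_cast NeZero.ne m
  refine Finset.sum_congr rfl fun s _ => ?_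
  have hb : b = a + m * k := by linarith
  congr 1
  rw [Int.fract_eq_fract]
  refine ⟨k * s, ?_⟩
  rw [hb]
  push_cast
  field_simp
  ring

theorem mul_rPart_dvd {m : ℕ} {q : Fin t → ℕ} (hq : IsOrderedFactorization m q) (b : ℕ)
    (j : Fin t) (hj : j ∈ J' q b) : q j * rPart q b ∣ m := by
  have hjJ : j ∉ J q b := by simpa [J, J'] using hj
  rw [rPart, ← Finset.prod_insert hjJ, ← hq.prod_eq]
  exact Finset.prod_dvd_prod_of_subset _ _ _ (Finset.subset_univ _)

theorem coprime_cofactor {m : ℕ} {q : Fin t → ℕ} (hq : IsOrderedFactorization m q) (b : ℕ)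
    (j : Fin t) (hj : j ∈ J' q b) : (q j).Coprime (m / (q j * rPart q b)) := by
  have hjJ : j ∉ J q b := by simpa [J, J'] using hj
  have hpos : 0 < q j * rPart q b :=
    Nat.mul_pos (by have := hq.two_lt j; omega)
      (Finset.prod_pos fun i _ => by have := hq.two_lt i; omega)
  have hm : m = (q j * rPart q b) * ∏ i ∈ (insert j (J q b))ᶜ, q i := by
    rw [rPart, ← Finset.prod_insert hjJ, Finset.prod_mul_prod_compl, hq.prod_eq]
  rw [hm, Nat.mul_div_cancel_left _ hpos]
  refine Nat.Coprime.prod_right fun i hi => hq.coprime ?_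
  rintro rfl
  simp at hi

theorem rPart_dvd {m : ℕ} {q : Fin t → ℕ} (hq : IsOrderedFactorization m q) (b : ℕ) :
    rPart q b ∣ b :=
  Finset.prod_dvd_of_isRelPrime
    (fun _ _ _ _ hij => Nat.coprime_iff_isRelPrime.mp (hq.coprime hij))
    fun i hi => by simpa [J] using hi

/-- `α_m(b)` does not depend on the chosen solution of `u x + v y = -1`. -/
theorem alpha_eq {m : ℕ} [NeZero m] {q : Fin t → ℕ} (hq : IsOrderedFactorization m q) (b : ℕ)
    (h : (J' q b).Nonempty) (hc : 1 < (J' q b).card) (u v : ℕ) (hu : u = q ((J' q b).min' h))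
    (hv : v = m / (u * rPart q b)) (x y : ℤ) (hxy : u * x + v * y = -1) :
    alpha m q b = theta m b + theta m (b * u * x) + theta m (b * v * y) - normElt m := by
  have hj := Finset.min'_mem _ h
  have hm : m = u * rPart q b * v := by
    rw [hv, hu, Nat.mul_div_cancel' (mul_rPart_dvd hq b _ hj)]
  have hcop : u.Coprime v := by
    rw [hv, hu]; exact coprime_cofactor hq b _ hj
  obtain ⟨c, hcb⟩ := rPart_dvd hq b
  have hbez : (1 : ℤ) = u * Nat.gcdA u v + v * Nat.gcdB u v := by
    rw [← Nat.gcd_eq_gcd_ab, hcop.gcd_eq_one, Nat.cast_one]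
  have hsum : (u : ℤ) * (x + Nat.gcdA u v) = -(v * (y + Nat.gcdB u v)) := by linarith
  have hicop : IsCoprime (u : ℤ) v := Nat.isCoprime_iff_coprime.mpr hcop
  have hvx : (v : ℤ) ∣ x + Nat.gcdA u v :=
    hicop.symm.dvd_of_dvd_mul_left ⟨-(y + Nat.gcdB u v), by rw [hsum]; ring⟩
  have huy : (u : ℤ) ∣ y + Nat.gcdB u v :=
    hicop.dvd_of_dvd_mul_left ⟨-(x + Nat.gcdA u v), by linarith⟩
  have e1 : (b : ℤ) * u * -Nat.gcdA u v ≡ b * u * x [ZMOD m] := by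
    rw [Int.modEq_iff_dvd]
    obtain ⟨k, hk⟩ := hvx
    refine ⟨c * k, ?_⟩
    have : (b : ℤ) * u * x - b * u * -Nat.gcdA u v = b * u * (x + Nat.gcdA u v) := by ring
    rw [this, hk, hm]
    nth_rewrite 1 [hcb]
    push_cast
    ring
  have e2 : (b : ℤ) * v * -Nat.gcdB u v ≡ b * v * y [ZMOD m] := by
    rw [Int.modEq_iff_dvd]
    obtain ⟨k, hk⟩ := huy
    refine ⟨c * k, ?_⟩
    have : (b : ℤ) * v * y - b * v * -Nat.gcdB u v = b * v * (y + Nat.gcdB u v) := by ring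
    rw [this, hk, hm]
    nth_rewrite 1 [hcb]
    push_cast
    ring
  rw [alpha, dif_pos h, if_pos hc]
  simp only [← hu, ← hv]
  rw [theta_congr m e1, theta_congr m e2]

end

end ShortStickelberger

/-! Let κ(x) be twice the coefficient of x at the identity, modulo 1. Then κ(½N) = 0 and κ(θ(a)) =
-2a/m, so the image of S' under κ is cyclic of order m/(2,m), the asserted index. It remains to see
that S'' is the kernel of κ on S' (`SDoublePrime_eq`) and that the given generators are independent.

First, S' is generated by the θ_m(a) and ½N alone (`SPrime_eq_thetaGroup`): Möbius inversion and the
distribution relation for fractional parts express each cor(res θ_n(a)) through them. The arguments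
of the θ's in each α add up to 0 or to m, so S'' lies in the kernel. Conversely, S' = S'' + Σ ℤ
θ(m/q_j) (`exists_eq_add_sum`), and q_j θ(m/q_j), or half of it for even q_j, lies in S''
(`nsmul_theta_mem`). If Σ n_j θ(m/q_j) is in the kernel, then m divides 2 Σ n_j m/q_j, hence q_j
divides 2 n_j for all j, as the q_j are coprime.

The main work is this generation statement. Distribution relations reduce it to those a that are
zero or a unit modulo each q_i, that is, to points with coordinates in (ℤ/q_i)ˣ ∪ {0}. There the
elements θ(a) - ½N form an odd distribution, and modulo values at smaller supports every point is
reduced to one that corresponds to an element of M_m (`OddDistribution.mem_of_isReduced`). The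
delicate case is the point with an even number of coordinates 1 and the rest 0. Oddness and the
distribution relations, used directly, only put twice its value in the subgroup. A Koszul-type chain
on which every odd torsion-free distribution vanishes, and in which the points with coordinates ±1
occur with odd total multiplicity, removes the factor 2 (`OddDistribution.onePoint_mem`).

For independence, the rational span of S'' contains N and all θ(a), and the non-vanishing of L(1,χ)
for odd χ makes its dimension at least φ(m)/2 + 1 (`totient_lt_two_mul_finrank`). An injection into
codes that a sign flip carries to non-codes gives |M'_m| ≤ φ(m)/2 (`two_mul_card_M'_le`). So there
are no more generators than the rank. -/

namespace ShortStickelberger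

noncomputable section

set_option linter.unusedSectionVars false

open Function Finset

/-! ### Points with coordinates in groups with zero, and operators on chains of points -/

section Points

variable {ι : Type*} {G : ι → Type*}

/-- The set of the nonzero coordinates of a point. -/
def supp [Fintype ι] (y : ∀ i, WithZero (G i)) : Finset ι :=
  letI := Classical.decPred fun i => y i ≠ 0
  {i | y i ≠ 0}

theorem mem_supp [Fintype ι] {y : ∀ i, WithZero (G i)} {i : ι} : i ∈ supp y ↔ y i ≠ 0 := by
  simp [supp]

variable [∀ i, CommGroup (G i)]

/-- Coordinatewise multiplication of a point, some of whose coordinates may be zero. -/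
def act (u : ∀ i, G i) (y : ∀ i, WithZero (G i)) : ∀ i, WithZero (G i) :=
  fun i => (u i : WithZero (G i)) * y i

theorem act_act (u v : ∀ i, G i) (y : ∀ i, WithZero (G i)) :
    act u (act v y) = act v (act u y) := by
  funext i
  simp only [act]
  rw [mul_left_comm]

theorem act_apply_eq_zero_iff (u : ∀ i, G i) (y : ∀ i, WithZero (G i)) (i : ι) :
    act u y i = 0 ↔ y i = 0 := by
  simp [act]

theorem act_eq_zero_iff (u : ∀ i, G i) (y : ∀ i, WithZero (G i)) : act u y = 0 ↔ y = 0 := by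
  simp [funext_iff, act]

theorem act_injective (u : ∀ i, G i) : Injective (act u) := by
  intro y z h
  funext i
  have := congrFun h i
  simp only [act] at this
  exact mul_left_cancel₀ WithZero.coe_ne_zero this

theorem supp_act [Fintype ι] (u : ∀ i, G i) (y : ∀ i, WithZero (G i)) :
    supp (act u y) = supp y := by
  ext i
  simp [mem_supp, act_apply_eq_zero_iff]

variable [DecidableEq ι]

theorem act_update (u : ∀ i, G i) (y : ∀ i, WithZero (G i)) (i : ι) (x : WithZero (G i)) :
    act u (update y i x) = update (act u y) i (u i * x) := by
  funext l
  by_cases h : l = i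
  · subst h; simp [act]
  · simp [act, h]

theorem act_update_zero (u : ∀ i, G i) (y : ∀ i, WithZero (G i)) (i : ι) :
    act u (update y i 0) = update (act u y) i 0 := by
  rw [act_update, mul_zero]

theorem supp_update_zero [Fintype ι] (y : ∀ i, WithZero (G i)) (i : ι) :
    supp (update y i 0) = (supp y).erase i := by
  ext l
  by_cases h : l = i
  · subst h; simp [mem_supp]
  · simp [mem_supp, h]

theorem supp_update_coe [Fintype ι] (y : ∀ i, WithZero (G i)) (i : ι) (g : G i) :
    supp (update y i (g : WithZero (G i))) = insert i (supp y) := by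
  ext l
  by_cases h : l = i
  · subst h; simp [mem_supp]
  · simp [mem_supp, h]

end Points

section Chains

variable {ι : Type*} [DecidableEq ι] {G : ι → Type*} [∀ i, CommGroup (G i)] [∀ i, Fintype (G i)]

/-- Setting the `i`-th coordinate to zero. -/
def zeroOp (i : ι) : Module.End ℤ ((∀ i, WithZero (G i)) →₀ ℤ) :=
  Finsupp.lmapDomain ℤ ℤ fun y => update y i 0

/-- The action of `u` on chains. -/
def actOp (u : ∀ i, G i) : Module.End ℤ ((∀ i, WithZero (G i)) →₀ ℤ) :=
  Finsupp.lmapDomain ℤ ℤ (act u)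

/-- Summation over all units in the `i`-th coordinate. -/
def sumOp (i : ι) : Module.End ℤ ((∀ i, WithZero (G i)) →₀ ℤ) :=
  ∑ g : G i, Finsupp.lmapDomain ℤ ℤ fun y => update y i (g : WithZero (G i))

theorem zeroOp_single (i : ι) (y : ∀ i, WithZero (G i)) (c : ℤ) :
    zeroOp i (Finsupp.single y c) = Finsupp.single (update y i 0) c := by
  simp [zeroOp, Finsupp.mapDomain_single]

theorem actOp_single (u : ∀ i, G i) (y : ∀ i, WithZero (G i)) (c : ℤ) :
    actOp u (Finsupp.single y c) = Finsupp.single (act u y) c := by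
  simp [actOp, Finsupp.mapDomain_single]

theorem sumOp_single (i : ι) (y : ∀ i, WithZero (G i)) (c : ℤ) :
    sumOp i (Finsupp.single y c)
      = ∑ g : G i, Finsupp.single (update y i (g : WithZero (G i))) c := by
  simp [sumOp, Finsupp.mapDomain_single]

theorem commute_of_single {A B : Module.End ℤ ((∀ i, WithZero (G i)) →₀ ℤ)}
    (h : ∀ y, A (B (Finsupp.single y 1)) = B (A (Finsupp.single y 1))) : Commute A B := by
  refine Finsupp.lhom_ext' fun y => LinearMap.ext_ring ?_
  simpa using h y

theorem commute_zeroOp (i l : ι) : Commute (zeroOp (G := G) i) (zeroOp l) := by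
  refine commute_of_single fun y => ?_
  simp only [zeroOp_single]
  by_cases h : i = l
  · subst h; rfl
  · rw [update_comm h]

theorem commute_actOp (u v : ∀ i, G i) : Commute (actOp u) (actOp v) := by
  refine commute_of_single fun y => ?_
  simp only [actOp_single, act_act u v]

theorem commute_actOp_zeroOp (u : ∀ i, G i) (i : ι) : Commute (actOp u) (zeroOp i) := by
  refine commute_of_single fun y => ?_
  simp only [actOp_single, zeroOp_single, act_update_zero]

theorem commute_sumOp_zeroOp {i l : ι} (h : i ≠ l) :
    Commute (sumOp (G := G) i) (zeroOp l) := by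
  refine commute_of_single fun y => ?_
  simp only [sumOp_single, zeroOp_single, map_sum]
  exact sum_congr rfl fun g _ => by rw [update_comm h]

theorem commute_actOp_sumOp (u : ∀ i, G i) (i : ι) : Commute (actOp u) (sumOp i) := by
  refine commute_of_single fun y => ?_
  simp only [sumOp_single, actOp_single, map_sum, act_update]
  exact Fintype.sum_equiv (Equiv.mulLeft (u i)) _ _ fun g => by simp

theorem commute_sumOp {i l : ι} (h : i ≠ l) : Commute (sumOp (G := G) i) (sumOp l) := by
  refine commute_of_single fun y => ?_
  simp only [sumOp_single, map_sum]
  rw [sum_comm]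
  exact sum_congr rfl fun g _ => sum_congr rfl fun g' _ => by rw [update_comm h]

end Chains

/-! ### Koszul signs -/

section Sign

variable {ι : Type*} [LinearOrder ι]

/-- The sign of the position of `i` in `S`. -/
def posSign (i : ι) (S : Finset ι) : ℤ := (-1) ^ #{l ∈ S | l < i}

/-- Deleting the smaller index lowers the position of the larger one by one; deleting the larger
leaves the position of the smaller unchanged. -/
theorem posSign_mul_posSign_of_lt {S : Finset ι} {i l : ι} (hi : i ∈ S) (h : i < l) :
    posSign i S * posSign l (S.erase i) = -(posSign l S * posSign i (S.erase l)) := by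
  have h1 : {k ∈ S.erase l | k < i} = {k ∈ S | k < i} := by
    ext k
    simp only [mem_filter, mem_erase]
    constructor
    · rintro ⟨⟨_, h1⟩, h2⟩; exact ⟨h1, h2⟩
    · rintro ⟨h1, h2⟩; exact ⟨⟨(h2.trans h).ne, h1⟩, h2⟩
  have h2 : {k ∈ S.erase i | k < l} = ({k ∈ S | k < l}).erase i := by
    rw [filter_erase]
  have h3 : #{k ∈ S | k < l} = #(({k ∈ S | k < l}).erase i) + 1 :=
    (card_erase_add_one (by simp [hi, h])).symm
  rw [posSign, posSign, posSign, posSign, h1, h2, h3, pow_succ]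
  ring

theorem posSign_mul_posSign {S : Finset ι} {i l : ι} (hi : i ∈ S) (hl : l ∈ S) (h : i ≠ l) :
    posSign i S * posSign l (S.erase i) = -(posSign l S * posSign i (S.erase l)) := by
  rcases lt_or_gt_of_ne h with h | h
  · exact posSign_mul_posSign_of_lt hi h
  · rw [posSign_mul_posSign_of_lt hl h, neg_neg]

/-- The square of a Koszul differential vanishes. -/
theorem sum_posSign_smul_sum_posSign_smul {C : Type*} [AddCommGroup C]
    (D : ι → Module.End ℤ C) (hD : ∀ i l, i ≠ l → Commute (D i) (D l)) (x : Finset ι → C)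
    (S : Finset ι) :
    ∑ i ∈ S, posSign i S • D i (∑ l ∈ S.erase i,
      posSign l (S.erase i) • D l (x ((S.erase i).erase l))) = 0 := by
  simp only [map_sum, map_smul, smul_sum, smul_smul]
  rw [sum_sigma']
  -- Exchanging the two deleted indices flips the sign, while the operators commute.
  refine sum_involution (fun a _ => ⟨a.2, a.1⟩) ?_ ?_ ?_ ?_
  · rintro ⟨i, l⟩ ha
    simp only [mem_sigma, mem_erase] at ha
    obtain ⟨hi, hli, hl⟩ := ha
    have hc : D i (D l (x ((S.erase i).erase l))) = D l (D i (x ((S.erase i).erase l))) :=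
      LinearMap.congr_fun (hD i l (Ne.symm hli)) _
    simp only [posSign_mul_posSign hi hl (Ne.symm hli), hc, neg_smul]
    rw [erase_right_comm (a := i) (b := l), neg_add_cancel]
  · rintro ⟨i, l⟩ ha _ h
    simp only [mem_sigma, mem_erase] at ha
    simp only [Sigma.mk.injEq] at h
    exact ha.2.1 h.1
  · rintro ⟨i, l⟩ ha
    simp only [mem_sigma, mem_erase] at ha ⊢
    exact ⟨ha.2.2, Ne.symm ha.2.1, ha.1⟩
  · rintro ⟨i, l⟩ ha
    rfl

end Sign

end

end ShortStickelberger

/-! ### Odd distributions and the Koszul chains on which they vanish -/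

namespace ShortStickelberger

noncomputable section

set_option linter.unusedSectionVars false

open Function Finset

/-- An odd distribution on the points `y`, each of whose coordinates is zero or an element of
`G i`: it changes its sign under `neg`, and its sums over all units in one coordinate are values
at points with fewer nonzero coordinates. Each `low i` is a set of representatives of
`G i / {1, neg i}`. -/
structure OddDistribution {ι : Type*} [DecidableEq ι] (G : ι → Type*) [∀ i, CommGroup (G i)]
    [∀ i, Fintype (G i)] (V : Type*) [AddCommGroup V] where
  neg : ∀ i, G i
  neg_mul_neg : ∀ i, neg i * neg i = 1
  low : ∀ i, Set (G i)
  one_mem_low : ∀ i, 1 ∈ low i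
  neg_mul_mem_low : ∀ i g, neg i * g ∈ low i ↔ g ∉ low i
  frob : ι → ∀ i, G i
  toFun : (∀ i, WithZero (G i)) → V
  map_neg : ∀ y, toFun (act neg y) = -toFun y
  sum_update : ∀ y i, ∑ g : G i, toFun (update y i (g : WithZero (G i)))
    = toFun (update y i 0) - toFun (act (frob i) (update y i 0))

namespace OddDistribution

variable {ι : Type*} [LinearOrder ι] [Fintype ι] {G : ι → Type*} [∀ i, CommGroup (G i)]
  [∀ i, Fintype (G i)] {V : Type*} [AddCommGroup V] (θ : OddDistribution G V)

theorem neg_not_mem_low (i : ι) : θ.neg i ∉ θ.low i := by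
  have := (θ.neg_mul_mem_low i (θ.neg i)).1
  rw [θ.neg_mul_neg] at this
  exact this (θ.one_mem_low i)

theorem neg_ne_one (i : ι) : θ.neg i ≠ 1 := fun h =>
  θ.neg_not_mem_low i (h ▸ θ.one_mem_low i)

theorem act_neg_act_neg (y : ∀ i, WithZero (G i)) : act θ.neg (act θ.neg y) = y := by
  funext i
  simp only [act]
  rw [← mul_assoc, ← WithZero.coe_mul, θ.neg_mul_neg, WithZero.coe_one, one_mul]

/-- The points whose first nonzero coordinate lies in `low`. -/
def IsFirstLow (y : ∀ i, WithZero (G i)) : Prop :=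
  ∃ i, ∃ g ∈ θ.low i, y i = (g : WithZero (G i)) ∧ ∀ l < i, y l = 0

theorem not_isFirstLow_zero : ¬ θ.IsFirstLow 0 := by
  rintro ⟨i, g, _, h, _⟩
  exact WithZero.coe_ne_zero h.symm

theorem exists_first {y : ∀ i, WithZero (G i)} (hy : y ≠ 0) :
    ∃ i, ∃ g : G i, y i = g ∧ ∀ l < i, y l = 0 := by
  have hne : (supp y).Nonempty := by
    by_contra h
    rw [not_nonempty_iff_eq_empty] at h
    refine hy (funext fun i => ?_)
    by_contra hi
    have := mem_supp.2 hi
    rw [h] at this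
    simp at this
  have h1 := mem_supp.1 ((supp y).min'_mem hne)
  obtain ⟨g, hg⟩ := WithZero.ne_zero_iff_exists.1 h1
  refine ⟨_, g, hg.symm, fun l hl => ?_⟩
  by_contra hl0
  exact absurd ((supp y).min'_le l (mem_supp.2 hl0)) (not_le.2 hl)

theorem isFirstLow_iff {y : ∀ i, WithZero (G i)} {i : ι} {g : G i} (h : y i = g)
    (h0 : ∀ l < i, y l = 0) : θ.IsFirstLow y ↔ g ∈ θ.low i := by
  constructor
  · rintro ⟨k, g', hg', hk, hk0⟩
    have hki : k = i := by
      rcases lt_trichotomy k i with h1 | h1 | h1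
      · exact absurd (hk.symm.trans (h0 k h1)) WithZero.coe_ne_zero
      · exact h1
      · exact absurd (h.symm.trans (hk0 i h1)) WithZero.coe_ne_zero
    subst hki
    rw [h, WithZero.coe_inj] at hk
    rwa [hk]
  · exact fun hg => ⟨i, g, hg, h, h0⟩

/-- Thus the first-low points form a fundamental domain for `neg` on the nonzero points. -/
theorem isFirstLow_act_neg {y : ∀ i, WithZero (G i)} (hy : y ≠ 0) :
    θ.IsFirstLow (act θ.neg y) ↔ ¬ θ.IsFirstLow y := by
  obtain ⟨i, g, hg, h0⟩ := exists_first hy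
  rw [θ.isFirstLow_iff hg h0, θ.isFirstLow_iff (i := i) (g := θ.neg i * g) (by simp [act, hg])
    (fun l hl => by simp [act, h0 l hl]), θ.neg_mul_mem_low]

/-- The operator on chains that expresses the relation `sum_update`. -/
def D (i : ι) : Module.End ℤ ((∀ i, WithZero (G i)) →₀ ℤ) :=
  zeroOp i - actOp (θ.frob i) * zeroOp i - sumOp i

theorem commute_D {i l : ι} (h : i ≠ l) : Commute (θ.D i) (θ.D l) := by
  have h1 : ∀ k, Commute (zeroOp (G := G) i - actOp (θ.frob i) * zeroOp i)
      (zeroOp k - actOp (θ.frob k) * zeroOp k) := fun k =>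
    .sub_left
      (.sub_right (commute_zeroOp i k)
        (.mul_right (commute_actOp_zeroOp _ _).symm (commute_zeroOp i k)))
      (.mul_left (.sub_right (commute_actOp_zeroOp _ _)
        (.mul_right (commute_actOp _ _) (commute_actOp_zeroOp _ _)))
      (.sub_right (commute_zeroOp i k)
        (.mul_right (commute_actOp_zeroOp _ _).symm (commute_zeroOp i k))))
  have h2 : ∀ k k', k ≠ k' → Commute (sumOp (G := G) k)
      (zeroOp k' - actOp (θ.frob k') * zeroOp k') := fun k k' hk =>
    .sub_right (commute_sumOp_zeroOp hk)
      (.mul_right (commute_actOp_sumOp _ _).symm (commute_sumOp_zeroOp hk))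
  exact .sub_left (.sub_right (h1 l) (h2 l i h.symm).symm) (.sub_right (h2 i l h) (commute_sumOp h))

theorem commute_actOp_D (u : ∀ i, G i) (i : ι) : Commute (actOp u) (θ.D i) :=
  .sub_right (.sub_right (commute_actOp_zeroOp _ _)
    (.mul_right (commute_actOp _ _) (commute_actOp_zeroOp _ _))) (commute_actOp_sumOp _ _)

theorem D_single (i : ι) (y : ∀ i, WithZero (G i)) :
    θ.D i (Finsupp.single y 1) = Finsupp.single (update y i 0) 1
      - Finsupp.single (act (θ.frob i) (update y i 0)) 1
      - ∑ g : G i, Finsupp.single (update y i (g : WithZero (G i))) 1 := by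
  simp [D, zeroOp_single, actOp_single, sumOp_single]

/-- The extension of the distribution to chains. -/
def lift : ((∀ i, WithZero (G i)) →₀ ℤ) →ₗ[ℤ] V := Finsupp.linearCombination ℤ θ.toFun

theorem lift_D (i : ι) (x : (∀ i, WithZero (G i)) →₀ ℤ) : θ.lift (θ.D i x) = 0 := by
  have : θ.lift ∘ₗ θ.D i = 0 := by
    refine Finsupp.lhom_ext' fun y => LinearMap.ext_ring ?_
    simp only [LinearMap.comp_apply, Finsupp.lsingle_apply, D_single, map_sub, map_sum]
    simp [lift, θ.sum_update]
  exact LinearMap.congr_fun this x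

theorem lift_actOp_neg (x : (∀ i, WithZero (G i)) →₀ ℤ) :
    θ.lift (actOp θ.neg x) = -θ.lift x := by
  have : θ.lift ∘ₗ actOp θ.neg = -θ.lift := by
    refine Finsupp.lhom_ext' fun y => LinearMap.ext_ring ?_
    simp [actOp_single, lift, θ.map_neg]
  exact LinearMap.congr_fun this x

theorem actOp_neg_apply (x : (∀ i, WithZero (G i)) →₀ ℤ) (y : ∀ i, WithZero (G i)) :
    actOp θ.neg x y = x (act θ.neg y) := by
  conv_lhs => rw [← θ.act_neg_act_neg y]
  exact Finsupp.mapDomain_apply (act_injective _) _ _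

/-- Multiplication by `frob i` fixes 0 and nothing else goes to 0, so the first two terms of `D`
cancel there; the points in the third have a nonzero `i`-th coordinate. -/
theorem D_apply_zero (i : ι) (x : (∀ i, WithZero (G i)) →₀ ℤ) : θ.D i x 0 = 0 := by
  classical
  have : Finsupp.lapply (R := ℤ) (0 : ∀ i, WithZero (G i)) ∘ₗ θ.D i = 0 := by
    refine Finsupp.lhom_ext' fun y => LinearMap.ext_ring ?_
    have h : ∀ g : G i, update y i (g : WithZero (G i)) ≠ 0 := fun g h => by
      have := congrFun h i
      simp at this
    simp [D_single, Finsupp.single_apply, act_eq_zero_iff, h]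
  exact LinearMap.congr_fun this x

/-- The chains whose points have all nonzero coordinates in `S`. -/
def supportedOn (S : Finset ι) : Submodule ℤ ((∀ i, WithZero (G i)) →₀ ℤ) :=
  Finsupp.supported ℤ ℤ {y | supp y ⊆ S}

theorem D_mem_supportedOn {i : ι} {S : Finset ι} (hi : i ∈ S)
    {x : (∀ i, WithZero (G i)) →₀ ℤ} (hx : x ∈ supportedOn (G := G) (S.erase i)) :
    θ.D i x ∈ supportedOn S := by
  rw [supportedOn, Finsupp.supported_eq_span_single] at hx
  have hs : ∀ y : ∀ i, WithZero (G i), supp y ⊆ S →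
      Finsupp.single y (1 : ℤ) ∈ supportedOn (G := G) S :=
    fun y hy => Finsupp.single_mem_supported ℤ _ hy
  induction hx using Submodule.span_induction with
  | mem x hx =>
    obtain ⟨y, hy, rfl⟩ := hx
    have hy' : supp y ⊆ S := hy.trans (erase_subset _ _)
    rw [D_single]
    refine sub_mem (sub_mem (hs _ ?_) (hs _ ?_)) (sum_mem fun g _ => hs _ ?_)
    · rw [supp_update_zero]; exact (erase_subset _ _).trans hy'
    · rw [supp_act, supp_update_zero]; exact (erase_subset _ _).trans hy'
    · rw [supp_update_coe]; exact insert_subset hi hy'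
  | zero => rw [map_zero]; exact zero_mem _
  | add x y _ _ hx hy => rw [map_add]; exact add_mem hx hy
  | smul c x _ hx => rw [map_smul]; exact Submodule.smul_mem _ _ hx

/-- The first two terms of `D` live on points whose `i`-th coordinate is zero, so only the sum over
units reaches `y`. -/
theorem D_apply {i : ι} {S : Finset ι} (hi : i ∉ S) {x : (∀ i, WithZero (G i)) →₀ ℤ}
    (hx : x ∈ supportedOn (G := G) S) {y : ∀ i, WithZero (G i)} (hy : y i ≠ 0) :
    θ.D i x y = -x (update y i 0) := by
  classical
  obtain ⟨g, hg⟩ := WithZero.ne_zero_iff_exists.1 hy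
  rw [supportedOn, Finsupp.supported_eq_span_single] at hx
  induction hx using Submodule.span_induction with
  | mem x hx =>
    obtain ⟨z, hz, rfl⟩ := hx
    have hzi : z i = 0 := by
      by_contra h
      exact hi (hz (mem_supp.2 h))
    have hz' : update z i 0 = z := by rw [← hzi, update_eq_self]
    have h1 : z ≠ y := fun h => hy (h ▸ hzi)
    have h2 : act (θ.frob i) z ≠ y := fun h =>
      hy (h ▸ (act_apply_eq_zero_iff _ _ _).2 hzi)
    rw [D_single, hz']
    simp only [Finsupp.coe_sub, Pi.sub_apply, Finsupp.single_apply, if_neg h1, if_neg h2,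
      Finsupp.finsetSum_apply]
    rw [sum_eq_single g]
    · have h3 : update z i (g : WithZero (G i)) = y ↔ z = update y i 0 := by
        constructor
        · rintro rfl
          rw [update_idem, hz']
        · rintro h
          rw [h, update_idem, hg, update_eq_self]
      simp only [h3]
      ring
    · intro g' _ hg'
      refine if_neg fun h => hg' ?_
      have := congrFun h i
      rw [update_self, ← hg, WithZero.coe_inj] at this
      exact this
    · simp
  | zero => simp
  | add x y _ _ hx hy => rw [map_add, Finsupp.add_apply, hx, hy, Finsupp.add_apply]; ring
  | smul c x _ hx => rw [map_smul, Finsupp.smul_apply, hx, Finsupp.smul_apply]; simp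

open scoped Classical in
/-- Auxiliary recursion for `chain`. -/
def chainAux : ℕ → Finset ι → (∀ i, WithZero (G i)) →₀ ℤ
  | 0, _ => Finsupp.single 0 1
  | n + 1, S => Finsupp.filter θ.IsFirstLow
      (∑ i ∈ S, posSign i S • θ.D i (chainAux n (S.erase i)))

/-- Chains `c_S` such that `c_S ± neg c_S` is the Koszul boundary of the `c_{S \ i}`. -/
def chain (S : Finset ι) : (∀ i, WithZero (G i)) →₀ ℤ := θ.chainAux #S S

/-- The Koszul boundary of the chains `c_{S \ i}`. -/
def boundary (S : Finset ι) : (∀ i, WithZero (G i)) →₀ ℤ :=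
  ∑ i ∈ S, posSign i S • θ.D i (θ.chain (S.erase i))

theorem chain_empty : θ.chain ∅ = Finsupp.single 0 1 := by
  simp [chain, chainAux]

open scoped Classical in
theorem chain_eq {S : Finset ι} (hS : S.Nonempty) :
    θ.chain S = Finsupp.filter θ.IsFirstLow (θ.boundary S) := by
  obtain ⟨n, hn⟩ := Nat.exists_eq_succ_of_ne_zero (card_ne_zero.2 hS)
  rw [chain, hn, chainAux, boundary]
  congr 1
  refine sum_congr rfl fun i hi => ?_
  rw [chain, card_erase_of_mem hi, hn, Nat.succ_sub_one]

theorem boundary_apply_zero (S : Finset ι) : θ.boundary S 0 = 0 := by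
  simp [boundary, Finsupp.finsetSum_apply, D_apply_zero]

-- A chain that `neg` multiplies by `ε` is recovered from its restriction to a fundamental domain of
-- `neg`. The fixed point 0 lies outside that domain, hence the condition there.
open scoped Classical in
theorem filter_add_smul_actOp_filter {r : (∀ i, WithZero (G i)) →₀ ℤ} {ε : ℤ}
    (hr : actOp θ.neg r = ε • r) (h0 : r 0 = 0) :
    Finsupp.filter θ.IsFirstLow r + ε • actOp θ.neg (Finsupp.filter θ.IsFirstLow r) = r := by
  ext y
  rw [Finsupp.add_apply, Finsupp.smul_apply, actOp_neg_apply, Finsupp.filter_apply,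
    Finsupp.filter_apply]
  by_cases hy : y = 0
  · subst hy
    rw [(act_eq_zero_iff θ.neg 0).2 rfl]
    simp [θ.not_isFirstLow_zero, h0]
  · rw [θ.isFirstLow_act_neg hy]
    have h1 : r (act θ.neg y) = ε * r y := by
      rw [← actOp_neg_apply, hr]; simp
    have h2 : r y = ε * r (act θ.neg y) := by
      have := congrArg (fun z => z (act θ.neg y)) hr
      simpa [actOp_neg_apply, act_neg_act_neg] using this
    by_cases h : θ.IsFirstLow y
    · simp [h]
    · simp [h, ← h2]

/-- Since the square of the Koszul differential vanishes, the boundary is an eigenvector of `neg`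
with the right sign, so its first-low half can serve as the next chain. -/
theorem chain_add_smul (S : Finset ι) :
    θ.chain S + (-1 : ℤ) ^ (#S + 1) • actOp θ.neg (θ.chain S) = θ.boundary S := by
  classical
  induction S using Finset.strongInduction with
  | H S ih =>
  rcases S.eq_empty_or_nonempty with rfl | hS
  · rw [chain_empty, actOp_single, (act_eq_zero_iff θ.neg 0).2 rfl]
    simp [boundary]
  have hsq : ((-1 : ℤ) ^ (#S + 1)) * (-1) ^ (#S + 1) = 1 := by
    rw [← mul_pow]; simp
  -- By the induction hypothesis for the sets `S.erase i`, the left side is a twofold Koszul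
  -- differential.
  have key : θ.boundary S - (-1 : ℤ) ^ (#S + 1) • actOp θ.neg (θ.boundary S) = 0 := by
    rw [← sum_posSign_smul_sum_posSign_smul θ.D (fun i l h => θ.commute_D h) θ.chain S]
    conv_lhs => rw [boundary, map_sum, smul_sum, ← sum_sub_distrib]
    refine sum_congr rfl fun i hi => ?_
    have h1 : ∀ x, actOp θ.neg (θ.D i x) = θ.D i (actOp θ.neg x) := fun x =>
      LinearMap.congr_fun (θ.commute_actOp_D θ.neg i) x
    have h2 := ih (S.erase i) (erase_ssubset hi)
    rw [card_erase_add_one hi] at h2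
    rw [boundary] at h2
    rw [← h2, map_smul, h1, map_add, map_smul, smul_comm _ (posSign i S), ← smul_sub, pow_succ]
    congr 1
    module
  rw [chain_eq _ hS]
  refine θ.filter_add_smul_actOp_filter ?_ (θ.boundary_apply_zero S)
  rw [sub_eq_zero] at key
  conv_rhs => rw [key]
  rw [smul_smul, hsq, one_smul]

theorem lift_boundary (S : Finset ι) : θ.lift (θ.boundary S) = 0 := by
  simp [boundary, lift_D]

/-- The distribution vanishes on the chains of even size. -/
theorem lift_chain_eq_zero [IsAddTorsionFree V] {S : Finset ι} (hS : Even #S) :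
    θ.lift (θ.chain S) = 0 := by
  have h := congrArg θ.lift (θ.chain_add_smul S)
  rw [lift_boundary, map_add, map_smul, lift_actOp_neg, hS.add_one.neg_one_pow] at h
  -- For even `#S` the sign of the chain identity and the sign from oddness cancel, so the two
  -- halves agree instead of cancelling.
  have h2 : (2 : ℕ) • θ.lift (θ.chain S) = 0 := by
    rw [← h]; module
  exact (smul_eq_zero_iff_right two_ne_zero).1 h2

theorem chain_mem_supportedOn (S : Finset ι) : θ.chain S ∈ supportedOn S := by
  classical
  induction S using Finset.strongInduction with
  | H S ih =>
  rcases S.eq_empty_or_nonempty with rfl | hS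
  · rw [chain_empty]
    refine Finsupp.single_mem_supported ℤ _ ?_
    intro i hi
    exact absurd rfl (mem_supp.1 hi)
  · rw [chain_eq _ hS]
    have : θ.boundary S ∈ supportedOn S := sum_mem fun i hi =>
      Submodule.smul_mem _ _ (θ.D_mem_supportedOn hi (ih _ (erase_ssubset hi)))
    rw [supportedOn, Finsupp.mem_supported] at this ⊢
    refine subset_trans ?_ this
    rw [Finsupp.support_filter]
    exact_mod_cast filter_subset _ _

end OddDistribution

end

end ShortStickelberger

/-! ### Reduction of all values of an odd distribution to those at reduced points -/

namespace ShortStickelberger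

noncomputable section

set_option linter.unusedSectionVars false

open Function Finset

namespace OddDistribution

variable {ι : Type*} [LinearOrder ι] [Fintype ι] {G : ι → Type*} [∀ i, CommGroup (G i)]
  [∀ i, Fintype (G i)] {V : Type*} [AddCommGroup V] (θ : OddDistribution G V)

open scoped Classical in
/-- The points with support `S` all of whose nonzero coordinates are `1` or `neg`. -/
def signPoints (S : Finset ι) : Finset (∀ i, WithZero (G i)) :=
  Fintype.piFinset fun i => if i ∈ S then {1, (θ.neg i : WithZero (G i))} else {0}

theorem mem_signPoints {S : Finset ι} {y : ∀ i, WithZero (G i)} :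
    y ∈ θ.signPoints S ↔ ∀ i, (i ∈ S → y i = 1 ∨ y i = θ.neg i) ∧ (i ∉ S → y i = 0) := by
  rw [signPoints, Fintype.mem_piFinset]
  refine forall_congr' fun i => ?_
  by_cases h : i ∈ S <;> simp [h]

theorem supp_of_mem_signPoints {S : Finset ι} {y : ∀ i, WithZero (G i)}
    (h : y ∈ θ.signPoints S) : supp y = S := by
  rw [mem_signPoints] at h
  ext i
  rw [mem_supp]
  by_cases hi : i ∈ S
  · rcases (h i).1 hi with h1 | h1 <;> simp [h1, hi]
  · simp [(h i).2 hi, hi]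

theorem isFirstLow_iff_of_mem_signPoints {S : Finset ι} (hS : S.Nonempty)
    {y : ∀ i, WithZero (G i)} (h : y ∈ θ.signPoints S) :
    θ.IsFirstLow y ↔ y (S.min' hS) = 1 := by
  rw [mem_signPoints] at h
  have h0 : ∀ l < S.min' hS, y l = 0 := fun l hl =>
    (h l).2 fun hl' => absurd (S.min'_le l hl') (not_le.2 hl)
  rcases (h _).1 (S.min'_mem hS) with h1 | h1
  · rw [θ.isFirstLow_iff (g := 1) (by rw [h1, WithZero.coe_one]) h0]
    exact iff_of_true (θ.one_mem_low _) h1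
  · rw [θ.isFirstLow_iff h1 h0]
    refine iff_of_false (θ.neg_not_mem_low _) fun h2 => θ.neg_ne_one (S.min' hS) ?_
    rw [h1, ← WithZero.coe_one, WithZero.coe_inj] at h2
    exact h2

-- Multiplying the `i`-th coordinate by `neg i` is a fixed-point-free involution of the index set
-- that does not affect the summand, so the terms cancel in pairs modulo 2.
open scoped Classical in
theorem sum_update_zero_signPoints {S : Finset ι} (hS : S.Nonempty) {i : ι} (hi : i ∈ S)
    (hne : i ≠ S.min' hS) (f : (∀ i, WithZero (G i)) → ZMod 2) :
    ∑ y ∈ θ.signPoints S with y (S.min' hS) = 1, f (update y i 0) = 0 := by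
  refine sum_involution (fun y _ => update y i (θ.neg i * y i)) ?_ ?_ ?_ ?_
  · intro y _
    rw [update_idem]
    exact CharTwo.add_self_eq_zero _
  · intro y hy _ h
    rw [mem_filter, mem_signPoints] at hy
    have h1 := congrFun h i
    rw [update_self] at h1
    have h2 : y i ≠ 0 := by
      rcases (hy.1 i).1 hi with h2 | h2 <;> simp [h2]
    have h3 := mul_right_cancel₀ h2 (h1.trans (one_mul _).symm)
    rw [← WithZero.coe_one, WithZero.coe_inj] at h3
    exact θ.neg_ne_one i h3
  · intro y hy
    rw [mem_filter, mem_signPoints] at hy ⊢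
    refine ⟨fun l => ?_, by rw [update_of_ne hne.symm]; exact hy.2⟩
    by_cases hl : l = i
    · subst hl
      rw [update_self]
      refine ⟨fun _ => ?_, fun h => absurd hi h⟩
      rcases (hy.1 l).1 hi with h2 | h2
      · right; rw [h2, mul_one]
      · left; rw [h2, ← WithZero.coe_mul, θ.neg_mul_neg, WithZero.coe_one]
    · rw [update_of_ne hl]; exact hy.1 l
  · intro y hy
    simp only [update_self, update_idem]
    rw [← mul_assoc, ← WithZero.coe_mul, θ.neg_mul_neg, WithZero.coe_one, one_mul,
      update_eq_self]

/-- Being first-low means here that the first coordinate is 1. Modulo 2 the boundary contributes the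
values of the chains of `S.erase i` with coordinate `i` zeroed; for `i` other than the minimum they
cancel in pairs, and the minimum gives the same sum for a smaller set. -/
theorem sum_chain_signPoints (S : Finset ι) :
    ∑ y ∈ θ.signPoints S, (θ.chain S y : ZMod 2) = 1 := by
  classical
  induction S using Finset.strongInduction with
  | H S ih =>
  rcases S.eq_empty_or_nonempty with rfl | hS
  · have : θ.signPoints ∅ = {0} := by
      ext y
      simp [mem_signPoints, funext_iff]
    simp [this, chain_empty]
  set k := S.min' hS with hk
  have hkS : k ∈ S := S.min'_mem hS
  have h1 : ∑ y ∈ θ.signPoints S, (θ.chain S y : ZMod 2)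
      = ∑ y ∈ θ.signPoints S with y k = 1, (θ.boundary S y : ZMod 2) := by
    rw [sum_filter]
    refine sum_congr rfl fun y hy => ?_
    rw [chain_eq _ hS, Finsupp.filter_apply]
    simp only [θ.isFirstLow_iff_of_mem_signPoints hS hy]
    split_ifs <;> simp
  have h2 : ∀ y ∈ θ.signPoints S, (θ.boundary S y : ZMod 2)
      = ∑ i ∈ S, (θ.chain (S.erase i) (update y i 0) : ZMod 2) := by
    intro y hy
    rw [boundary, Finsupp.finsetSum_apply, Int.cast_sum]
    refine sum_congr rfl fun i hi => ?_
    have hyi : y i ≠ 0 := by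
      rw [← mem_supp, θ.supp_of_mem_signPoints hy]; exact hi
    rw [Finsupp.smul_apply, θ.D_apply (notMem_erase i S) (θ.chain_mem_supportedOn _) hyi, posSign]
    simp [CharTwo.neg_eq]
  rw [h1, sum_congr rfl fun y hy => h2 y (mem_of_mem_filter y hy), sum_comm,
    sum_eq_single_of_mem k hkS, ← ih _ (erase_ssubset hkS)]
  · refine sum_bij' (fun y _ => update y k 0) (fun z _ => update z k 1) ?_ ?_ ?_ ?_ ?_
    · intro y hy
      rw [mem_filter, mem_signPoints] at hy
      rw [mem_signPoints]
      intro l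
      by_cases hl : l = k
      · subst hl; simp
      · simpa [hl] using hy.1 l
    · intro z hz
      rw [mem_signPoints] at hz
      rw [mem_filter, mem_signPoints]
      refine ⟨fun l => ?_, by simp⟩
      by_cases hl : l = k
      · rw [hl]; simp [hkS]
      · simpa [hl] using hz l
    · intro y hy
      rw [mem_filter] at hy
      simp only [update_idem]
      rw [← hy.2, update_eq_self]
    · intro z hz
      rw [mem_signPoints] at hz
      have : z k = 0 := (hz k).2 (notMem_erase _ _)
      simp only [update_idem]
      rw [← this, update_eq_self]
    · intro y _
      rfl
  · intro i hi hik
    exact θ.sum_update_zero_signPoints hS hi hik fun y => (θ.chain (S.erase i) y : ZMod 2)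

/-- The points that remain after the reductions: no coordinate is `neg`, the last coordinate
different from `0` and `1` is in `low`, and the support is odd if there is no such coordinate. -/
structure IsReduced (y : ∀ i, WithZero (G i)) : Prop where
  ne_neg : ∀ i, y i ≠ θ.neg i
  mem_low : ∀ i, ∀ g : G i, y i = g → g ≠ 1 → (∀ l, i < l → y l = 0 ∨ y l = 1) → g ∈ θ.low i
  odd : (∀ i, y i = 0 ∨ y i = 1) → Odd #(supp y)

section Reduction

variable {θ} {W : AddSubgroup V} {S : Finset ι}
  (hlow : ∀ y, supp y ⊂ S → θ.toFun y ∈ W)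
  (hred : ∀ y, supp y = S → θ.IsReduced y → θ.toFun y ∈ W)

include hlow

/-- The distribution relation expresses the sum by values at smaller supports: modulo `W`, sums over
one nonzero coordinate vanish. -/
theorem sum_update_mem {y : ∀ i, WithZero (G i)} (hy : supp y = S) {i : ι} (hi : i ∈ S) :
    ∑ g : G i, θ.toFun (update y i (g : WithZero (G i))) ∈ W := by
  rw [θ.sum_update]
  refine sub_mem (hlow _ ?_) (hlow _ ?_)
  · rw [supp_update_zero, hy]; exact erase_ssubset hi
  · rw [supp_act, supp_update_zero, hy]; exact erase_ssubset hi

-- The sum relation trades a coordinate `neg i` for the other units, one coordinate at a time. All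
-- coordinates that were not `neg` stay as they are, which the hypothesis on `z` records.
open scoped Classical in
theorem mem_of_forall_ne_neg (n : ℕ) : ∀ y : ∀ i, WithZero (G i), supp y = S →
    #{i | y i = θ.neg i} = n →
    (∀ z, supp z = S → (∀ i, z i ≠ θ.neg i) → (∀ i, y i ≠ θ.neg i → z i = y i) →
      θ.toFun z ∈ W) → θ.toFun y ∈ W := by
  induction n with
  | zero =>
    intro y hy hn h
    refine h y hy (fun i hi => ?_) fun _ _ => rfl
    rw [card_eq_zero] at hn
    have : i ∈ ({i | y i = θ.neg i} : Finset ι) := by simpa using hi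
    rw [hn] at this
    simp at this
  | succ n ih =>
    intro y hy hn h
    obtain ⟨i, hi⟩ := card_pos.1 (show 0 < #{i | y i = θ.neg i} by omega)
    have hyi : y i = θ.neg i := by simpa using hi
    have hiS : i ∈ S := by rw [← hy, mem_supp, hyi]; simp
    have hsum := sum_update_mem hlow hy hiS
    rw [← add_sum_erase _ _ (mem_univ (θ.neg i)), ← hyi, update_eq_self] at hsum
    refine (add_mem_cancel_right (sum_mem fun g hg => ?_)).1 hsum
    have hg' : (g : WithZero (G i)) ≠ θ.neg i := by
      rw [Ne, WithZero.coe_inj]; exact (mem_erase.1 hg).1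
    refine ih _ (by rw [supp_update_coe, hy, insert_eq_self.2 hiS]) ?_ fun z hz hz1 hz2 =>
      h z hz hz1 fun l hl => ?_
    · have : ({l | update y i (g : WithZero (G i)) l = θ.neg l} : Finset ι)
          = ({l | y l = θ.neg l} : Finset ι).erase i := by
        ext l
        by_cases hl : l = i
        · subst hl; simp [hg']
        · simp [hl]
      rw [this, card_erase_of_mem hi, hn, Nat.succ_sub_one]
    · have hl' : l ≠ i := fun e => hl (e ▸ hyi)
      have := hz2 l (by rwa [update_of_ne hl'])
      rwa [update_of_ne hl'] at this

include hred

omit hlow in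
theorem mem_of_last_mem_low {y : ∀ i, WithZero (G i)} (hy : supp y = S)
    (hne : ∀ i, y i ≠ θ.neg i) {k : ι} {g : G k} (hg : y k = g) (hg1 : g ≠ 1)
    (hlast : ∀ l, k < l → y l = 0 ∨ y l = 1) (hgl : g ∈ θ.low k) : θ.toFun y ∈ W := by
  have hg1' : (g : WithZero (G k)) ≠ 1 := by
    rw [← WithZero.coe_one, Ne, WithZero.coe_inj]; exact hg1
  refine hred y hy ⟨hne, fun i g' hg' hg'1 hl' => ?_, fun h => ?_⟩
  · rcases lt_trichotomy i k with h | h | h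
    · rcases hl' k h with h1 | h1
      · exact absurd (hg.symm.trans h1) WithZero.coe_ne_zero
      · exact absurd (hg.symm.trans h1) hg1'
    · subst h
      rw [hg', WithZero.coe_inj] at hg
      rwa [hg]
    · rcases hlast i h with h1 | h1
      · exact absurd (hg'.symm.trans h1) WithZero.coe_ne_zero
      · rw [hg', ← WithZero.coe_one, WithZero.coe_inj] at h1
        exact absurd h1 hg'1
  · rcases h k with h1 | h1
    · exact absurd (hg.symm.trans h1) WithZero.coe_ne_zero
    · exact absurd (hg.symm.trans h1) hg1'

/-- If the last coordinate other than 0 and 1 is not low, replace the point by its negative. This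
makes that coordinate low but turns each 1 into `neg`; eliminating these leaves coordinate `k` alone
and can only create a later exceptional coordinate, whence the induction from the top. -/
theorem mem_of_last (k : ι) : ∀ y : ∀ i, WithZero (G i), supp y = S → (∀ i, y i ≠ θ.neg i) →
    y k ≠ 0 → y k ≠ 1 → (∀ l, k < l → y l = 0 ∨ y l = 1) → θ.toFun y ∈ W := by
  classical
  induction k using WellFoundedGT.induction with
  | ind k ih =>
  intro y hy hne h0 h1 hlast
  obtain ⟨g, hg⟩ := WithZero.ne_zero_iff_exists.1 h0
  have hg1 : g ≠ 1 := fun h => h1 (by rw [← hg, h, WithZero.coe_one])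
  by_cases hgl : g ∈ θ.low k
  · exact mem_of_last_mem_low hred hy hne hg.symm hg1 hlast hgl
  rw [← neg_mem_iff, ← θ.map_neg]
  refine mem_of_forall_ne_neg hlow _ _ (by rw [supp_act, hy]) rfl fun z hz hz1 hz2 => ?_
  have hzk : z k = (θ.neg k * g : G k) := by
    rw [hz2 k, act, ← hg, WithZero.coe_mul]
    rw [act, ← hg, ← WithZero.coe_mul, Ne, WithZero.coe_inj, mul_eq_left]
    exact hg1
  have hg2 : θ.neg k * g ≠ 1 := by
    intro h
    refine hne k ?_
    rw [← hg, WithZero.coe_inj]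
    rw [← θ.neg_mul_neg k] at h
    exact mul_left_cancel h
  by_cases hl : ∀ l, k < l → z l = 0 ∨ z l = 1
  · exact mem_of_last_mem_low hred hz hz1 hzk hg2 hl ((θ.neg_mul_mem_low k g).2 hgl)
  · push Not at hl
    have hTne : ({l | k < l ∧ z l ≠ 0 ∧ z l ≠ 1} : Finset ι).Nonempty := by
      obtain ⟨l, hl⟩ := hl
      exact ⟨l, by simpa using hl⟩
    have hm := max'_mem _ hTne
    rw [mem_filter] at hm
    refine ih _ hm.2.1 z hz hz1 hm.2.2.1 hm.2.2.2 fun l hl => ?_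
    by_contra hcon
    push Not at hcon
    have := le_max' ({l | k < l ∧ z l ≠ 0 ∧ z l ≠ 1} : Finset ι) l
      (by simpa using ⟨hm.2.1.trans hl, hcon⟩)
    exact absurd this (not_le.2 hl)

/-- The `k`-th coordinate survives the elimination of all coordinates `neg`, so a last coordinate
other than 0 and 1 exists and `mem_of_last` applies. -/
theorem mem_of_ne_sign {y : ∀ i, WithZero (G i)} (hy : supp y = S) {k : ι} (h0 : y k ≠ 0)
    (h1 : y k ≠ 1) (h2 : y k ≠ θ.neg k) : θ.toFun y ∈ W := by
  classical
  refine mem_of_forall_ne_neg hlow _ y hy rfl fun z hz hz1 hz2 => ?_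
  have hzk := hz2 k h2
  have hTne : ({l | z l ≠ 0 ∧ z l ≠ 1} : Finset ι).Nonempty :=
    ⟨k, by simpa [hzk] using ⟨h0, h1⟩⟩
  have hm := max'_mem _ hTne
  rw [mem_filter] at hm
  refine mem_of_last hlow hred _ z hz hz1 hm.2.1 hm.2.2 fun l hl => ?_
  by_contra hcon
  push Not at hcon
  have := le_max' ({l | z l ≠ 0 ∧ z l ≠ 1} : Finset ι) l (by simpa using hcon)
  exact absurd this (not_le.2 hl)

omit hlow hred in
/-- The point with support `S` all of whose nonzero coordinates are `1`. -/
def onePoint (G : ι → Type*) [∀ i, CommGroup (G i)] (S : Finset ι) : ∀ i, WithZero (G i) :=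
  fun i => if i ∈ S then 1 else 0

-- In the sum relation for a coordinate equal to `neg`, all terms other than those for `neg` and 1
-- lie in `W`. Hence replacing one `neg` by 1 changes the sign of the value modulo `W`.
open scoped Classical in
theorem sub_smul_onePoint_mem (n : ℕ) : ∀ y ∈ θ.signPoints S, #{i | y i = θ.neg i} = n →
    θ.toFun y - (-1 : ℤ) ^ n • θ.toFun (onePoint G S) ∈ W := by
  induction n with
  | zero =>
    intro y hy hn
    rw [card_eq_zero] at hn
    have : y = onePoint G S := by
      rw [mem_signPoints] at hy
      funext i
      by_cases hi : i ∈ S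
      · rcases (hy i).1 hi with h | h
        · simp [onePoint, hi, h]
        · have : i ∈ ({i | y i = θ.neg i} : Finset ι) := by simpa using h
          rw [hn] at this
          simp at this
      · simp [onePoint, hi, (hy i).2 hi]
    simp [this]
  | succ n ih =>
    intro y hy hn
    have hyS := θ.supp_of_mem_signPoints hy
    obtain ⟨i, hi⟩ := card_pos.1 (show 0 < #{i | y i = θ.neg i} by omega)
    have hyi : y i = θ.neg i := by simpa using hi
    have hiS : i ∈ S := by rw [← hyS, mem_supp, hyi]; simp
    have hsum := sum_update_mem hlow hyS hiS
    rw [← add_sum_erase _ _ (mem_univ (θ.neg i)), ← hyi, update_eq_self,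
      ← add_sum_erase _ _ (mem_erase.2 ⟨(θ.neg_ne_one i).symm, mem_univ 1⟩), ← add_assoc] at hsum
    have h1 := (add_mem_cancel_right (sum_mem fun g hg => ?_)).1 hsum
    · have h2 := ih (update y i 1) ?_ ?_
      · rw [WithZero.coe_one] at h1
        have := sub_mem h1 h2
        rw [pow_succ]
        convert this using 1
        module
      · rw [mem_signPoints] at hy ⊢
        intro l
        by_cases hl : l = i
        · rw [hl]; simp [hiS]
        · simpa [hl] using hy l
      · have : ({l | update y i 1 l = θ.neg l} : Finset ι)
            = ({l | y l = θ.neg l} : Finset ι).erase i := by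
          ext l
          by_cases hl : l = i
          · subst hl
            have : (1 : WithZero (G l)) ≠ θ.neg l := by
              rw [← WithZero.coe_one, Ne, WithZero.coe_inj]; exact (θ.neg_ne_one l).symm
            simp [this]
          · simp [hl]
        rw [this, card_erase_of_mem hi, hn, Nat.succ_sub_one]
    · simp only [mem_erase, mem_univ, and_true] at hg
      refine mem_of_ne_sign hlow hred (k := i) ?_ ?_ ?_ ?_
      · rw [supp_update_coe, hyS, insert_eq_self.2 hiS]
      · simp
      · rw [update_self, ← WithZero.coe_one, Ne, WithZero.coe_inj]; exact hg.1
      · rw [update_self, Ne, WithZero.coe_inj]; exact hg.2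

/-- For odd `#S` the point is reduced. For even `#S` its class `e` modulo `W` satisfies `2 e = 0`,
by oddness; the vanishing of the distribution on `chain S` shows that an odd multiple of `e` is zero
as well. -/
theorem onePoint_mem [IsAddTorsionFree V] : θ.toFun (onePoint G S) ∈ W := by
  classical
  have hone : onePoint G S ∈ θ.signPoints S := by
    rw [mem_signPoints]
    intro i
    by_cases hi : i ∈ S <;> simp [onePoint, hi]
  have h01 : ∀ i, onePoint G S i = 0 ∨ onePoint G S i = 1 := fun i => by
    by_cases hi : i ∈ S <;> simp [onePoint, hi]
  rcases Nat.even_or_odd #S with hev | hodd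
  · have hneg : act θ.neg (onePoint G S) ∈ θ.signPoints S := by
      rw [mem_signPoints]
      intro i
      by_cases hi : i ∈ S <;> simp [onePoint, hi, act]
    have hcard : #{i | act θ.neg (onePoint G S) i = θ.neg i} = #S := by
      congr 1
      ext i
      by_cases hi : i ∈ S <;> simp [onePoint, hi, act]
    have h2 := sub_smul_onePoint_mem hlow hred _ _ hneg hcard
    rw [θ.map_neg, hev.neg_one_pow, one_smul] at h2
    set π := QuotientAddGroup.mk' W with hπ
    set e := π (θ.toFun (onePoint G S)) with he
    have hmem : ∀ v, π v = 0 ↔ v ∈ W := fun v => QuotientAddGroup.eq_zero_iff v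
    have h2e : -e = e := by
      rw [← hmem, map_sub, _root_.map_neg, ← he] at h2
      rwa [sub_eq_zero] at h2
    have hzero := congrArg π (θ.lift_chain_eq_zero hev)
    rw [lift, Finsupp.linearCombination_apply, Finsupp.sum, map_sum, map_zero] at hzero
    -- Modulo `W` only sign points contribute, and each of them has value `e`, since `-e = e`.
    have hterm : ∀ y ∈ (θ.chain S).support, π (θ.chain S y • θ.toFun y)
        = if y ∈ θ.signPoints S then θ.chain S y • e else 0 := by
      intro y hy
      have hyS : supp y ⊆ S :=
        (Finsupp.mem_supported ℤ _).1 (θ.chain_mem_supportedOn S) hy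
      rw [map_zsmul]
      split_ifs with hs
      · have := (hmem _).2 (sub_smul_onePoint_mem hlow hred _ y hs rfl)
        rw [map_sub, sub_eq_zero, map_zsmul, ← he] at this
        rw [this]
        rcases neg_one_pow_eq_or ℤ #{i | y i = θ.neg i} with h | h <;> simp [h, h2e]
      · have : θ.toFun y ∈ W := by
          by_cases hyS' : supp y = S
          · rw [mem_signPoints] at hs
            push Not at hs
            obtain ⟨i, hi⟩ := hs
            by_cases hiS : i ∈ S
            · by_cases h : y i = 1 ∨ y i = θ.neg i
              · exact absurd (hi fun _ => h).1 (by simpa using hiS)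
              · push Not at h
                exact mem_of_ne_sign hlow hred hyS' (mem_supp.1 (hyS'.symm ▸ hiS)) h.1 h.2
            · have h0 : y i = 0 := by
                by_contra h
                exact hiS (hyS' ▸ mem_supp.2 h)
              exact absurd h0 (hi fun h => absurd h hiS).2
          · exact hlow y (hyS.ssubset_of_ne hyS')
        rw [(hmem _).2 this, smul_zero]
    rw [sum_congr rfl hterm, ← sum_filter] at hzero
    have hsum : (∑ y ∈ θ.signPoints S, θ.chain S y) • e = 0 := by
      rw [sum_smul, ← hzero]
      symm
      refine sum_subset (fun y hy => (mem_filter.1 hy).2) fun y hy hy' => ?_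
      have : θ.chain S y = 0 := by
        by_contra h
        exact hy' (mem_filter.2 ⟨Finsupp.mem_support_iff.2 h, hy⟩)
      rw [this, zero_smul]
    have hodd : Odd (∑ y ∈ θ.signPoints S, θ.chain S y) := by
      rw [← Int.not_even_iff_odd, ← ZMod.intCast_eq_zero_iff_even, Int.cast_sum,
        θ.sum_chain_signPoints]
      exact one_ne_zero
    obtain ⟨c, hc⟩ := hodd
    have h2e' : (2 : ℤ) • e = 0 := by
      rw [two_zsmul]; nth_rewrite 1 [← h2e]; exact neg_add_cancel e
    rw [hc, add_smul, one_smul, mul_comm, mul_smul, h2e', smul_zero, zero_add] at hsum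
    exact (hmem _).1 hsum
  · have hsupp := θ.supp_of_mem_signPoints hone
    refine hred _ hsupp ⟨fun i => ?_, fun i g hg hg1 _ => ?_, fun _ => by rwa [hsupp]⟩
    · rcases h01 i with h | h <;> rw [h]
      · exact WithZero.coe_ne_zero.symm
      · rw [← WithZero.coe_one, Ne, WithZero.coe_inj]; exact (θ.neg_ne_one i).symm
    · rcases h01 i with h | h <;> rw [hg] at h
      · exact absurd h WithZero.coe_ne_zero
      · rw [← WithZero.coe_one, WithZero.coe_inj] at h
        exact absurd h hg1

theorem mem_of_supp_eq [IsAddTorsionFree V] {y : ∀ i, WithZero (G i)}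
    (hy : supp y = S) : θ.toFun y ∈ W := by
  classical
  by_cases hs : y ∈ θ.signPoints S
  · have h := sub_smul_onePoint_mem hlow hred _ y hs rfl
    have := add_mem h (zsmul_mem (onePoint_mem hlow hred) ((-1) ^ #{i | y i = θ.neg i}))
    rwa [sub_add_cancel] at this
  · rw [mem_signPoints] at hs
    push Not at hs
    obtain ⟨i, hi⟩ := hs
    by_cases hiS : i ∈ S
    · by_cases h : y i = 1 ∨ y i = θ.neg i
      · exact absurd (hi fun _ => h).1 (by simpa using hiS)
      · push Not at h
        exact mem_of_ne_sign hlow hred hy (mem_supp.1 (hy.symm ▸ hiS)) h.1 h.2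
    · have h0 : y i = 0 := by
        by_contra h
        exact hiS (hy ▸ mem_supp.2 h)
      exact absurd h0 (hi fun h => absurd h hiS).2

end Reduction

/-- An odd distribution with values in a torsion free group takes all its values in a subgroup as
soon as the values at the points with at most one nonzero coordinate and, modulo values at points
with smaller support, those at the reduced points lie in it. -/
theorem mem_of_isReduced [IsAddTorsionFree V] (W : AddSubgroup V)
    (h1 : ∀ y, #(supp y) ≤ 1 → θ.toFun y ∈ W)
    (hred : ∀ y, 1 < #(supp y) → θ.IsReduced y → (∀ z, supp z ⊂ supp y → θ.toFun z ∈ W) →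
      θ.toFun y ∈ W) (y : ∀ i, WithZero (G i)) : θ.toFun y ∈ W := by
  suffices ∀ S : Finset ι, ∀ y : ∀ i, WithZero (G i), supp y = S → θ.toFun y ∈ W from
    this _ y rfl
  intro S
  induction S using Finset.strongInduction with
  | H S ih =>
  intro y hy
  have hlow : ∀ z, supp z ⊂ S → θ.toFun z ∈ W := fun z hz => ih _ hz z rfl
  by_cases hc : #S ≤ 1
  · exact h1 y (hy ▸ hc)
  · refine mem_of_supp_eq hlow (fun z hz hzr => hred z ?_ hzr (hz ▸ hlow)) hy
    rw [hz]; exact not_le.1 hc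

end OddDistribution

end

end ShortStickelberger

/-! ### Values of `L`-functions at 0 and non-vanishing of twisted sawtooth sums -/

namespace ShortStickelberger

noncomputable section

open Finset Complex

theorem hasDerivAt_ofReal_cpow_neg {t : ℝ} (ht : 0 < t) (s : ℂ) :
    HasDerivAt (fun t : ℝ => (t : ℂ) ^ (-s)) (-s * (t : ℂ) ^ (-s - 1)) t := by
  have := ((hasDerivAt_id (t : ℂ)).cpow_const (c := -s) (Or.inl (by simpa using ht))).comp_ofReal
  simpa using this

/-- A bound for the second differences of `t ^ (-s)`. -/
theorem norm_second_diff_cpow_le (s : ℂ) {n : ℝ} (hn : 0 < n) (hs : 0 ≤ s.re + 2) :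
    ‖(n : ℂ) ^ (-s) - 2 * ((n + 1 : ℝ) : ℂ) ^ (-s) + ((n + 2 : ℝ) : ℂ) ^ (-s)‖
      ≤ ‖s‖ * ‖s + 1‖ * n ^ (-(s.re + 2)) := by
  -- A second difference is bounded by the second derivative: the mean value inequality is used
  -- twice.
  have hf'' : ∀ t : ℝ, n ≤ t → ‖-s * ((-s - 1) * (t : ℂ) ^ (-s - 1 - 1))‖
      ≤ ‖s‖ * ‖s + 1‖ * n ^ (-(s.re + 2)) := by
    intro t ht
    have ht0 : 0 < t := hn.trans_le ht
    have e : -s - 1 = -(s + 1) := by ring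
    rw [norm_mul, norm_mul, norm_neg, Complex.norm_cpow_eq_rpow_re_of_pos ht0, ← mul_assoc, e,
      norm_neg]
    refine mul_le_mul_of_nonneg_left ?_ (by positivity)
    have e2 : (-(s + 1) - 1).re = -(s.re + 2) := by simp; ring
    rw [e2, Real.rpow_neg ht0.le, Real.rpow_neg hn.le]
    exact inv_anti₀ (Real.rpow_pos_of_pos hn _) (Real.rpow_le_rpow hn.le ht hs)
  have hg' : ∀ t : ℝ, n ≤ t →
      ‖-s * ((t + 1 : ℝ) : ℂ) ^ (-s - 1) - -s * (t : ℂ) ^ (-s - 1)‖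
        ≤ ‖s‖ * ‖s + 1‖ * n ^ (-(s.re + 2)) := by
    intro t ht
    have := Convex.norm_image_sub_le_of_norm_hasDerivWithin_le
      (f := fun t : ℝ => -s * (t : ℂ) ^ (-s - 1))
      (f' := fun t : ℝ => -s * ((-s - 1) * (t : ℂ) ^ (-s - 1 - 1)))
      (s := Set.Ici n) (x := t) (y := t + 1)
      (fun x hx => by
        have h := hasDerivAt_ofReal_cpow_neg (hn.trans_le hx) (s + 1)
        rw [show -(s + 1) = -s - 1 by ring] at h
        exact (h.const_mul (-s)).hasDerivWithinAt)
      (fun x hx => hf'' x hx) (convex_Ici n) ht (by simp only [Set.mem_Ici]; linarith)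
    simpa using this
  have := Convex.norm_image_sub_le_of_norm_hasDerivWithin_le
    (f := fun t : ℝ => ((t + 1 : ℝ) : ℂ) ^ (-s) - (t : ℂ) ^ (-s))
    (f' := fun t : ℝ => -s * ((t + 1 : ℝ) : ℂ) ^ (-s - 1) - -s * (t : ℂ) ^ (-s - 1))
    (s := Set.Ici n) (x := n) (y := n + 1)
    (fun x hx => by
      have hx0 : 0 < x := hn.trans_le hx
      exact (((hasDerivAt_ofReal_cpow_neg (t := x + 1) (by linarith) s).comp_add_const x 1).sub
        (hasDerivAt_ofReal_cpow_neg hx0 s)).hasDerivWithinAt)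
    (fun x hx => hg' x hx) (convex_Ici n) (by simp) (by simp)
  refine le_trans (le_of_eq ?_) (this.trans (by simp))
  congr 1
  push_cast
  ring_nf

/-- The values at `0` of the Dirichlet series with coefficients `B (n + 2) - 2 B (n + 1) + B n`. -/
theorem LFunction_apply_zero_of_second_diff {m : ℕ} [NeZero m] (Φ : ZMod m → ℂ)
    (hΦ : ∑ j, Φ j = 0) (B : ℕ → ℂ) {C : ℝ} (hB : ∀ n, ‖B n‖ ≤ C)
    (h1 : Φ 1 = B 1 - 2 * B 0)
    (h2 : ∀ n : ℕ, Φ ((n + 2 : ℕ) : ZMod m) = B (n + 2) - 2 * B (n + 1) + B n) :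
    ZMod.LFunction Φ 0 = -B 0 := by
  set d : ℕ → ℂ → ℂ := fun n s => ((n + 1 : ℕ) : ℂ) ^ (-s) - 2 * ((n + 2 : ℕ) : ℂ) ^ (-s)
    + ((n + 3 : ℕ) : ℂ) ^ (-s) with hd
  -- Two summations by parts turn the Dirichlet series into `F`. The second differences `d n` make
  -- its series converge beyond `re s = 0`, and `d n 0 = 0` leaves `F 0 = -B 0`.
  set F : ℂ → ℂ := fun s => (∑' n : ℕ, B (n + 1) * d n s) - 2 * B 0 + B 0 * (2 : ℂ) ^ (-s) with hF
  have hC : 0 ≤ C := (norm_nonneg _).trans (hB 0)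
  -- This ball contains 0 as well as 2, near which the original series converges, and stays in `re s
  -- ≥ -1/4`, where the terms are dominated by `n ^ (-7/4)`.
  set U : Set ℂ := Metric.ball 1 (5 / 4) with hU
  have hUre : ∀ s ∈ U, -(1 / 4) ≤ s.re ∧ ‖s‖ ≤ 9 / 4 := by
    intro s hs
    rw [hU, mem_ball_iff_norm] at hs
    have h1 := (abs_le.1 ((Complex.abs_re_le_norm (s - 1)).trans hs.le)).1
    simp only [sub_re, one_re] at h1
    have h2 : ‖s‖ ≤ ‖s - 1‖ + 1 := by
      have := norm_add_le (s - 1) 1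
      simpa using this
    exact ⟨by linarith, by linarith⟩
  have hdiff : DifferentiableOn ℂ (fun s => ∑' n : ℕ, B (n + 1) * d n s) U := by
    have hsum : Summable fun n : ℕ => C * (9 * ((n + 1 : ℕ) : ℝ) ^ (-(7 / 4) : ℝ)) := by
      refine (Summable.mul_left _ ?_).mul_left _
      exact (summable_nat_add_iff (f := fun n : ℕ => (n : ℝ) ^ (-(7 / 4) : ℝ)) 1).2
        (Real.summable_nat_rpow.2 (by norm_num))
    refine differentiableOn_tsum_of_summable_norm hsum (fun n => ?_) Metric.isOpen_ball ?_
    · intro s _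
      have hne : ∀ k : ℕ, DifferentiableAt ℂ (fun s : ℂ => ((n + (k + 1) : ℕ) : ℂ) ^ (-s)) s :=
        fun k => (differentiableAt_id.neg).const_cpow
          (Or.inl (by exact_mod_cast (by omega : n + (k + 1) ≠ 0)))
      exact (((hne 0).sub ((hne 1).const_mul 2)).add (hne 2)).const_mul _ |>.differentiableWithinAt
    · intro n s hs
      obtain ⟨hre, hnorm⟩ := hUre s hs
      rw [norm_mul]
      refine mul_le_mul (hB _) ?_ (norm_nonneg _) hC
      have hn0 : (0 : ℝ) < ((n + 1 : ℕ) : ℝ) := by positivity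
      have hb := norm_second_diff_cpow_le s hn0 (by linarith)
      have e : d n s = (((n + 1 : ℕ) : ℝ) : ℂ) ^ (-s)
          - 2 * ((((n + 1 : ℕ) : ℝ) + 1 : ℝ) : ℂ) ^ (-s)
          + ((((n + 1 : ℕ) : ℝ) + 2 : ℝ) : ℂ) ^ (-s) := by
        simp only [hd]; push_cast; ring_nf
      rw [e]
      refine hb.trans (mul_le_mul ?_ ?_ (by positivity) (by norm_num))
      · have : ‖s + 1‖ ≤ 13 / 4 := (norm_add_le _ _).trans (by rw [norm_one]; linarith)
        nlinarith [norm_nonneg s, norm_nonneg (s + 1)]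
      · exact Real.rpow_le_rpow_of_exponent_le (by norm_cast; omega) (by linarith)
  have hFdiff : DifferentiableOn ℂ F U := by
    refine (hdiff.sub_const _).add ?_
    exact ((differentiable_id.neg.const_cpow (Or.inl two_ne_zero)).const_mul _).differentiableOn
  have hLdiff : DifferentiableOn ℂ (ZMod.LFunction Φ) U :=
    (ZMod.differentiable_LFunction_of_sum_zero hΦ).differentiableOn
  have hconv : ∀ s : ℂ, 1 < s.re → ZMod.LFunction Φ s = F s := by
    intro s hs
    have hp : ∀ k : ℕ, Summable fun n : ℕ => ((n + (k + 1) : ℕ) : ℂ) ^ (-s) := fun k => by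
      have := (Complex.summable_one_div_nat_cpow (p := s)).2 hs
      simp only [one_div, ← Complex.cpow_neg] at this
      exact (summable_nat_add_iff (f := fun n : ℕ => (n : ℂ) ^ (-s)) (k + 1)).2 this
    have hBp : ∀ l k : ℕ, Summable fun n : ℕ => B (n + l) * ((n + (k + 1) : ℕ) : ℂ) ^ (-s) := by
      intro l k
      refine Summable.of_norm_bounded (g := fun n : ℕ => C * ‖((n + (k + 1) : ℕ) : ℂ) ^ (-s)‖)
        ((hp k).norm.mul_left _) fun n => ?_
      rw [norm_mul]
      exact mul_le_mul_of_nonneg_right (hB _) (norm_nonneg _)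
    rw [ZMod.LFunction_eq_LSeries _ hs, LSeries]
    have hterm : ∀ n : ℕ, LSeries.term (fun n : ℕ => Φ n) s (n + 1)
        = Φ ((n + 1 : ℕ) : ZMod m) * ((n + 1 : ℕ) : ℂ) ^ (-s) := fun n => by
      rw [LSeries.term_of_ne_zero (Nat.succ_ne_zero n), Complex.cpow_neg, div_eq_mul_inv]
    have hSum := ZMod.LSeriesSummable_of_one_lt_re Φ hs
    rw [LSeriesSummable] at hSum
    have hSum1 := (summable_nat_add_iff 1).2 hSum
    rw [hSum.tsum_eq_zero_add, LSeries.term_zero, zero_add, hSum1.tsum_eq_zero_add]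
    simp only [hterm]
    simp only [add_assoc, Nat.reduceAdd, h2]
    have e1 : ∀ n : ℕ, (B (n + 2) - 2 * B (n + 1) + B n) * ((n + 2 : ℕ) : ℂ) ^ (-s)
        = B (n + 2) * ((n + (1 + 1) : ℕ) : ℂ) ^ (-s)
          - 2 * (B (n + 1) * ((n + (1 + 1) : ℕ) : ℂ) ^ (-s))
          + B (n + 0) * ((n + (1 + 1) : ℕ) : ℂ) ^ (-s) := fun n => by
      simp only [Nat.reduceAdd, add_zero]; ring
    have e2 : ∀ n : ℕ, B (n + 1) * d n s
        = B (n + 1) * ((n + (0 + 1) : ℕ) : ℂ) ^ (-s)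
          - 2 * (B (n + 1) * ((n + (1 + 1) : ℕ) : ℂ) ^ (-s))
          + B (n + 1) * ((n + (2 + 1) : ℕ) : ℂ) ^ (-s) := fun n => by
      simp only [hd, Nat.reduceAdd]; ring
    simp only [hF, e1, e2]
    rw [((hBp 2 1).sub ((hBp 1 1).mul_left 2)).tsum_add (hBp 0 1),
      (hBp 2 1).tsum_sub ((hBp 1 1).mul_left 2),
      ((hBp 1 0).sub ((hBp 1 1).mul_left 2)).tsum_add (hBp 1 2),
      (hBp 1 0).tsum_sub ((hBp 1 1).mul_left 2),
      (hBp 1 0).tsum_eq_zero_add, (hBp 0 1).tsum_eq_zero_add]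
    simp only [add_assoc, zero_add, Nat.reduceAdd, add_zero, Nat.cast_one, one_cpow,
      Nat.cast_ofNat, h1]
    simp only [Nat.cast_add, Nat.cast_ofNat]
    ring
  have hev : ZMod.LFunction Φ =ᶠ[nhds 2] F := by
    have : {s : ℂ | 1 < s.re} ∈ nhds (2 : ℂ) :=
      (isOpen_lt continuous_const continuous_re).mem_nhds (by simp)
    filter_upwards [this] with s hs using hconv s hs
  have heq := (hLdiff.analyticOnNhd Metric.isOpen_ball).eqOn_of_preconnected_of_eventuallyEq
    (hFdiff.analyticOnNhd Metric.isOpen_ball) (convex_ball _ _).isPreconnected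
    (z₀ := 2) (by rw [hU, mem_ball_iff_norm]; norm_num) hev
  have h0 : (0 : ℂ) ∈ U := by rw [hU, mem_ball_iff_norm]; norm_num
  rw [heq h0]
  simp only [hF, hd, neg_zero, cpow_zero]
  norm_num
  ring

theorem periodic_sum_range {m : ℕ} {f : ℕ → ℂ} (hf : f.Periodic m)
    (h0 : ∑ k ∈ range m, f k = 0) :
    Function.Periodic (fun n => ∑ k ∈ range (n + 1), f k) m := by
  intro n
  have : n + m + 1 = m + (n + 1) := by ring
  change ∑ k ∈ range (n + m + 1), f k = _
  rw [this, sum_range_add, h0, zero_add]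
  exact sum_congr rfl fun k _ => by rw [add_comm m k]; exact hf k

theorem exists_norm_le_of_periodic {m : ℕ} (hm : 0 < m) {f : ℕ → ℂ} (hf : f.Periodic m) :
    ∃ C : ℝ, ∀ n, ‖f n‖ ≤ C := by
  refine ⟨∑ k ∈ range m, ‖f k‖, fun n => ?_⟩
  rw [← hf.map_mod_nat n]
  exact single_le_sum (f := fun k => ‖f k‖) (fun _ _ => norm_nonneg _)
    (mem_range.2 (Nat.mod_lt _ hm))

theorem sum_sum_range_add (f : ℕ → ℂ) (M : ℕ) :
    ∑ n ∈ range M, ∑ k ∈ range (n + 1), f k + ∑ k ∈ range M, k * f k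
      = M * ∑ k ∈ range M, f k := by
  induction M with
  | zero => simp
  | succ M ih =>
    rw [sum_range_succ, sum_range_succ (fun k => (k : ℂ) * f k), sum_range_succ f]
    push_cast
    linear_combination ih

theorem sum_zmod {m : ℕ} [NeZero m] {V : Type*} [AddCommMonoid V] (f : ZMod m → V) :
    ∑ j, f j = ∑ k ∈ range m, f k := by
  refine sum_bij' (fun j _ => j.val) (fun k _ => (k : ZMod m)) ?_ ?_ ?_ ?_ ?_
  · exact fun j _ => mem_range.2 (ZMod.val_lt j)
  · simp
  · simp
  · exact fun k hk => ZMod.val_cast_of_lt (mem_range.1 hk)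
  · simp

/-- The value at `0` of an `L`-function in terms of the first Bernoulli polynomial. -/
theorem LFunction_apply_zero {m : ℕ} [NeZero m] (Φ : ZMod m → ℂ) (hΦ : ∑ j, Φ j = 0)
    (h0 : Φ 0 = 0) : ZMod.LFunction Φ 0 = -∑ j : ZMod m, Φ j * (j.val / m) := by
  have hm : (m : ℂ) ≠ 0 := by exact_mod_cast NeZero.ne m
  set f : ℕ → ℂ := fun n => Φ (n : ZMod m) with hf
  have hfper : f.Periodic m := fun n => by simp [hf]
  have hfsum : ∑ k ∈ range m, f k = 0 := by rw [← hΦ, sum_zmod]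
  -- This constant makes the sum of `a` over a period vanish, so that the partial sums of `a` are
  -- again periodic, hence bounded. As `f 0 = 0`, their initial value is `c`.
  set c : ℂ := (∑ k ∈ range m, k * f k) / m with hc
  set a : ℕ → ℂ := fun n => c + ∑ k ∈ range (n + 1), f k with ha
  have haper : a.Periodic m := fun n => by
    have := periodic_sum_range hfper hfsum n
    simp only [ha]
    simp only at this
    rw [this]
  have hasum : ∑ k ∈ range m, a k = 0 := by
    have := sum_sum_range_add f m
    rw [hfsum, mul_zero] at this
    simp only [ha, sum_add_distrib, sum_const, card_range, nsmul_eq_mul, hc]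
    rw [mul_div_cancel₀ _ hm, add_comm]
    exact this
  obtain ⟨C, hC⟩ := exists_norm_le_of_periodic (NeZero.pos m) (periodic_sum_range haper hasum)
  have haf : ∀ n, f (n + 1) = a (n + 1) - a n := fun n => by
    simp only [ha]
    rw [sum_range_succ f (n + 1)]
    ring
  rw [LFunction_apply_zero_of_second_diff Φ hΦ (fun n => ∑ k ∈ range (n + 1), a k) hC]
  · have : f 0 = 0 := by simpa [hf] using h0
    simp only [zero_add, sum_range_one, ha, this, add_zero, hc, sum_div]
    rw [sum_zmod]
    congr 1
    refine sum_congr rfl fun k hk => ?_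
    rw [ZMod.val_cast_of_lt (mem_range.1 hk)]
    simp only [hf]
    ring
  · have := haf 0
    simp only [hf, zero_add, Nat.cast_one] at this
    rw [this, sum_range_succ]
    simp only [zero_add, sum_range_one]
    ring
  · intro n
    have := haf (n + 1)
    simp only [hf] at this
    rw [this, sum_range_succ a (n + 1 + 1), sum_range_succ a (n + 1)]
    ring

/-- The sawtooth function on `ℤ / m`. -/
def saw {m : ℕ} (z : ZMod m) : ℚ := if z = 0 then 0 else z.val / m - 1 / 2

theorem saw_zero {m : ℕ} : saw (0 : ZMod m) = 0 := if_pos rfl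

theorem saw_neg {m : ℕ} [NeZero m] (z : ZMod m) : saw (-z) = -saw z := by
  by_cases h : z = 0
  · simp [h, saw_zero]
  · have hm : (m : ℚ) ≠ 0 := by exact_mod_cast NeZero.ne m
    rw [saw, saw, if_neg h, if_neg (neg_ne_zero.2 h), ZMod.neg_val, if_neg h,
      Nat.cast_sub (ZMod.val_lt z).le]
    field_simp
    ring

theorem LFunction_apply_zero_eq_sum_saw {m : ℕ} [NeZero m] (Φ : ZMod m → ℂ)
    (hΦ : ∑ j, Φ j = 0) (h0 : Φ 0 = 0) :
    ZMod.LFunction Φ 0 = -∑ j : ZMod m, Φ j * (saw j : ℚ) := by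
  have : ∀ j : ZMod m, Φ j * (saw j : ℚ) = Φ j * (j.val / m) - Φ j * (1 / 2) := fun j => by
    by_cases h : j = 0
    · simp [h, h0]
    · rw [saw, if_neg h]; push_cast; ring
  rw [LFunction_apply_zero Φ hΦ h0, sum_congr rfl fun j _ => this j, sum_sub_distrib, ← sum_mul,
    hΦ, zero_mul, sub_zero]

/-- This is the functional equation at `s = 1`; oddness combines its two terms into one. -/
theorem LFunction_apply_zero_of_odd {m : ℕ} [NeZero m] (Φ : ZMod m → ℂ)
    (hodd : ∀ x, Φ (-x) = -Φ x) (h0 : Φ 0 = 0) :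
    ZMod.LFunction Φ 0 = I / Real.pi * ZMod.LFunction (ZMod.dft Φ) 1 := by
  have h := ZMod.LFunction_one_sub Φ (s := 1)
    (fun n h => by
      have := congrArg Complex.re h
      simp only [one_re, neg_re, natCast_re] at this
      have h2 : (0 : ℝ) ≤ n := n.cast_nonneg
      linarith) (Or.inl h0)
  have h1 : (fun x => Φ (-x)) = -Φ := funext hodd
  have h2 : ZMod.LFunction (-ZMod.dft Φ) 1 = -ZMod.LFunction (ZMod.dft Φ) 1 := by
    simp [ZMod.LFunction, sum_neg_distrib]
  have hpi : (Real.pi : ℂ) ≠ 0 := by exact_mod_cast Real.pi_ne_zero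
  rw [h1, map_neg, h2, sub_self, cpow_zero, cpow_neg_one, Complex.Gamma_one, mul_one, mul_one, mul_one,
    show (Real.pi : ℂ) * I / 2 = (Real.pi / 2 : ℂ) * I by ring,
    show -(Real.pi : ℂ) * I / 2 = -(Real.pi / 2 : ℂ) * I by ring, Complex.exp_mul_I,
    Complex.exp_mul_I, Complex.cos_neg, Complex.sin_neg, Complex.cos_pi_div_two,
    Complex.sin_pi_div_two] at h
  rw [h]
  field_simp
  ring

/-- If all the sums vanished, so would the value at 0 of the `L`-function of the Fourier transform
of `χ⁻¹`. The functional equation turns that value into a nonzero multiple of `L(χ⁻¹, 1)`, which is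
not zero. The transform need not be supported on units when `χ` is imprimitive, so all residues `a`
are needed. -/
theorem exists_sum_mul_saw_ne_zero {m : ℕ} [NeZero m] (χ : DirichletCharacter ℂ m)
    (hχ : χ (-1) = -1) : ∃ a : ZMod m, ∑ u : (ZMod m)ˣ, χ u * (saw (a * (u : ZMod m)) : ℚ) ≠ 0 := by
  by_contra! hcon
  have hm : (m : ℂ) ≠ 0 := by exact_mod_cast NeZero.ne m
  obtain ⟨ψ, hψ⟩ : ∃ ψ : DirichletCharacter ℂ m, ψ * χ = 1 := ⟨χ⁻¹, inv_mul_cancel χ⟩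
  have hψχ : ∀ u : (ZMod m)ˣ, ψ u * χ u = 1 := fun u => by
    rw [← MulChar.mul_apply, hψ, MulChar.one_apply_coe]
  have hψ1 : ψ (-1) = -1 := by
    have := hψχ (-1)
    rw [Units.val_neg, Units.val_one, hχ, mul_neg_one] at this
    rw [← this, neg_neg]
  have hne : ψ ≠ 1 := by
    rintro rfl
    rw [MulChar.one_apply (by simp)] at hψ1
    norm_num at hψ1
  have hodd : Function.Odd ψ := fun x => by
    rw [← neg_one_mul, map_mul, hψ1, neg_one_mul]
  set Φ : ZMod m → ℂ := ZMod.dft ψ with hΦdef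
  have hΦodd : ∀ x, Φ (-x) = -Φ x := ZMod.dft_odd_iff.2 hodd
  have hΦ0 : Φ 0 = 0 := by
    have := hΦodd 0
    rw [neg_zero] at this
    exact self_eq_neg.1 this
  have hΦsum : ∑ j, Φ j = 0 := by
    have h1 : ∑ j, Φ j = ∑ j, Φ (-j) := (Equiv.sum_comp (Equiv.neg _) _).symm
    simp only [hΦodd, sum_neg_distrib] at h1
    exact self_eq_neg.1 h1
  -- The Fourier transform of `χ⁻¹` transforms under units by `χ`.
  have hΦmul : ∀ (u : (ZMod m)ˣ) (k : ZMod m), Φ (u * k) = χ u * Φ k := by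
    intro u k
    have h1 := ZMod.dft_comp_unitMul ψ u⁻¹ k
    rw [inv_inv] at h1
    rw [hΦdef, ← h1]
    have h2 : (fun j => ψ ((u⁻¹ : (ZMod m)ˣ) * j)) = fun j => χ u * ψ j := by
      funext j
      have h3 := hψχ u
      have h4 : ψ (u⁻¹ : (ZMod m)ˣ) * ψ u = 1 := by
        rw [← map_mul, ← Units.val_mul, inv_mul_cancel, Units.val_one, map_one]
      rw [map_mul, ← mul_one (ψ (u⁻¹ : (ZMod m)ˣ)), ← h3, ← mul_assoc, h4, one_mul]
    rw [h2, ZMod.dft_const_mul]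
  -- Averaging over the substitutions `j ↦ u j` brings in the sums assumed to be zero.
  have hzero : ∑ j : ZMod m, Φ j * (saw j : ℚ) = 0 := by
    have h1 : ∀ u : (ZMod m)ˣ, ∑ j : ZMod m, Φ j * ((saw j : ℚ) : ℂ)
        = ∑ j : ZMod m, Φ j * (χ u * (saw (j * (u : ZMod m)) : ℚ)) := fun u => by
      rw [← Equiv.sum_comp (Units.mulLeft u)]
      refine sum_congr rfl fun j _ => ?_
      rw [Units.mulLeft_apply, hΦmul, mul_comm j]
      ring
    have h2 : (Fintype.card (ZMod m)ˣ : ℂ) * ∑ j : ZMod m, Φ j * ((saw j : ℚ) : ℂ) = 0 := by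
      rw [← nsmul_eq_mul, ← card_univ, ← sum_const, sum_congr rfl fun u _ => h1 u, sum_comm]
      simp only [← mul_sum, hcon, mul_zero, sum_const_zero]
    exact (mul_eq_zero.1 h2).resolve_left (by exact_mod_cast Fintype.card_ne_zero)
  have hL := LFunction_apply_zero_eq_sum_saw Φ hΦsum hΦ0
  rw [hzero, neg_zero, LFunction_apply_zero_of_odd Φ hΦodd hΦ0, hΦdef, ZMod.dft_dft] at hL
  have h3 : ZMod.LFunction (fun j => (m : ℂ) • ψ (-j)) 1
      = -m * DirichletCharacter.LFunction ψ 1 := by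
    rw [DirichletCharacter.LFunction, ZMod.LFunction, ZMod.LFunction]
    simp only [hodd _, smul_eq_mul, mul_sum]
    exact sum_congr rfl fun j _ => by ring
  rw [h3] at hL
  have hpi : (Real.pi : ℂ) ≠ 0 := by exact_mod_cast Real.pi_ne_zero
  exact mul_ne_zero (div_ne_zero I_ne_zero hpi) (mul_ne_zero (neg_ne_zero.2 hm)
    (DirichletCharacter.LFunction_apply_one_ne_zero hne)) hL

/-- All character sums of `w` vanish: for even characters by oddness, for odd ones because their
product with a nonzero twisted sawtooth sum is a convolution that vanishes. Orthogonality of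
characters then gives `w = 0`. -/
theorem eq_zero_of_sum_mul_saw_eq_zero {m : ℕ} [NeZero m] (w : (ZMod m)ˣ → ℚ)
    (hodd : ∀ u, w (-u) = -w u) (h : ∀ a : ZMod m, ∑ u : (ZMod m)ˣ, w u * saw (a * (u : ZMod m)) = 0) :
    w = 0 := by
  have hchar : ∀ χ : DirichletCharacter ℂ m, ∑ u : (ZMod m)ˣ, (w u : ℂ) * χ u = 0 := by
    intro χ
    rcases χ.even_or_odd with hχ | hχ
    · have h1 : ∑ u : (ZMod m)ˣ, (w u : ℂ) * χ u
          = ∑ u : (ZMod m)ˣ, (w (-u) : ℂ) * χ (-u : (ZMod m)ˣ) :=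
        (Equiv.sum_comp (Equiv.neg _) _).symm
      have h2 : ∀ u : (ZMod m)ˣ,
          (w (-u) : ℂ) * χ (-u : (ZMod m)ˣ) = -((w u : ℂ) * χ u) := fun u => by
        rw [hodd, Units.val_neg, ← neg_one_mul (u : ZMod m), map_mul, hχ]; push_cast; ring
      simp only [h2, sum_neg_distrib] at h1
      exact self_eq_neg.1 h1
    · obtain ⟨ψ, hψ⟩ : ∃ ψ : DirichletCharacter ℂ m, ψ * χ = 1 := ⟨χ⁻¹, inv_mul_cancel χ⟩
      have hψχ : ∀ u : (ZMod m)ˣ, ψ u * χ u = 1 := fun u => by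
        rw [← MulChar.mul_apply, hψ, MulChar.one_apply_coe]
      have hψ1 : ψ (-1) = -1 := by
        have := hψχ (-1)
        rw [Units.val_neg, Units.val_one, hχ, mul_neg_one] at this
        rw [← this, neg_neg]
      obtain ⟨a, ha⟩ := exists_sum_mul_saw_ne_zero ψ hψ1
      refine (mul_eq_zero.1 ?_).resolve_right ha
      have h1 : ∀ u t : (ZMod m)ˣ, ψ ((u * t : (ZMod m)ˣ) : ZMod m) * χ u = ψ t := fun u t => by
        rw [Units.val_mul, map_mul, mul_right_comm, hψχ, one_mul]
      calc (∑ u : (ZMod m)ˣ, (w u : ℂ) * χ u)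
            * ∑ t : (ZMod m)ˣ, ψ t * ((saw (a * (t : ZMod m)) : ℚ) : ℂ)
          = ∑ u : (ZMod m)ˣ, ∑ t : (ZMod m)ˣ, (w u : ℂ) * χ u *
              (ψ (u * t : (ZMod m)ˣ) * ((saw (a * ((u * t : (ZMod m)ˣ) : ZMod m)) : ℚ) : ℂ)) := by
            rw [sum_mul]
            refine sum_congr rfl fun u _ => ?_
            rw [← Equiv.sum_comp (Equiv.mulLeft u), mul_sum]
            rfl
        _ = ∑ t : (ZMod m)ˣ,
              ψ t * ((∑ u : (ZMod m)ˣ, w u * saw (a * (t : ZMod m) * (u : ZMod m)) : ℚ) : ℂ) := by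
            rw [sum_comm]
            refine sum_congr rfl fun t _ => ?_
            rw [Rat.cast_sum, mul_sum]
            refine sum_congr rfl fun u _ => ?_
            have : a * ((u * t : (ZMod m)ˣ) : ZMod m) = a * t * u := by push_cast; ring
            rw [this, ← h1 u t]
            push_cast
            ring
        _ = 0 := by simp [h]
  funext v
  have h1 : ∑ χ : DirichletCharacter ℂ m, χ (v : ZMod m)⁻¹ * ∑ u : (ZMod m)ˣ, (w u : ℂ) * χ u
      = m.totient * w v := by
    simp only [mul_sum]
    rw [sum_comm]
    have h2 : ∀ u : (ZMod m)ˣ, ∑ χ : DirichletCharacter ℂ m, χ (v : ZMod m)⁻¹ * ((w u : ℂ) * χ u)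
        = if v = u then (m.totient : ℂ) * (w v : ℂ) else 0 := fun u => by
      have h3 := DirichletCharacter.sum_char_inv_mul_char_eq ℂ v.isUnit (u : ZMod m)
      simp only [Units.val_inj] at h3
      calc _ = (w u : ℂ) * ∑ χ : DirichletCharacter ℂ m, χ (v : ZMod m)⁻¹ * χ u := by
            rw [mul_sum]; exact sum_congr rfl fun χ _ => by ring
        _ = _ := by
            rw [h3]
            split_ifs with hvu
            · rw [hvu]; ring
            · ring
    simp only [h2, sum_ite_eq, mem_univ, if_true]
  simp only [hchar, mul_zero, sum_const_zero] at h1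
  have h4 : (m.totient : ℂ) ≠ 0 := by
    exact_mod_cast (Nat.totient_pos.2 (NeZero.pos m)).ne'
  exact_mod_cast (mul_eq_zero.1 h1.symm).resolve_left h4

end

end ShortStickelberger

/-! ### Coefficients of group ring elements as functions on `(ℤ/m)ˣ` -/

namespace ShortStickelberger

noncomputable section

open Finset

/-- The isomorphism `G_m ≃ (ℤ/m)ˣ`. -/
def galEquiv (m : ℕ) [NeZero m] : GalCyc m ≃* (ZMod m)ˣ :=
  IsCyclotomicExtension.autEquivPow (Cyc m) (Polynomial.cyclotomic.irreducible_rat (NeZero.pos m))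

theorem sigma_eq (m : ℕ) [NeZero m] {s : ℕ} (h : s.Coprime m) :
    sigma m s = (galEquiv m).symm (ZMod.unitOfCoprime s h) := dif_pos h

theorem unitOfCoprime_val {m : ℕ} [NeZero m] (u : (ZMod m)ˣ) :
    ZMod.unitOfCoprime (u : ZMod m).val (ZMod.val_coe_unit_coprime u) = u := by
  ext
  simp

theorem galEquiv_apply (m : ℕ) [NeZero m] (σ : GalCyc m) (z : Cyc m) (hz : (z : ℂ) ^ m = 1) :
    (σ z : ℂ) = (z : ℂ) ^ (galEquiv m σ : ZMod m).val := by
  have hz' : z ^ m = 1 := Subtype.ext (by rw [SubmonoidClass.coe_pow, hz, OneMemClass.coe_one])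
  have h := sigma_apply m _ (ZMod.val_coe_unit_coprime (galEquiv m σ)) z hz'
  rw [sigma_eq m (ZMod.val_coe_unit_coprime _), unitOfCoprime_val,
    MulEquiv.symm_apply_apply] at h
  rw [h, SubmonoidClass.coe_pow]

/-- Both sides are read off from the action on a primitive `d`-th root of unity. -/
theorem galEquiv_resGal {d m : ℕ} [NeZero d] [NeZero m] (h : d ∣ m) (σ : GalCyc m) :
    galEquiv d (resGal h σ) = ZMod.unitsMap h (galEquiv m σ) := by
  obtain ⟨z, hζ⟩ : ∃ z : Cyc d, IsPrimitiveRoot (z : ℂ) d :=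
    ⟨⟨_, IntermediateField.mem_adjoin_simple_self ℚ _⟩,
      Complex.isPrimitiveRoot_exp d (NeZero.ne d)⟩
  have h1 := galEquiv_apply d (resGal h σ) z hζ.pow_eq_one
  obtain ⟨k, hk⟩ := id h
  have h3 : (z : ℂ) ^ m = 1 := by rw [hk, pow_mul, hζ.pow_eq_one, one_pow]
  have h2 := galEquiv_apply m σ ⟨z, cyc_le h z.2⟩ h3
  rw [← resGal_apply, h1] at h2
  ext
  rw [ZMod.unitsMap_val h, ← ZMod.natCast_zmod_val (galEquiv d (resGal h σ) : ZMod d),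
    ← ZMod.natCast_val, ZMod.natCast_eq_natCast_iff]
  change (z : ℂ) ^ _ = (z : ℂ) ^ _ at h2
  rw [pow_eq_pow_mod _ hζ.pow_eq_one,
    pow_eq_pow_mod (galEquiv m σ : ZMod m).val hζ.pow_eq_one] at h2
  exact hζ.pow_inj (Nat.mod_lt _ (NeZero.pos d)) (Nat.mod_lt _ (NeZero.pos d)) h2
  exact h

/-- The coefficients of an element of `ℚ[G_m]` at the `σ_u⁻¹`. -/
def coeffEquiv (m : ℕ) [NeZero m] : MonoidAlgebra ℚ (GalCyc m) ≃ₗ[ℚ] ((ZMod m)ˣ → ℚ) :=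
  (MonoidAlgebra.coeffLinearEquiv ℚ).trans <|
    (Finsupp.linearEquivFunOnFinite ℚ ℚ (GalCyc m)).trans <|
      LinearEquiv.funCongrLeft ℚ ℚ ((galEquiv m).symm.toEquiv.trans (Equiv.inv _))

theorem coeffEquiv_apply {m : ℕ} [NeZero m] (x : MonoidAlgebra ℚ (GalCyc m)) (u : (ZMod m)ˣ) :
    coeffEquiv m x u = x.coeff ((galEquiv m).symm u)⁻¹ := rfl

theorem fract_neg_div_congr {m : ℕ} [NeZero m] {a b : ℤ} (h : a ≡ b [ZMOD m]) :
    Int.fract (-((a : ℚ) / m)) = Int.fract (-((b : ℚ) / m)) := by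
  obtain ⟨k, hk⟩ := h.dvd
  have hm : (m : ℚ) ≠ 0 := by exact_mod_cast NeZero.ne m
  rw [Int.fract_eq_fract]
  refine ⟨k, ?_⟩
  have : (b : ℚ) = a + m * k := by exact_mod_cast (by linarith : b = a + m * k)
  rw [this]
  field_simp
  ring

/-- The coefficients of `θ_m(a)`. -/
def thetaFun (m : ℕ) (a : ℤ) (u : (ZMod m)ˣ) : ℚ :=
  Int.fract (-((a : ℚ) * (u : ZMod m).val / m))

theorem fract_eq_thetaFun {m : ℕ} [NeZero m] (a : ℤ) {s : ℕ} (h : s.Coprime m) :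
    Int.fract (-((a : ℚ) * s / m)) = thetaFun m a (ZMod.unitOfCoprime s h) := by
  have := fract_neg_div_congr (m := m) (a := a * s)
    (b := a * (ZMod.unitOfCoprime s h : ZMod m).val) (by
      refine Int.ModEq.mul_left _ ?_
      rw [Int.natCast_modEq_iff, ← ZMod.natCast_eq_natCast_iff, ZMod.coe_unitOfCoprime,
        ZMod.natCast_zmod_val])
  push_cast at this
  exact this

theorem sum_Ioc_coprime {m : ℕ} [NeZero m] {V : Type*} [AddCommMonoid V] (f : ℕ → V)
    (F : (ZMod m)ˣ → V) (h : ∀ s (hs : s.Coprime m), f s = F (ZMod.unitOfCoprime s hs)) :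
    ∑ s ∈ Ioc 0 m with s.Coprime m, f s = ∑ u, F u := by
  have hc : ∀ s ∈ ({s ∈ Ioc 0 m | s.Coprime m} : Finset ℕ), s.Coprime m :=
    fun s hs => (mem_filter.1 hs).2
  refine sum_bij (fun s hs => ZMod.unitOfCoprime s (hc s hs)) (fun _ _ => mem_univ _) ?_ ?_ ?_
  · intro s hs s' hs' he
    have h1 : (s : ZMod m) = s' := by
      rw [← ZMod.coe_unitOfCoprime s (hc s hs), ← ZMod.coe_unitOfCoprime s' (hc s' hs'), he]
    rw [ZMod.natCast_eq_natCast_iff] at h1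
    simp only [mem_filter, mem_Ioc] at hs hs'
    exact h1.eq_of_abs_lt (by rw [abs_lt]; constructor <;> omega)
  · intro u _
    -- The residue 0 is a unit only for `m = 1`, where the interval `(0, 1]` represents it by 1.
    by_cases h0 : (u : ZMod m).val = 0
    · have h1 := ZMod.val_coe_unit_coprime u
      rw [h0, Nat.coprime_zero_left] at h1
      subst h1
      exact ⟨1, by simp, Subsingleton.elim _ _⟩
    · refine ⟨(u : ZMod m).val, ?_, unitOfCoprime_val u⟩
      simp only [mem_filter, mem_Ioc]
      exact ⟨⟨Nat.pos_of_ne_zero h0, (ZMod.val_lt _).le⟩, ZMod.val_coe_unit_coprime u⟩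
  · exact fun s hs => h s _

theorem theta_eq (m : ℕ) [NeZero m] (a : ℤ) :
    theta m a = ∑ u : (ZMod m)ˣ,
      MonoidAlgebra.single ((galEquiv m).symm u)⁻¹ (thetaFun m a u) :=
  sum_Ioc_coprime _ _ fun s hs => by rw [sigma_eq m hs, fract_eq_thetaFun a hs]

theorem coeffEquiv_theta (m : ℕ) [NeZero m] (a : ℤ) :
    coeffEquiv m (theta m a) = thetaFun m a := by
  classical
  funext u
  rw [coeffEquiv_apply, theta_eq, MonoidAlgebra.coeff_sum, Finsupp.finsetSum_apply]
  simp [MonoidAlgebra.coeff_single, Finsupp.single_apply]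

theorem coeffEquiv_normElt (m : ℕ) [NeZero m] : coeffEquiv m (normElt m) = 1 := by
  classical
  funext u
  rw [coeffEquiv_apply, normElt, MonoidAlgebra.coeff_sum, Finsupp.finsetSum_apply]
  simp [MonoidAlgebra.coeff_single, Finsupp.single_apply]

theorem cor_single {d m : ℕ} [NeZero d] [NeZero m] (h : d ∣ m) (τ : GalCyc d) (c : ℚ)
    (σ : GalCyc m) [Decidable (resGal h σ = τ)] :
    (cor h (MonoidAlgebra.single τ c)).coeff σ = if resGal h σ = τ then c else 0 := by
  classical
  simp only [cor, LinearMap.comp_apply, LinearEquiv.coe_coe, MonoidAlgebra.coeffLinearEquiv_apply,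
    MonoidAlgebra.coeff_single, Finsupp.linearCombination_single, MonoidAlgebra.coeff_smul,
    MonoidAlgebra.coeff_sum, Finsupp.smul_apply, Finsupp.finsetSum_apply, Finsupp.single_apply]
  simp

theorem coeffEquiv_thetaCor (m n : ℕ) [NeZero m] [NeZero n] (a : ℤ) (u : (ZMod m)ˣ) :
    coeffEquiv m (thetaCor m n a) u = ∑ v ∈ univ.filter fun v : (ZMod n)ˣ =>
      (u : ZMod m).val ≡ (v : ZMod n).val [MOD m.gcd n], thetaFun n a v := by
  classical
  have : NeZero (m.gcd n) := ⟨(Nat.gcd_pos_of_pos_left n (NeZero.pos m)).ne'⟩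
  rw [coeffEquiv_apply, thetaCor, theta_eq, map_sum, map_sum, MonoidAlgebra.coeff_sum,
    Finsupp.finsetSum_apply, sum_filter]
  refine sum_congr rfl fun v _ => ?_
  have h1 : res (Nat.gcd_dvd_right m n)
      (MonoidAlgebra.single ((galEquiv n).symm v)⁻¹ (thetaFun n a v))
      = MonoidAlgebra.single (resGal (Nat.gcd_dvd_right m n) ((galEquiv n).symm v)⁻¹)
        (thetaFun n a v) := by
    simp [res]
  rw [h1, cor_single]
  refine if_congr ?_ rfl rfl
  rw [map_inv, map_inv, inv_inj, ← (galEquiv (m.gcd n)).injective.eq_iff, galEquiv_resGal,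
    galEquiv_resGal, MulEquiv.apply_symm_apply, MulEquiv.apply_symm_apply, Units.ext_iff,
    ZMod.unitsMap_val, ZMod.unitsMap_val, ← ZMod.natCast_val, ← ZMod.natCast_val,
    ZMod.natCast_eq_natCast_iff]

end

end ShortStickelberger

/-! ### Distribution relations, and generators of Sinnott's group -/

namespace ShortStickelberger

noncomputable section

open Finset

/-- The sum does not change when `x` moves by a multiple of `1/k`, so `x` may be taken in `[0,
1/k)`, where all fractional parts are explicit. -/
theorem sum_fract_add_div {k : ℕ} (hk : 0 < k) (x : ℚ) :
    ∑ j ∈ range k, Int.fract (x + j / k) = Int.fract (k * x) + (k - 1) / 2 := by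
  have hk0 : (k : ℚ) ≠ 0 := by exact_mod_cast hk.ne'
  have hstep : ∀ x : ℚ, ∑ j ∈ range k, Int.fract (x + 1 / k + j / k)
      = ∑ j ∈ range k, Int.fract (x + j / k) := by
    intro x
    have h1 : ∀ j : ℕ, Int.fract (x + 1 / k + j / k) = Int.fract (x + (j + 1 : ℕ) / k) := fun j => by
      congr 1; push_cast; ring
    have h2 := sum_range_succ (fun j : ℕ => Int.fract (x + j / k)) k
    rw [sum_range_succ', div_self hk0, Int.fract_add_one, Nat.cast_zero, zero_div, add_zero] at h2
    rw [sum_congr rfl fun j _ => h1 j]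
    exact add_right_cancel h2
  have hshift : ∀ (l : ℤ) (x : ℚ), ∑ j ∈ range k, Int.fract (x + l / k + j / k)
      = ∑ j ∈ range k, Int.fract (x + j / k) := by
    intro l
    induction l with
    | zero => intro x; simp
    | succ n ih =>
      intro x
      rw [← ih x, ← hstep (x + (n : ℤ) / k)]
      refine sum_congr rfl fun j _ => ?_
      congr 1; push_cast; ring
    | pred n ih =>
      intro x
      rw [← ih x, ← hstep (x + ((-n - 1 : ℤ) : ℚ) / k)]
      refine sum_congr rfl fun j _ => ?_
      congr 1; push_cast; ring
  have hx : x = Int.fract (k * x) / k + (⌊k * x⌋ : ℤ) / k := by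
    rw [← add_div, Int.fract_add_floor, mul_div_cancel_left₀ _ hk0]
  have h0 := Int.fract_nonneg (k * x)
  have h1 := Int.fract_lt_one (k * x)
  have hkpos : (0 : ℚ) < k := by exact_mod_cast hk
  rw [hx, hshift, ← hx]
  have hterm : ∀ j ∈ range k, Int.fract (Int.fract (k * x) / k + j / k)
      = Int.fract (k * x) / k + j / k := by
    intro j hj
    rw [mem_range] at hj
    have hj' : (j : ℚ) + 1 ≤ k := by exact_mod_cast hj
    rw [Int.fract_eq_self, ← add_div]
    exact ⟨by positivity, by rw [div_lt_one hkpos]; linarith⟩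
  have hgauss : ∀ n : ℕ, ∑ j ∈ range n, (j : ℚ) = n * (n - 1) / 2 := fun n => by
    induction n with
    | zero => simp
    | succ n ih => rw [sum_range_succ, ih]; push_cast; ring
  rw [sum_congr rfl hterm, sum_add_distrib, sum_const, card_range, nsmul_eq_mul, ← sum_div, hgauss]
  field_simp

theorem sum_range_mul_of_periodic {V : Type*} [AddCommMonoid V] {f : ℕ → V} {k : ℕ}
    (hf : f.Periodic k) (g : ℕ) : ∑ j ∈ range (g * k), f j = g • ∑ j ∈ range k, f j := by
  induction g with
  | zero => simp
  | succ g ih =>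
    rw [add_mul, one_mul, sum_range_add, ih, succ_nsmul]
    congr 1
    exact sum_congr rfl fun j _ => by
      rw [add_comm]; exact_mod_cast hf.nat_mul g j

/-- In lowest terms `a/k` is `a₁/k₁`. The residues `-a₁ j` run `g` times through all classes modulo
`k₁`, which reduces the sum to `sum_fract_add_div`. -/
theorem sum_fract_sub_mul_div (a : ℤ) {k g k₁ : ℕ} {a₁ : ℤ} (hk₁ : 0 < k₁) (hg : 0 < g)
    (hk : k = g * k₁) (ha : a = g * a₁) (hcop : IsCoprime a₁ (k₁ : ℤ)) (x : ℚ) :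
    ∑ j ∈ range k, Int.fract (x - a * j / k) = g * Int.fract (k₁ * x) + (k - g) / 2 := by
  have : NeZero k₁ := ⟨hk₁.ne'⟩
  have hk0 : (k₁ : ℚ) ≠ 0 := by exact_mod_cast hk₁.ne'
  have hg0 : (g : ℚ) ≠ 0 := by exact_mod_cast hg.ne'
  set F : ZMod k₁ → ℚ := fun z => Int.fract (x + z.val / k₁) with hF
  have hFint : ∀ b : ℤ, Int.fract (x + b / k₁) = F b := fun b => by
    simp only [hF]
    rw [Int.fract_eq_fract]
    have : (((b : ZMod k₁).val : ℤ) : ZMod k₁) = (b : ℤ) := by simp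
    rw [ZMod.intCast_eq_intCast_iff] at this
    obtain ⟨c, hc⟩ := this.dvd
    refine ⟨c, ?_⟩
    have : (b : ℚ) = (b : ZMod k₁).val + k₁ * c := by
      exact_mod_cast (by linarith : b = (b : ZMod k₁).val + k₁ * c)
    conv_lhs => rw [this]
    field_simp
    ring
  have hunit : IsUnit ((-a₁ : ℤ) : ZMod k₁) := by
    rw [ZMod.coe_int_isUnit_iff_isCoprime]
    exact hcop.symm.neg_right
  obtain ⟨w, hw⟩ := hunit
  have hterm : ∀ j : ℕ, Int.fract (x - a * j / k) = F (w * (j : ZMod k₁)) := fun j => by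
    have : x - a * j / k = x + ((-a₁ * j : ℤ) : ℚ) / k₁ := by
      rw [ha, hk]; push_cast; field_simp; ring
    rw [this, hFint, hw]
    push_cast
    rfl
  have hper : Function.Periodic (fun j : ℕ => F (w * (j : ZMod k₁))) k₁ := fun j => by simp
  rw [sum_congr rfl fun j _ => hterm j, hk, sum_range_mul_of_periodic hper,
    ← sum_zmod (fun z : ZMod k₁ => F ((w : ZMod k₁) * z)),
    show ∑ z : ZMod k₁, F ((w : ZMod k₁) * z) = ∑ z, F z from Equiv.sum_comp (Units.mulLeft w) F,
    sum_zmod]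
  have hval : ∀ j ∈ range k₁, F (j : ZMod k₁) = Int.fract (x + j / k₁) := fun j hj => by
    simp only [hF]
    rw [ZMod.val_cast_of_lt (mem_range.1 hj)]
  rw [sum_congr rfl hval, sum_fract_add_div hk₁, nsmul_eq_mul]
  push_cast
  ring

theorem sum_units_eq_sum_range {n : ℕ} [NeZero n] {V : Type*} [AddCommMonoid V] (f : ℕ → V)
    (P : ℕ → Prop) [DecidablePred P] :
    ∑ v ∈ univ.filter fun v : (ZMod n)ˣ => P (v : ZMod n).val, f (v : ZMod n).val
      = ∑ s ∈ range n with P s ∧ s.Coprime n, f s := by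
  refine sum_bij (fun v _ => (v : ZMod n).val) ?_ ?_ ?_ fun _ _ => rfl
  · intro v hv
    simp only [mem_filter, mem_univ, true_and] at hv
    simp only [mem_filter, mem_range]
    exact ⟨ZMod.val_lt _, hv, ZMod.val_coe_unit_coprime v⟩
  · intro v _ v' _ h
    exact Units.ext (ZMod.val_injective n h)
  · intro s hs
    simp only [mem_filter, mem_range] at hs
    refine ⟨ZMod.unitOfCoprime s hs.2.2, ?_, ?_⟩
    · simp only [mem_filter, mem_univ, true_and, ZMod.coe_unitOfCoprime]
      rw [ZMod.val_cast_of_lt hs.1]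
      exact hs.2.1
    · rw [ZMod.coe_unitOfCoprime, ZMod.val_cast_of_lt hs.1]

/-- With `s = e s'` the congruence becomes `s' ≡ e' U` modulo `d`, an arithmetic progression of
length `k` below `d k`. -/
theorem sum_modEq_dvd {V : Type*} [AddCommMonoid V] (f : ℕ → V) {n d e k e' U : ℕ} (hd : 0 < d)
    (he : 0 < e) (hn : n = d * (e * k)) (hee : e * e' ≡ 1 [MOD d]) :
    ∑ s ∈ range n with U ≡ s [MOD d] ∧ e ∣ s, f s
      = ∑ j ∈ range k, f (e * (e' * U % d + d * j)) := by
  symm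
  refine sum_bij (fun j _ => e * (e' * U % d + d * j)) ?_ ?_ ?_ fun _ _ => rfl
  · intro j hj
    rw [mem_range] at hj
    simp only [mem_filter, mem_range]
    refine ⟨?_, ?_, dvd_mul_right _ _⟩
    · have h1 := Nat.mod_lt (e' * U) hd
      have h2 : d * (j + 1) ≤ d * k := Nat.mul_le_mul_left _ hj
      have h3 : e' * U % d + d * j < d * k := by rw [mul_add] at h2; omega
      calc _ < e * (d * k) := Nat.mul_lt_mul_of_pos_left h3 he
        _ = n := by rw [hn]; ring
    · have h1 : e' * U % d + d * j ≡ e' * U [MOD d] := by simp [Nat.ModEq]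
      have h2 := h1.mul_left e
      have h3 : e * (e' * U) ≡ 1 * U [MOD d] := by
        rw [← mul_assoc]; exact hee.mul_right U
      rw [one_mul] at h3
      exact (h2.trans h3).symm
  · intro j _ j' _ h
    have h1 := Nat.eq_of_mul_eq_mul_left he h
    exact Nat.eq_of_mul_eq_mul_left hd (by omega)
  · intro s hs
    simp only [mem_filter, mem_range] at hs
    obtain ⟨hsn, hU, s', rfl⟩ := hs
    have h1 : s' % d = e' * U % d := by
      have h2 := (hU.symm.mul_left e')
      have h3 : e' * (e * s') ≡ 1 * s' [MOD d] := by
        rw [← mul_assoc, mul_comm e']; exact hee.mul_right s'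
      rw [one_mul] at h3
      exact h3.symm.trans h2
    have h4 : s' < d * k := by
      rw [hn, show d * (e * k) = e * (d * k) by ring] at hsn
      exact Nat.lt_of_mul_lt_mul_left hsn
    refine ⟨s' / d, mem_range.2 (Nat.div_lt_of_lt_mul h4), ?_⟩
    rw [← h1, Nat.mod_add_div]

theorem sum_moebius_dvd {P : ℕ} (hP : P ≠ 0) (s : ℕ) :
    ∑ e ∈ P.divisors with e ∣ s, ArithmeticFunction.moebius e = if s.Coprime P then 1 else 0 := by
  have h1 : {e ∈ P.divisors | e ∣ s} = (s.gcd P).divisors := by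
    ext e
    simp only [mem_filter, Nat.mem_divisors, Nat.dvd_gcd_iff]
    constructor
    · rintro ⟨⟨h1, _⟩, h2⟩; exact ⟨⟨h2, h1⟩, (Nat.gcd_pos_of_pos_right _ (Nat.pos_of_ne_zero hP)).ne'⟩
    · rintro ⟨⟨h1, h2⟩, _⟩; exact ⟨⟨h2, hP⟩, h1⟩
  rw [h1, ← ArithmeticFunction.coe_mul_zeta_apply, ArithmeticFunction.moebius_mul_coe_zeta,
    ArithmeticFunction.one_apply]

/-- The primes that divide `n` but not `d`, multiplied. -/
theorem exists_coprime_cofactor {n d : ℕ} [NeZero n] (hd : d ∣ n) :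
    ∃ P : ℕ, P ≠ 0 ∧ P ∣ n / d ∧ P.Coprime d ∧
      ∀ s : ℕ, s.Coprime d → (s.Coprime n ↔ s.Coprime P) := by
  have hd0 : 0 < d := Nat.pos_of_dvd_of_pos hd (NeZero.pos n)
  set T := {p ∈ n.primeFactors | ¬ p ∣ d} with hT
  have hTp : ∀ p ∈ T, p.Prime ∧ p ∣ n ∧ ¬ p ∣ d := fun p hp => by
    simp only [hT, mem_filter, Nat.mem_primeFactors] at hp
    exact ⟨hp.1.1, hp.1.2.1, hp.2⟩
  have hPn : ∏ p ∈ T, p ∣ n := Finset.prod_primes_dvd n (fun p hp => (hTp p hp).1.prime)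
    fun p hp => (hTp p hp).2.1
  have hPd : (∏ p ∈ T, p).Coprime d :=
    Nat.Coprime.prod_left fun p hp => ((hTp p hp).1.coprime_iff_not_dvd).2 (hTp p hp).2.2
  refine ⟨∏ p ∈ T, p, fun h => ?_, ?_, hPd, fun s hs => ?_⟩
  · rw [h] at hPn
    exact NeZero.ne n (Nat.eq_zero_of_zero_dvd hPn)
  · refine hPd.dvd_of_dvd_mul_left ?_
    rwa [Nat.mul_div_cancel' hd]
  · refine ⟨fun h => h.coprime_dvd_right hPn, fun h => Nat.coprime_of_dvd fun p hp hps hpn => ?_⟩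
    by_cases hpd : p ∣ d
    · exact hp.one_lt.ne' (Nat.eq_one_of_dvd_coprimes hs hps hpd)
    · have : p ∈ T := by
        simp only [hT, mem_filter, Nat.mem_primeFactors]
        exact ⟨⟨hp, hpn, NeZero.ne n⟩, hpd⟩
      exact hp.one_lt.ne' (Nat.eq_one_of_dvd_coprimes h hps (dvd_prod_of_mem _ this))

/-- The group generated by the `θ_m(a)` and `½ N_m`. -/
def thetaGroup (m : ℕ) [NeZero m] : AddSubgroup (MonoidAlgebra ℚ (GalCyc m)) :=
  AddSubgroup.closure (Set.range (theta m) ∪ {(1 / 2 : ℚ) • normElt m})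

theorem theta_mem_thetaGroup (m : ℕ) [NeZero m] (a : ℤ) : theta m a ∈ thetaGroup m :=
  AddSubgroup.subset_closure (Or.inl ⟨a, rfl⟩)

theorem half_normElt_mem_thetaGroup (m : ℕ) [NeZero m] :
    (1 / 2 : ℚ) • normElt m ∈ thetaGroup m :=
  AddSubgroup.subset_closure (Or.inr rfl)

/-- The sum runs over an arithmetic progression, so `sum_fract_sub_mul_div` collapses it to one
fractional part with denominator `d`, a coefficient of some `θ_m(b)` because `d ∣ m`. The integers
`g`, `b`, `c` must not depend on `u`. -/
theorem sum_modEq_dvd_fract {m n d e k e' : ℕ} [NeZero m] (hdm : d ∣ m) (he : 0 < e)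
    (hk : 0 < k) (hn : n = d * (e * k)) (hee : e * e' ≡ 1 [MOD d]) (a : ℤ) :
    ∃ (g : ℕ) (b c : ℤ), ∀ u : (ZMod m)ˣ,
      ∑ s ∈ range n with (u : ZMod m).val ≡ s [MOD d] ∧ e ∣ s, Int.fract (-((a : ℚ) * s / n))
        = g * thetaFun m b u + c * (1 / 2) := by
  have hd : 0 < d := Nat.pos_of_dvd_of_pos hdm (NeZero.pos m)
  have : NeZero d := ⟨hd.ne'⟩
  obtain ⟨r, hr⟩ := hdm
  have hr0 : 0 < r := Nat.pos_of_ne_zero fun h => NeZero.ne m (by rw [hr, h, mul_zero])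
  have hg0 : 0 < Int.gcd a k := Int.gcd_pos_of_ne_zero_right _ (by exact_mod_cast hk.ne')
  obtain ⟨a₁, k₁, hcop, ha, hk₁⟩ := Int.exists_gcd_one hg0
  lift k₁ to ℕ using by
    by_contra h
    push Not at h
    have h1 : (0 : ℤ) < k := by exact_mod_cast hk
    have h2 : (0 : ℤ) < Int.gcd a k := by exact_mod_cast hg0
    rw [hk₁] at h1
    nlinarith
  set g := Int.gcd a k with hg
  have hkk : k = g * k₁ := by
    rw [mul_comm]; exact_mod_cast hk₁
  have hk₁0 : 0 < k₁ := Nat.pos_of_ne_zero fun h => hk.ne' (by rw [hkk, h, mul_zero])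
  -- Here `r = m / d` rescales the denominator, `e'` inverts `e` modulo `d`, and `k - g` is the
  -- constant term of `sum_fract_sub_mul_div`.
  refine ⟨g, r * (a₁ * e'), k - g, fun u => ?_⟩
  rw [sum_modEq_dvd _ hd he hn hee]
  set s₀ := e' * (u : ZMod m).val % d with hs₀
  have hd' : (d : ℚ) ≠ 0 := by exact_mod_cast hd.ne'
  have he' : (e : ℚ) ≠ 0 := by exact_mod_cast he.ne'
  have hk' : (k : ℚ) ≠ 0 := by exact_mod_cast hk.ne'
  have hg' : (g : ℚ) ≠ 0 := by exact_mod_cast hg0.ne'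
  have hr' : (r : ℚ) ≠ 0 := by exact_mod_cast hr0.ne'
  have hk₁' : (k₁ : ℚ) ≠ 0 := by exact_mod_cast hk₁0.ne'
  have h1 : ∀ j : ℕ, -((a : ℚ) * (e * (s₀ + d * j) : ℕ) / n)
      = -(a * s₀ / (d * k)) - a * j / k := fun j => by
    rw [hn]; push_cast; field_simp; ring
  simp only [h1]
  rw [sum_fract_sub_mul_div a hk₁0 hg0 hkk (by rw [ha, mul_comm])
    (Int.isCoprime_iff_gcd_eq_one.2 hcop)]
  have h2 : (k₁ : ℚ) * -(a * s₀ / (d * k)) = -((a₁ * s₀ : ℤ) / d) := by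
    have : (a : ℚ) = a₁ * g := by exact_mod_cast ha
    rw [this, hkk]; push_cast; field_simp
  have h3 : Int.fract (-(((a₁ * s₀ : ℤ) : ℚ) / d)) = thetaFun m (r * (a₁ * e')) u := by
    have h4 : a₁ * (s₀ : ℤ) ≡ a₁ * ((e' * (u : ZMod m).val : ℕ) : ℤ) [ZMOD d] :=
      Int.ModEq.mul_left _ ((Int.natCast_modEq_iff).2 (by simp [hs₀, Nat.ModEq]))
    rw [fract_neg_div_congr h4, thetaFun]
    have hmq : (m : ℚ) = d * r := by exact_mod_cast hr
    congr 2
    push_cast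
    rw [hmq]
    field_simp
  rw [h2, h3]
  push_cast
  ring

/-- The coefficient at `u` sums over `s ≡ u` modulo `d` that are prime to `n`. Such `s` are prime to
`d` anyway, and Möbius inversion over the remaining primes, whose product is `P`, replaces
coprimality by divisibility conditions. -/
theorem thetaCor_mem_thetaGroup (m n : ℕ) [NeZero m] [NeZero n] (a : ℤ) :
    thetaCor m n a ∈ thetaGroup m := by
  set d := m.gcd n with hd
  have hdm : d ∣ m := Nat.gcd_dvd_left m n
  have hdn : d ∣ n := Nat.gcd_dvd_right m n
  have hd0 : 0 < d := Nat.pos_of_dvd_of_pos hdm (NeZero.pos m)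
  obtain ⟨P, hP0, hPn, hPd, hP⟩ := exists_coprime_cofactor hdn
  have hinner : ∀ e ∈ P.divisors, ∃ (g : ℕ) (b c : ℤ), ∀ u : (ZMod m)ˣ,
      ∑ s ∈ range n with (u : ZMod m).val ≡ s [MOD d] ∧ e ∣ s, Int.fract (-((a : ℚ) * s / n))
        = g * thetaFun m b u + c * (1 / 2) := by
    intro e he
    have heP := Nat.dvd_of_mem_divisors he
    obtain ⟨k, hk⟩ := heP.trans hPn
    have hn : n = d * (e * k) := by rw [← hk, Nat.mul_div_cancel' hdn]
    have hn0 := NeZero.ne n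
    have he0 : 0 < e := Nat.pos_of_mem_divisors he
    have hk0 : 0 < k := Nat.pos_of_ne_zero fun h => hn0 (by rw [hn, h, mul_zero, mul_zero])
    obtain ⟨e', he'⟩ : ∃ e', e * e' ≡ 1 [MOD d] := by
      have hcop : e.Coprime d := hPd.coprime_dvd_left heP
      refine ⟨((e : ZMod d)⁻¹).val, ?_⟩
      have : NeZero d := ⟨hd0.ne'⟩
      rw [← ZMod.natCast_eq_natCast_iff]
      push_cast
      rw [ZMod.natCast_zmod_val]
      exact ZMod.coe_mul_inv_eq_one e hcop
    exact sum_modEq_dvd_fract hdm he0 hk0 hn he' a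
  choose! g b c hgbc using hinner
  have key : thetaCor m n a = ∑ e ∈ P.divisors, ArithmeticFunction.moebius e •
      ((g e : ℤ) • theta m (b e) + c e • ((1 / 2 : ℚ) • normElt m)) := by
    apply (coeffEquiv m).injective
    funext u
    have hU : ((u : ZMod m).val).Coprime d :=
      (ZMod.val_coe_unit_coprime u).coprime_dvd_right hdm
    rw [coeffEquiv_thetaCor, map_sum, Finset.sum_apply]
    simp only [map_zsmul, map_add, map_smul, coeffEquiv_theta, coeffEquiv_normElt, Pi.smul_apply,
      Pi.add_apply, Pi.one_apply]
    have h1 := sum_units_eq_sum_range (n := n) (fun s => Int.fract (-((a : ℚ) * s / n)))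
      (fun s => (u : ZMod m).val ≡ s [MOD d])
    refine h1.trans ?_
    have h2 : ∀ s : ℕ, ((u : ZMod m).val ≡ s [MOD d] ∧ s.Coprime n)
        ↔ ((u : ZMod m).val ≡ s [MOD d] ∧ s.Coprime P) := fun s => by
      refine and_congr_right fun h => hP s ?_
      have := h.gcd_eq
      rw [hU.gcd_eq_one] at this
      exact this.symm
    have h3 : ∑ s ∈ range n with ((u : ZMod m).val ≡ s [MOD d] ∧ s.Coprime n),
        Int.fract (-((a : ℚ) * s / n))
        = ∑ s ∈ range n with (u : ZMod m).val ≡ s [MOD d],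
          ∑ e ∈ P.divisors with e ∣ s, (ArithmeticFunction.moebius e : ℚ)
            * Int.fract (-((a : ℚ) * s / n)) := by
      simp only [h2]
      rw [← filter_filter, sum_filter (fun s : ℕ => s.Coprime P)]
      refine sum_congr rfl fun s _ => ?_
      rw [← sum_mul, ← Int.cast_sum, sum_moebius_dvd hP0]
      split_ifs <;> simp
    rw [h3]
    have h4 : ∀ s ∈ ({s ∈ range n | (u : ZMod m).val ≡ s [MOD d]} : Finset ℕ),
        ∑ e ∈ P.divisors with e ∣ s, (ArithmeticFunction.moebius e : ℚ)
            * Int.fract (-((a : ℚ) * s / n))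
        = ∑ e ∈ P.divisors, if e ∣ s then (ArithmeticFunction.moebius e : ℚ)
            * Int.fract (-((a : ℚ) * s / n)) else 0 := fun s _ => sum_filter _ _
    rw [sum_congr rfl h4, sum_comm]
    refine sum_congr rfl fun e he => ?_
    rw [← sum_filter, filter_filter, ← mul_sum, hgbc e he u]
    simp [mul_add]
  rw [key]
  exact sum_mem fun e _ => zsmul_mem (add_mem (zsmul_mem (theta_mem_thetaGroup m _) _)
    (zsmul_mem (half_normElt_mem_thetaGroup m) _)) _

theorem thetaCor_self (m : ℕ) [NeZero m] (a : ℤ) : thetaCor m m a = theta m a := by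
  apply (coeffEquiv m).injective
  funext u
  rw [coeffEquiv_thetaCor, coeffEquiv_theta, Nat.gcd_self]
  have : (univ.filter fun v : (ZMod m)ˣ => (u : ZMod m).val ≡ (v : ZMod m).val [MOD m]) = {u} := by
    ext v
    simp only [mem_filter, mem_univ, true_and, mem_singleton]
    refine ⟨fun h => Units.ext (ZMod.val_injective m ?_), fun h => by rw [h]⟩
    exact (Nat.ModEq.eq_of_lt_of_lt h (ZMod.val_lt _) (ZMod.val_lt _)).symm
  rw [this, sum_singleton]

/-- The group `G_2` is trivial and `θ_2(1)` is half its identity element; corestriction spreads it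
over all of `G_m`. -/
theorem thetaCor_two_one (m : ℕ) [NeZero m] : thetaCor m 2 1 = (1 / 2 : ℚ) • normElt m := by
  apply (coeffEquiv m).injective
  funext u
  rw [coeffEquiv_thetaCor, map_smul, coeffEquiv_normElt]
  have h1 : ((1 : (ZMod 2)ˣ) : ZMod 2).val = 1 := rfl
  have : (univ.filter fun v : (ZMod 2)ˣ =>
      (u : ZMod m).val ≡ (v : ZMod 2).val [MOD m.gcd 2]) = {1} := by
    ext v
    have hv : v = 1 := Subsingleton.elim _ _
    simp only [mem_filter, mem_univ, true_and, mem_singleton, hv, h1, iff_true]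
    have hu : ((u : ZMod m).val).Coprime (m.gcd 2) :=
      (ZMod.val_coe_unit_coprime u).coprime_dvd_right (Nat.gcd_dvd_left m 2)
    rcases (Nat.dvd_prime Nat.prime_two).1 (Nat.gcd_dvd_right m 2) with h | h
    · rw [h]; exact Nat.modEq_one
    · rw [h] at hu ⊢
      exact Nat.odd_iff.1 (Nat.coprime_two_right.1 hu)
  rw [this, sum_singleton, thetaFun, h1, Int.fract_eq_iff]
  refine ⟨by norm_num, by norm_num, -1, by norm_num⟩

theorem SPrime_eq_thetaGroup (m : ℕ) [NeZero m] : SPrime m = thetaGroup m := by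
  refine le_antisymm ((AddSubgroup.closure_le _).2 ?_) ((AddSubgroup.closure_le _).2 ?_)
  · rintro _ ⟨n, _, a, rfl⟩
    exact thetaCor_mem_thetaGroup m n a
  · rintro _ (⟨a, rfl⟩ | rfl)
    · exact AddSubgroup.subset_closure ⟨m, inferInstance, a, (thetaCor_self m a).symm⟩
    · exact AddSubgroup.subset_closure ⟨2, ⟨two_ne_zero⟩, 1, (thetaCor_two_one m).symm⟩

/-! ### The odd part of the Stickelberger elements -/

theorem theta_eq_zero_of_dvd (m : ℕ) [NeZero m] {a : ℤ} (h : (m : ℤ) ∣ a) : theta m a = 0 := by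
  rw [theta_congr m (Int.modEq_zero_iff_dvd.2 h)]
  simp [theta]

theorem natCast_zmod_mul_unit_eq_zero_iff {m : ℕ} (a : ℤ) (u : (ZMod m)ˣ) :
    (a : ZMod m) * u = 0 ↔ (m : ℤ) ∣ a := by
  rw [Units.mul_left_eq_zero, ZMod.intCast_zmod_eq_zero_iff_dvd]

/-- `θ_m(a) - ½ N_m`, or zero if `m ∣ a`: the element whose coefficients are given by the
sawtooth function. -/
def oddTheta (m : ℕ) [NeZero m] (a : ℤ) : MonoidAlgebra ℚ (GalCyc m) :=
  theta m a - if (m : ℤ) ∣ a then 0 else (1 / 2 : ℚ) • normElt m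

theorem oddTheta_congr (m : ℕ) [NeZero m] {a b : ℤ} (h : a ≡ b [ZMOD m]) :
    oddTheta m a = oddTheta m b := by
  rw [oddTheta, oddTheta, theta_congr m h]
  simp only [← Int.modEq_zero_iff_dvd]
  congr 1
  exact if_congr ⟨h.symm.trans, h.trans⟩ rfl rfl

theorem oddTheta_of_dvd (m : ℕ) [NeZero m] {a : ℤ} (h : (m : ℤ) ∣ a) : oddTheta m a = 0 := by
  rw [oddTheta, theta_eq_zero_of_dvd m h, if_pos h, sub_zero]

theorem theta_eq_oddTheta_add (m : ℕ) [NeZero m] {a : ℤ} (h : ¬ (m : ℤ) ∣ a) :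
    theta m a = oddTheta m a + (1 / 2 : ℚ) • normElt m := by
  rw [oddTheta, if_neg h, sub_add_cancel]

theorem coeffEquiv_oddTheta (m : ℕ) [NeZero m] (a : ℤ) (u : (ZMod m)ˣ) :
    coeffEquiv m (oddTheta m a) u = saw (-(a * (u : ZMod m)) : ZMod m) := by
  by_cases h : (m : ℤ) ∣ a
  · rw [oddTheta_of_dvd m h, (natCast_zmod_mul_unit_eq_zero_iff a u).2 h, neg_zero, saw_zero]
    simp
  · have h0 : (-(a * (u : ZMod m)) : ZMod m) ≠ 0 := by
      rw [neg_ne_zero, Ne, natCast_zmod_mul_unit_eq_zero_iff]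
      exact h
    rw [oddTheta, if_neg h, map_sub, map_smul, coeffEquiv_theta, coeffEquiv_normElt, saw, if_neg h0]
    simp only [Pi.sub_apply, Pi.smul_apply, Pi.one_apply, smul_eq_mul, mul_one, thetaFun]
    congr 1
    set z : ZMod m := -(a * (u : ZMod m)) with hz
    have h1 : (-(a * (u : ZMod m).val) : ℤ) ≡ z.val [ZMOD m] := by
      rw [← ZMod.intCast_eq_intCast_iff]
      push_cast
      simp [hz]
    have hm : (0 : ℚ) < m := by exact_mod_cast NeZero.pos m
    rw [Int.fract_eq_iff]
    obtain ⟨k, hk⟩ := h1.symm.dvd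
    refine ⟨by positivity, ?_, k, ?_⟩
    · rw [div_lt_one hm]; exact_mod_cast ZMod.val_lt z
    · have : (-(a * (u : ZMod m).val) : ℚ) - z.val = m * k := by exact_mod_cast hk
      field_simp
      linarith

theorem oddTheta_neg (m : ℕ) [NeZero m] (a : ℤ) : oddTheta m (-a) = -oddTheta m a := by
  apply (coeffEquiv m).injective
  funext u
  rw [map_neg, Pi.neg_apply, coeffEquiv_oddTheta, coeffEquiv_oddTheta, ← saw_neg]
  congr 1
  push_cast
  ring

theorem theta_neg (m : ℕ) [NeZero m] {a : ℤ} (h : ¬ (m : ℤ) ∣ a) :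
    theta m (-a) = normElt m - theta m a := by
  rw [theta_eq_oddTheta_add m h, theta_eq_oddTheta_add m (by rwa [dvd_neg]), oddTheta_neg]
  have : normElt m = (1 / 2 : ℚ) • normElt m + (1 / 2 : ℚ) • normElt m := by
    rw [← add_smul]; norm_num
  nth_rewrite 2 [this]
  abel

theorem sum_theta_add (m : ℕ) [NeZero m] {k r : ℕ} (h : m = k * r) (a : ℤ) :
    ∑ j ∈ range k, theta m (a + j * r) = theta m (k * a) + ((k - 1) / 2 : ℚ) • normElt m := by
  have hk : 0 < k := Nat.pos_of_ne_zero fun h0 => NeZero.ne m (by rw [h, h0, zero_mul])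
  have hr : 0 < r := Nat.pos_of_ne_zero fun h0 => NeZero.ne m (by rw [h, h0, mul_zero])
  have hk' : (k : ℚ) ≠ 0 := by exact_mod_cast hk.ne'
  have hr' : (r : ℚ) ≠ 0 := by exact_mod_cast hr.ne'
  apply (coeffEquiv m).injective
  funext u
  have hmq : (m : ℚ) = k * r := by exact_mod_cast h
  have hcop : IsCoprime ((u : ZMod m).val : ℤ) k :=
    Nat.isCoprime_iff_coprime.2
      ((ZMod.val_coe_unit_coprime u).coprime_dvd_right ⟨r, h⟩)
  have h1 := sum_fract_sub_mul_div (u : ZMod m).val hk one_pos (one_mul k).symm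
    (by rw [Nat.cast_one, one_mul]) hcop (-((a : ℚ) * (u : ZMod m).val / m))
  rw [map_sum, Finset.sum_apply]
  simp only [map_add, map_smul, coeffEquiv_theta, coeffEquiv_normElt, Pi.add_apply, Pi.smul_apply,
    Pi.one_apply, thetaFun, smul_eq_mul, mul_one]
  rw [Nat.cast_one, one_mul] at h1
  convert h1 using 2
  · rename_i j _
    congr 1
    rw [hmq]
    push_cast
    field_simp
    ring
  · congr 1
    push_cast
    ring

/-- This counts the terms in which `oddTheta` lacks the summand `-½ N_m`, the correction needed to
pass from `sum_theta_add` to `sum_oddTheta_add`. -/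
theorem card_dvd_add_mul {m k r : ℕ} (h : m = k * r) (hm : 0 < m) (a : ℤ) :
    #((range k).filter fun j : ℕ => (m : ℤ) ∣ a + (j : ℤ) * r) = if (m : ℤ) ∣ k * a then 1 else 0 := by
  have hk : (0 : ℤ) < k := by
    exact_mod_cast Nat.pos_of_ne_zero fun h0 => hm.ne' (by rw [h, h0, zero_mul])
  have hr : (0 : ℤ) < r := by
    exact_mod_cast Nat.pos_of_ne_zero fun h0 => hm.ne' (by rw [h, h0, mul_zero])
  have hm' : (m : ℤ) = k * r := by exact_mod_cast h
  simp only [hm', mul_dvd_mul_iff_left hk.ne']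
  split_ifs with hra
  · obtain ⟨c, rfl⟩ := hra
    have h1 : ∀ j : ℕ, (k : ℤ) * r ∣ r * c + j * r ↔ (k : ℤ) ∣ c + j := fun j => by
      rw [show (r : ℤ) * c + j * r = (c + j) * r by ring, mul_dvd_mul_iff_right hr.ne']
    simp only [h1]
    rw [card_eq_one]
    refine ⟨((-c) % k).toNat, ?_⟩
    have h2 := Int.emod_nonneg (-c) hk.ne'
    have h3 := Int.emod_lt_of_pos (-c) hk
    ext j
    simp only [mem_filter, mem_range, mem_singleton]
    have h4 : (k : ℤ) ∣ c + j ↔ (-c) % k = j % k := by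
      rw [← Int.ModEq, Int.modEq_iff_dvd]
      simp [add_comm]
    rw [h4]
    constructor
    · rintro ⟨hj, h5⟩
      have h6 : (j : ℤ) % k = j := Int.emod_eq_of_lt (by positivity) (by exact_mod_cast hj)
      rw [h6] at h5
      omega
    · rintro rfl
      rw [Int.toNat_of_nonneg h2, Int.emod_emod]
      exact ⟨by omega, rfl⟩
  · rw [card_eq_zero, filter_eq_empty_iff]
    intro j _ hj
    exact hra ((dvd_add_left (dvd_mul_left _ _)).1 ((dvd_mul_left _ _).trans hj))

/-- The constant of `sum_theta_add` is absorbed by the normalisation at multiples of `m`, so the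
relation for the odd parts is homogeneous. -/
theorem sum_oddTheta_add (m : ℕ) [NeZero m] {k r : ℕ} (h : m = k * r) (a : ℤ) :
    ∑ j ∈ range k, oddTheta m (a + j * r) = oddTheta m (k * a) := by
  have h1 : ∀ b : ℤ, oddTheta m b = theta m b - (1 / 2 : ℚ) • normElt m
      + (if (m : ℤ) ∣ b then (1 : ℚ) else 0) • (1 / 2 : ℚ) • normElt m := fun b => by
    rw [oddTheta]; split_ifs <;> simp
  simp only [h1, sum_add_distrib, sum_sub_distrib, sum_theta_add m h, ← sum_smul, sum_boole,
    sum_const, card_range, card_dvd_add_mul h (NeZero.pos m)]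
  rw [← Nat.cast_smul_eq_nsmul ℚ]
  split_ifs <;> module

end

end ShortStickelberger

/-! ### The odd distribution attached to Stickelberger elements -/

namespace ShortStickelberger

noncomputable section

open Finset Function

section Dictionary

variable {t m : ℕ} {q : Fin t → ℕ}

theorem IsOrderedFactorization.neZero (hq : IsOrderedFactorization m q) (i : Fin t) :
    NeZero (q i) := ⟨by have := hq.two_lt i; omega⟩

theorem IsOrderedFactorization.dvd (hq : IsOrderedFactorization m q) (i : Fin t) : q i ∣ m := by
  rw [← hq.prod_eq]; exact dvd_prod_of_mem _ (mem_univ i)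

theorem IsOrderedFactorization.dvd_iff (hq : IsOrderedFactorization m q) (a : ℤ) :
    (m : ℤ) ∣ a ↔ ∀ i, (q i : ℤ) ∣ a := by
  refine ⟨fun h i => (Int.natCast_dvd_natCast.2 (hq.dvd i)).trans h, fun h => ?_⟩
  rw [← hq.prod_eq]
  push_cast
  exact Fintype.prod_dvd_of_coprime (fun i j hij => Nat.isCoprime_iff_coprime.2 (hq.coprime hij)) h

theorem IsOrderedFactorization.div_eq_prod (hq : IsOrderedFactorization m q) (j : Fin t) :
    m / q j = ∏ l ∈ univ.erase j, q l :=
  Nat.div_eq_of_eq_mul_right (by have := hq.two_lt j; omega)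
    (by rw [mul_prod_erase _ _ (mem_univ j), hq.prod_eq])

theorem IsOrderedFactorization.div_dvd (hq : IsOrderedFactorization m q) {j : Fin t} {a : ℤ}
    (h : ∀ l, l ≠ j → (q l : ℤ) ∣ a) : ((m / q j : ℕ) : ℤ) ∣ a := by
  rw [hq.div_eq_prod]
  push_cast
  exact prod_dvd_of_coprime (fun i _ l _ hil => Nat.isCoprime_iff_coprime.2 (hq.coprime hil))
    fun l hl => h l (mem_erase.1 hl).1

theorem IsOrderedFactorization.dvd_div (hq : IsOrderedFactorization m q) {l j : Fin t}
    (h : l ≠ j) : q l ∣ m / q j := by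
  rw [hq.div_eq_prod]
  exact dvd_prod_of_mem _ (mem_erase.2 ⟨h, mem_univ l⟩)

theorem IsOrderedFactorization.modEq_iff (hq : IsOrderedFactorization m q) (a b : ℤ) :
    a ≡ b [ZMOD m] ↔ ∀ i, (a : ZMod (q i)) = b := by
  simp only [ZMod.intCast_eq_intCast_iff_dvd_sub, Int.modEq_iff_dvd, hq.dvd_iff]

theorem IsOrderedFactorization.exists_int (hq : IsOrderedFactorization m q)
    (z : ∀ i, ZMod (q i)) : ∃ a : ℤ, ∀ i, (a : ZMod (q i)) = z i := by
  obtain ⟨a, ha⟩ := ZMod.intCast_surjective ((ZMod.prodEquivPi q hq.coprime).symm z)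
  refine ⟨a, fun i => ?_⟩
  have := congrArg (ZMod.prodEquivPi q hq.coprime) ha
  rw [map_intCast, RingEquiv.apply_symm_apply] at this
  rw [← this]
  rfl

theorem IsOrderedFactorization.isUnit_prod (hq : IsOrderedFactorization m q) {S : Finset (Fin t)}
    {i : Fin t} (hi : i ∉ S) : IsUnit (∏ l ∈ S, (q l : ZMod (q i))) := by
  rw [← Nat.cast_prod]
  refine (ZMod.isUnit_iff_coprime _ _).2 (Nat.Coprime.prod_left fun l hl => hq.coprime ?_)
  rintro rfl
  exact hi hl

/-- The inclusion of the units, and of zero. -/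
def coord {n : ℕ} : WithZero (ZMod n)ˣ →*₀ ZMod n := WithZero.lift' (Units.coeHom (ZMod n))

@[simp]
theorem coord_coe {n : ℕ} (g : (ZMod n)ˣ) : coord (g : WithZero (ZMod n)ˣ) = g :=
  WithZero.lift'_coe _ _

/-- `a` is an integer with `i`-th residue class `y i * ∏_{y l = 0} q l`, for all `i`. -/
def IsRep (q : Fin t → ℕ) (y : ∀ i, WithZero (ZMod (q i))ˣ) (a : ℤ) : Prop :=
  ∀ i, (a : ZMod (q i)) = (∏ l ∈ (supp y)ᶜ, (q l : ZMod (q i))) * coord (y i)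

theorem IsOrderedFactorization.exists_isRep (hq : IsOrderedFactorization m q)
    (y : ∀ i, WithZero (ZMod (q i))ˣ) : ∃ a, IsRep q y a :=
  hq.exists_int _

/-- The value at `y` of the odd distribution attached to the elements `oddTheta m a`. -/
def thetaAt [NeZero m] (hq : IsOrderedFactorization m q) (y : ∀ i, WithZero (ZMod (q i))ˣ) :
    MonoidAlgebra ℚ (GalCyc m) :=
  oddTheta m (hq.exists_isRep y).choose

theorem thetaAt_eq [NeZero m] (hq : IsOrderedFactorization m q)
    {y : ∀ i, WithZero (ZMod (q i))ˣ} {a : ℤ} (h : IsRep q y a) : thetaAt hq y = oddTheta m a :=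
  oddTheta_congr m ((hq.modEq_iff _ _).2 fun i => by rw [(hq.exists_isRep y).choose_spec i, h i])

theorem sum_range_eq_sum_isUnit_add {p k : ℕ} [NeZero (p ^ k)] (hp : p.Prime) (hk : 0 < k)
    {V : Type*} [AddCommGroup V] (F : ZMod (p ^ k) → V) :
    ∑ g : (ZMod (p ^ k))ˣ, F g
      = ∑ x ∈ range (p ^ k), F (x : ZMod (p ^ k))
        - ∑ x ∈ range (p ^ (k - 1)), F ((p * x : ℕ) : ZMod (p ^ k)) := by
  have hpk : p ^ k = p * p ^ (k - 1) := by rw [← pow_succ', Nat.sub_add_cancel hk]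
  have h1 := sum_units_eq_sum_range (n := p ^ k) (fun s => F (s : ZMod (p ^ k))) (fun _ => True)
  simp only [filter_true, ZMod.natCast_zmod_val, true_and] at h1
  rw [h1, eq_sub_iff_add_eq, ← sum_filter_add_sum_filter_not (range (p ^ k)) (fun s => s.Coprime (p ^ k))]
  congr 1
  symm
  refine sum_bij' (fun x _ => x / p) (fun x _ => p * x) ?_ ?_ ?_ ?_ ?_
  · intro x hx
    rw [mem_filter, mem_range, hpk] at hx
    exact mem_range.2 (Nat.div_lt_of_lt_mul hx.1)
  · intro x hx
    rw [mem_range] at hx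
    rw [mem_filter, mem_range, Nat.coprime_pow_right_iff hk]
    refine ⟨?_, fun h => hp.one_lt.ne' (Nat.Coprime.eq_one_of_dvd h.symm (dvd_mul_right p x))⟩
    rw [hpk]
    exact Nat.mul_lt_mul_of_pos_left hx hp.pos
  · intro x hx
    rw [mem_filter, Nat.coprime_pow_right_iff hk, Nat.coprime_comm, hp.coprime_iff_not_dvd,
      not_not] at hx
    exact Nat.mul_div_cancel' hx.2
  · intro x _
    exact Nat.mul_div_cancel_left x hp.pos
  · intro x hx
    rw [mem_filter, Nat.coprime_pow_right_iff hk, Nat.coprime_comm, hp.coprime_iff_not_dvd,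
      not_not] at hx
    rw [Nat.mul_div_cancel' hx.2]

theorem minFac_eq_of_pow_eq {p k n : ℕ} (hp : p.Prime) (hk : k ≠ 0) (h : p ^ k = n) : n.minFac = p := by
  rw [← h, hp.pow_minFac hk]

theorem isUnit_minFac (hq : IsOrderedFactorization m q) {i l : Fin t} (h : l ≠ i) :
    IsUnit ((q i).minFac : ZMod (q l)) :=
  (ZMod.isUnit_iff_coprime _ _).2
    ((hq.coprime h.symm).coprime_dvd_left (Nat.minFac_dvd _))

/-- The inverse of the prime dividing `q i`, as a unit modulo the other `q l`. -/
def frobUnit (hq : IsOrderedFactorization m q) (i l : Fin t) : (ZMod (q l))ˣ :=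
  -- The value 1 at `l = i` is immaterial: `frobUnit hq i` is applied to points whose `i`-th
  -- coordinate is zero.
  if h : l = i then 1 else (isUnit_minFac hq h).unit⁻¹

theorem minFac_mul_frobUnit (hq : IsOrderedFactorization m q) {i l : Fin t} (h : l ≠ i) :
    ((q i).minFac : ZMod (q l)) * frobUnit hq i l = 1 := by
  rw [frobUnit, dif_neg h]
  exact (isUnit_minFac hq h).mul_val_inv

/-- A sum over units modulo `q i = p ^ k` is the sum over all residues minus that over multiples of
`p`. By `sum_oddTheta_add` these two sums give the arguments `q i * a` and `p ^ (k - 1) * a`. The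
factor `∏ q l` in `IsRep` makes the first of them represent the point with `i`-th coordinate zeroed;
the second differs from it by the unit `p⁻¹` at the other coordinates. -/
theorem sum_thetaAt_update [NeZero m] (hq : IsOrderedFactorization m q) [∀ i, NeZero (q i)]
    (y : ∀ i, WithZero (ZMod (q i))ˣ) (i : Fin t) :
    ∑ g : (ZMod (q i))ˣ, thetaAt hq (update y i (g : WithZero (ZMod (q i))ˣ))
      = thetaAt hq (update y i 0) - thetaAt hq (act (frobUnit hq i) (update y i 0)) := by
  obtain ⟨p, k, hp, hk, hpk⟩ := (isPrimePow_nat_iff _).1 (hq.isPrimePow i)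
  have hmin : (q i).minFac = p := minFac_eq_of_pow_eq hp hk.ne' hpk
  have hqi : q i = p * p ^ (k - 1) := by rw [← hpk, ← pow_succ', Nat.sub_add_cancel hk]
  obtain ⟨c, hc⟩ := hq.dvd i
  set S₁ : Finset (Fin t) := (supp y ∪ {i})ᶜ with hS₁
  have hiS₁ : i ∉ S₁ := by simp [hS₁]
  have hsupp0 : (supp (update y i 0))ᶜ = insert i S₁ := by
    ext l
    by_cases h : l = i <;> simp [hS₁, mem_supp, h]
  have hsuppg : ∀ g : (ZMod (q i))ˣ,
      (supp (update y i (g : WithZero (ZMod (q i))ˣ)))ᶜ = S₁ := fun g => by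
    ext l
    by_cases h : l = i
    · subst h; simp [hS₁, mem_supp]
    · simp [hS₁, mem_supp, h]
  have hcl : ∀ l, l ≠ i → (c : ZMod (q l)) = 0 := fun l hl => by
    rw [ZMod.natCast_eq_zero_iff]
    exact (hq.coprime hl).dvd_of_dvd_mul_left (hc ▸ hq.dvd l)
  have hci : IsUnit (c : ZMod (q i)) := by
    have : c = ∏ l ∈ univ.erase i, q l := by
      refine Nat.eq_of_mul_eq_mul_left (NeZero.pos (q i)) ?_
      rw [← hc, mul_prod_erase _ _ (mem_univ i), hq.prod_eq]
    rw [this, Nat.cast_prod]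
    exact hq.isUnit_prod (by simp)
  obtain ⟨γ, hγ⟩ := hci
  obtain ⟨ρ, hρ⟩ := hq.isUnit_prod hiS₁
  -- The integer `a` carries the coordinates away from `i`, and `c = m / q i` moves only the class
  -- modulo `q i`.
  obtain ⟨a, ha⟩ := hq.exists_int
    (update (fun l => (∏ s ∈ S₁, (q s : ZMod (q l))) * coord (y l)) i 0)
  have hai : (a : ZMod (q i)) = 0 := by rw [ha i, update_self]
  have hal : ∀ l, l ≠ i → (a : ZMod (q l)) = (∏ s ∈ S₁, (q s : ZMod (q l))) * coord (y l) :=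
    fun l hl => by rw [ha l, update_of_ne hl]
  -- The unit `ρ * γ⁻¹` accounts for the product in `IsRep` and for the class of `c`; it permutes
  -- the units and so drops out of the sum.
  have hunit : ∀ g : (ZMod (q i))ˣ, thetaAt hq (update y i (g : WithZero (ZMod (q i))ˣ))
      = oddTheta m (a + ((ρ * γ⁻¹ * g : (ZMod (q i))ˣ) : ZMod (q i)).val * c) := fun g => by
    refine thetaAt_eq hq fun l => ?_
    rw [hsuppg]
    by_cases hl : l = i
    · subst hl
      rw [update_self, coord_coe, ← hρ]
      push_cast
      rw [ZMod.natCast_zmod_val, hai, ← hγ, mul_right_comm, mul_assoc (ρ : ZMod (q l)),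
        Units.inv_mul, zero_add, mul_one]
    · rw [update_of_ne hl, ← hal l hl]
      push_cast
      rw [hcl l hl, mul_zero, add_zero]
  have hper : ∀ x : ℕ, oddTheta m (a + (x : ZMod (q i)).val * c) = oddTheta m (a + x * c) :=
    fun x => by
    refine oddTheta_congr m (Int.ModEq.add_left _ ?_)
    rw [hc, Nat.cast_mul, mul_comm _ (c : ℤ), mul_comm _ (c : ℤ), mul_comm _ (c : ℤ)]
    refine Int.ModEq.mul_left' ?_
    rw [← ZMod.intCast_eq_intCast_iff]
    push_cast
    rw [ZMod.natCast_zmod_val]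
  have h0 : thetaAt hq (update y i 0) = oddTheta m (q i * a) := by
    refine thetaAt_eq hq fun l => ?_
    rw [hsupp0, prod_insert hiS₁]
    by_cases hl : l = i
    · subst hl; simp
    · rw [update_of_ne hl, mul_assoc, ← hal l hl]; push_cast; rfl
  have h1 : thetaAt hq (act (frobUnit hq i) (update y i 0)) = oddTheta m ((p ^ (k - 1) : ℕ) * a) := by
    refine thetaAt_eq hq fun l => ?_
    rw [supp_act, hsupp0, prod_insert hiS₁]
    by_cases hl : l = i
    · subst hl; simp [act, hai]
    · have h2 := minFac_mul_frobUnit hq hl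
      rw [hmin] at h2
      rw [act, update_of_ne hl, map_mul, coord_coe, hqi]
      push_cast
      rw [hal l hl]
      linear_combination (-(p : ZMod (q l)) ^ (k - 1) * ((∏ s ∈ S₁, (q s : ZMod (q l))) * coord (y l))) * h2
  rw [h0, h1, ← sum_oddTheta_add m hc, ← sum_oddTheta_add m (k := p ^ (k - 1)) (r := p * c)
    (by rw [hc, hqi]; ring)]
  simp only [hunit]
  rw [show ∑ g : (ZMod (q i))ˣ, oddTheta m (a + ((ρ * γ⁻¹ * g : (ZMod (q i))ˣ) : ZMod (q i)).val * c)
    = ∑ g : (ZMod (q i))ˣ, oddTheta m (a + (g : ZMod (q i)).val * c) from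
    Equiv.sum_comp (Equiv.mulLeft (ρ * γ⁻¹))
      fun g : (ZMod (q i))ˣ => oddTheta m (a + (g : ZMod (q i)).val * c)]
  -- A variable `n` stands for `q i`, since `q i` occurs in types and cannot be rewritten to `p ^ k`
  -- in place.
  have key : ∀ n : ℕ, p ^ k = n → ∀ _ : NeZero n, ∀ F : ZMod n → MonoidAlgebra ℚ (GalCyc m),
      ∑ g : (ZMod n)ˣ, F g = ∑ x ∈ range n, F x
        - ∑ x ∈ range (p ^ (k - 1)), F ((p * x : ℕ) : ZMod n) := by
    rintro n rfl _ F
    exact sum_range_eq_sum_isUnit_add hp hk F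
  rw [key _ hpk inferInstance fun z => oddTheta m (a + z.val * c)]
  simp only [hper]
  congr 1
  refine sum_congr rfl fun x _ => ?_
  push_cast
  ring_nf

/-- The units of `ZMod n` represented by integers less than `n / 2`. -/
def lowUnits (n : ℕ) : Set (ZMod n)ˣ := {g | 2 * (g : ZMod n).val < n}

theorem neg_mul_mem_lowUnits {n : ℕ} (hn : 2 < n) (g : (ZMod n)ˣ) :
    -1 * g ∈ lowUnits n ↔ g ∉ lowUnits n := by
  have : NeZero n := ⟨by omega⟩
  have : Fact (1 < n) := ⟨by omega⟩
  have h1 : (g : ZMod n) ≠ 0 := g.ne_zero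
  have h2 : 2 * (g : ZMod n).val ≠ n := fun h => by
    have h3 := ZMod.val_coe_unit_coprime g
    have h4 := Nat.Coprime.eq_one_of_dvd h3 ⟨2, by omega⟩
    omega
  have h3 := ZMod.val_lt (g : ZMod n)
  rw [neg_one_mul]
  simp only [lowUnits, Set.mem_ofPred_eq, Units.val_neg, ZMod.neg_val, if_neg h1]
  omega

theorem one_mem_lowUnits {n : ℕ} (hn : 2 < n) : 1 ∈ lowUnits n := by
  have : Fact (1 < n) := ⟨by omega⟩
  simp only [lowUnits, Set.mem_ofPred_eq, Units.val_one, ZMod.val_one]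
  omega

/-- The odd distribution attached to the elements `oddTheta m a`. -/
def thetaDistribution [NeZero m] (hq : IsOrderedFactorization m q) [∀ i, NeZero (q i)] :
    OddDistribution (fun i => (ZMod (q i))ˣ) (MonoidAlgebra ℚ (GalCyc m)) where
  neg _ := -1
  neg_mul_neg _ := by simp
  low i := lowUnits (q i)
  one_mem_low i := one_mem_lowUnits (hq.two_lt i)
  neg_mul_mem_low i g := neg_mul_mem_lowUnits (hq.two_lt i) g
  frob := frobUnit hq
  toFun := thetaAt hq
  map_neg y := by
    obtain ⟨a, ha⟩ := hq.exists_isRep y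
    rw [thetaAt_eq hq ha, ← oddTheta_neg]
    refine thetaAt_eq hq fun i => ?_
    rw [supp_act, act, map_mul, coord_coe]
    push_cast
    rw [ha i]
    ring
  sum_update := sum_thetaAt_update hq

end Dictionary

end

end ShortStickelberger

/-! ### Points and their integer representatives; reduced points and `M_m` -/

namespace ShortStickelberger

noncomputable section

open Finset Function

section Representatives

variable {t m : ℕ} {q : Fin t → ℕ} {y : ∀ i, WithZero (ZMod (q i))ˣ} {a : ℤ} {b : ℕ}

theorem IsOrderedFactorization.nontrivial (hq : IsOrderedFactorization m q) (i : Fin t) :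
    Nontrivial (ZMod (q i)) :=
  have : Fact (1 < q i) := ⟨(Nat.lt_succ_self 1).trans (hq.two_lt i)⟩
  inferInstance

theorem eq_zero_or_eq_coe {G : Type*} (x : WithZero G) : x = 0 ∨ ∃ g : G, x = g :=
  (em (x = 0)).imp_right fun h => (WithZero.ne_zero_iff_exists.1 h).imp fun _ => Eq.symm

theorem IsRep.isUnit_prod (hq : IsOrderedFactorization m q) {i : Fin t} (hi : y i ≠ 0) :
    IsUnit (∏ l ∈ (supp y)ᶜ, (q l : ZMod (q i))) :=
  hq.isUnit_prod (by simpa [mem_supp] using hi)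

theorem IsRep.isUnit (hq : IsOrderedFactorization m q) (h : IsRep q y a) {i : Fin t}
    (hi : y i ≠ 0) : IsUnit (a : ZMod (q i)) := by
  rw [h i]
  refine (IsRep.isUnit_prod hq hi).mul ?_
  obtain ⟨g, hg⟩ := (eq_zero_or_eq_coe (y i)).resolve_left hi
  rw [hg, coord_coe]
  exact g.isUnit

theorem IsRep.dvd_iff (hq : IsOrderedFactorization m q) (h : IsRep q y a) (i : Fin t) :
    (q i : ℤ) ∣ a ↔ y i = 0 := by
  have := hq.nontrivial i
  rw [← ZMod.intCast_zmod_eq_zero_iff_dvd]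
  constructor
  · intro h0
    by_contra hi
    exact (h.isUnit hq hi).ne_zero h0
  · intro h0
    rw [h i, h0, map_zero, mul_zero]

theorem IsRep.J'_eq (hq : IsOrderedFactorization m q) (h : IsRep q y b) : J' q b = supp y := by
  ext i
  rw [mem_supp, Ne, ← h.dvd_iff hq, Int.natCast_dvd_natCast]
  simp [J']

theorem IsRep.J_eq (hq : IsOrderedFactorization m q) (h : IsRep q y b) : J q b = (supp y)ᶜ := by
  ext i
  rw [mem_compl, mem_supp, not_not, ← h.dvd_iff hq, Int.natCast_dvd_natCast]
  simp [J]

/-- So the factor in `IsRep` is `(b, m)`. This is why the coordinates 1 and -1 correspond to the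
congruences `b ≡ ±(b, m)` in the definition of `M`. -/
theorem IsRep.gcd_eq (hq : IsOrderedFactorization m q) (h : IsRep q y b) :
    b.gcd m = ∏ l ∈ (supp y)ᶜ, q l := by
  rw [← h.J_eq hq]
  change b.gcd m = rPart q b
  have hm : m = rPart q b * ∏ l ∈ supp y, q l := by
    rw [rPart, h.J_eq hq, mul_comm, prod_mul_prod_compl, hq.prod_eq]
  have hcop : b.Coprime (∏ l ∈ supp y, q l) := Nat.Coprime.prod_right fun l hl => by
    have := h.isUnit hq (mem_supp.1 hl)
    rwa [Int.cast_natCast, ZMod.isUnit_iff_coprime] at this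
  rw [hm, hcop.symm.gcd_mul_right_cancel_right, Nat.gcd_eq_right (rPart_dvd hq b)]

theorem exists_isRep_of_forall (hq : IsOrderedFactorization m q)
    (h : ∀ i, (a : ZMod (q i)) = 0 ∨ IsUnit (a : ZMod (q i))) : ∃ y, IsRep q y a := by
  classical
  have key : ∀ i, ∃ x : WithZero (ZMod (q i))ˣ, (x = 0 ↔ (a : ZMod (q i)) = 0) ∧
      (a : ZMod (q i)) = (∏ l ∈ univ.filter fun l => (a : ZMod (q l)) = 0, (q l : ZMod (q i)))
        * coord x := by
    intro i
    by_cases h0 : (a : ZMod (q i)) = 0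
    · exact ⟨0, by simp [h0], by simp [h0]⟩
    · obtain ⟨ρ, hρ⟩ := hq.isUnit_prod (S := univ.filter fun l => (a : ZMod (q l)) = 0)
        (i := i) (by simp [h0])
      obtain ⟨g, hg⟩ := (h i).resolve_left h0
      refine ⟨(ρ⁻¹ * g : (ZMod (q i))ˣ), by simp [h0], ?_⟩
      rw [coord_coe, ← hρ, Units.val_mul, Units.mul_inv_cancel_left, hg]
  choose y hy0 hy using key
  refine ⟨y, fun i => ?_⟩
  have : (supp y)ᶜ = univ.filter fun l => (a : ZMod (q l)) = 0 := by
    ext l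
    simp [mem_supp, hy0]
  rw [this]
  exact hy i

/-- The hypothesis is `(a, m/(a,m)) = 1` written prime by prime: a prime of `q i` dividing `a`
forces `q i ∣ a`. In this form its negation yields the prime needed in `theta_mem_of_forall`. -/
theorem exists_isRep_of_coprime (hq : IsOrderedFactorization m q)
    (h : ∀ p : ℕ, p.Prime → (p : ℤ) ∣ a → ¬ p ∣ m / Int.gcd a m) : ∃ y, IsRep q y a := by
  refine exists_isRep_of_forall hq fun i => ?_
  obtain ⟨p, k, hp, hk, hpk⟩ := (isPrimePow_nat_iff _).1 (hq.isPrimePow i)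
  by_cases hpa : (p : ℤ) ∣ a
  · left
    have h1 : (q i).Coprime (m / Int.gcd a m) := by
      rw [← hpk]
      exact ((hp.coprime_iff_not_dvd).2 (h p hp hpa)).pow_left k
    have h2 : q i ∣ m / Int.gcd a m * Int.gcd a m := by
      rw [Nat.div_mul_cancel]
      · exact hq.dvd i
      · exact_mod_cast Int.gcd_dvd_right a m
    rw [ZMod.intCast_zmod_eq_zero_iff_dvd]
    exact (Int.natCast_dvd_natCast.2 (h1.dvd_of_dvd_mul_left h2)).trans (Int.gcd_dvd_left a m)
  · right
    rw [ZMod.coe_int_isUnit_iff_isCoprime, ← hpk]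
    push_cast
    refine IsCoprime.pow_left ?_
    exact (Nat.prime_iff_prime_int.1 hp).coprime_iff_not_dvd.2 hpa

theorem exists_isRep_of_mem_X (hq : IsOrderedFactorization m q) (hb : b ∈ X m) :
    ∃ y, IsRep q y (b : ℤ) := by
  refine exists_isRep_of_coprime hq fun p hp hpb hpm => ?_
  rw [Int.gcd_natCast_natCast] at hpm
  exact hp.one_lt.ne' (Nat.eq_one_of_dvd_coprimes hb.2.2 (Int.natCast_dvd_natCast.1 hpb) hpm)

theorem IsRep.mem_X (hq : IsOrderedFactorization m q) (h : IsRep q y b) (h0 : 0 < b) (hm : b < m) :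
    b ∈ X m := by
  refine ⟨h0, hm, ?_⟩
  have hm' : m = (b.gcd m) * ∏ l ∈ supp y, q l := by
    rw [h.gcd_eq hq, mul_comm, prod_mul_prod_compl, hq.prod_eq]
  have h1 : m / b.gcd m = ∏ l ∈ supp y, q l :=
    Nat.div_eq_of_eq_mul_right (Nat.gcd_pos_of_pos_left _ h0) hm'
  rw [h1]
  exact Nat.Coprime.prod_right fun l hl => by
    have := h.isUnit hq (mem_supp.1 hl)
    rwa [Int.cast_natCast, ZMod.isUnit_iff_coprime] at this

theorem coord_eq_coe_iff {n : ℕ} [Nontrivial (ZMod n)] {x : WithZero (ZMod n)ˣ}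
    {g : (ZMod n)ˣ} : coord x = (g : ZMod n) ↔ x = g := by
  rcases eq_zero_or_eq_coe x with rfl | ⟨h, rfl⟩
  · rw [map_zero]
    exact ⟨fun h => absurd h.symm g.ne_zero, fun h => absurd h.symm WithZero.coe_ne_zero⟩
  · rw [coord_coe, WithZero.coe_inj, Units.val_inj]

theorem IsRep.eq_gcd_mul (hq : IsOrderedFactorization m q) (h : IsRep q y b) (i : Fin t) :
    (b : ZMod (q i)) = (b.gcd m : ZMod (q i)) * coord (y i) := by
  have := h i
  rw [Int.cast_natCast] at this
  rw [this, h.gcd_eq hq, Nat.cast_prod]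

theorem IsRep.isUnit_gcd (hq : IsOrderedFactorization m q) (h : IsRep q y b) {i : Fin t}
    (hi : y i ≠ 0) : IsUnit (b.gcd m : ZMod (q i)) := by
  rw [h.gcd_eq hq, Nat.cast_prod]
  exact IsRep.isUnit_prod hq hi

theorem IsRep.modEq_gcd_iff (hq : IsOrderedFactorization m q) (h : IsRep q y b) (i : Fin t) :
    b ≡ b.gcd m [MOD q i] ↔ y i = 0 ∨ y i = 1 := by
  have := hq.nontrivial i
  rw [← ZMod.natCast_eq_natCast_iff, h.eq_gcd_mul hq i]
  by_cases hi : y i = 0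
  · have h0 : (b.gcd m : ZMod (q i)) = 0 := by
      rw [h.gcd_eq hq, Nat.cast_prod]
      exact prod_eq_zero (i := i) (by simp [mem_supp, hi]) (by simp)
    simp [hi, h0]
  · rw [(h.isUnit_gcd hq hi).mul_eq_left, ← Units.val_one, coord_eq_coe_iff]
    simp [hi]

theorem IsRep.modEq_neg_gcd_iff (hq : IsOrderedFactorization m q) (h : IsRep q y b) {i : Fin t}
    (hi : y i ≠ 0) :
    (b : ℤ) ≡ -(b.gcd m : ℤ) [ZMOD q i] ↔ y i = ((-1 : (ZMod (q i))ˣ) : WithZero _) := by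
  have := hq.nontrivial i
  rw [← ZMod.intCast_eq_intCast_iff, Int.cast_natCast, Int.cast_neg, Int.cast_natCast]
  conv_lhs => rw [h.eq_gcd_mul hq i]
  rw [← mul_neg_one, (h.isUnit_gcd hq hi).mul_right_inj,
    ← coord_eq_coe_iff]
  simp

/-- If all coordinates are 0 or 1, then `b ≡ (b, m)` modulo `m`, and both numbers are less than `m`.
-/
theorem IsRep.dvd_m_iff (hq : IsOrderedFactorization m q) (h : IsRep q y b) (h0 : 0 < b)
    (hm : b < m) : b ∣ m ↔ ∀ i, y i = 0 ∨ y i = 1 := by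
  simp only [← h.modEq_gcd_iff hq]
  constructor
  · intro h1 i
    rw [Nat.gcd_eq_left h1]
  · intro h1
    have h2 : (b : ℤ) ≡ (b.gcd m : ℕ) [ZMOD m] := by
      rw [hq.modEq_iff]
      intro i
      have := (ZMod.natCast_eq_natCast_iff _ _ _).2 (h1 i)
      push_cast
      exact this
    have h3 := Nat.ModEq.eq_of_lt_of_lt (Int.natCast_modEq_iff.1 h2) hm
      ((Nat.gcd_le_left m h0).trans_lt hm)
    rw [h3]
    exact Nat.gcd_dvd_right b m

theorem IsRep.fract_lt_half_iff (hq : IsOrderedFactorization m q) (h : IsRep q y b) (h0 : 0 < b)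
    {k : Fin t} {g : (ZMod (q k))ˣ} (hk : y k = g) :
    Int.fract ((b : ℚ) / (b.gcd m * q k)) < 1 / 2 ↔ g ∈ lowUnits (q k) := by
  have := hq.neZero k
  have hg0 : 0 < b.gcd m := Nat.gcd_pos_of_pos_left _ h0
  obtain ⟨c, hc⟩ := Nat.gcd_dvd_left b m
  have hcg : (c : ZMod (q k)) = g := by
    have h1 := h.eq_gcd_mul hq k
    rw [hk, coord_coe] at h1
    have hu := h.isUnit_gcd hq (i := k) (by rw [hk]; exact WithZero.coe_ne_zero)
    refine hu.mul_left_cancel ?_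
    rw [← h1]
    conv_rhs => rw [hc]
    push_cast
    rfl
  have h1 : (b : ℚ) / (b.gcd m * q k) = (c : ℚ) / q k := by
    have : (b.gcd m : ℚ) ≠ 0 := by exact_mod_cast hg0.ne'
    have h2 : (b : ℚ) = b.gcd m * c := by exact_mod_cast hc
    have hqk : (q k : ℚ) ≠ 0 := by exact_mod_cast NeZero.ne (q k)
    rw [h2]
    field_simp
  have hq0 : (0 : ℚ) < q k := by exact_mod_cast NeZero.pos (q k)
  rw [h1, lowUnits, Set.mem_ofPred_eq, ← hcg, ZMod.val_natCast,
    Int.fract_div_natCast_eq_div_natCast_mod, div_lt_div_iff₀ hq0 two_pos]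
  norm_cast
  omega

/-- The conditions (i), (ii), (iii) of `M` are the three fields of `IsReduced`, read through the
dictionary. -/
theorem IsRep.mem_M_iff [NeZero m] [∀ i, NeZero (q i)] (hq : IsOrderedFactorization m q)
    (h : IsRep q y b) (h0 : 0 < b) (hm : b < m) :
    b ∈ M m q ↔ (thetaDistribution hq).IsReduced y := by
  have hX := h.mem_X hq h0 hm
  have h1 : (∀ i, ¬ q i ∣ b → ¬ (b : ℤ) ≡ -(b.gcd m : ℤ) [ZMOD q i])
      ↔ ∀ i, y i ≠ ((thetaDistribution hq).neg i : WithZero _) := by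
    refine forall_congr' fun i => ?_
    rw [← Int.natCast_dvd_natCast, h.dvd_iff hq]
    by_cases hi : y i = 0
    · simp [hi]
    · rw [h.modEq_neg_gcd_iff hq hi]
      simp only [hi, not_false_eq_true, true_imp_iff]
      rfl
  have h2 : (¬ b ∣ m → ∀ k, IsGreatest {i | ¬ b ≡ b.gcd m [MOD q i]} k →
      Int.fract ((b : ℚ) / (b.gcd m * q k)) < 1 / 2)
      ↔ ∀ i, ∀ g : (ZMod (q i))ˣ, y i = g → g ≠ 1 → (∀ l, i < l → y l = 0 ∨ y l = 1) →
        g ∈ (thetaDistribution hq).low i := by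
    simp only [IsGreatest, upperBounds, Set.mem_ofPred_eq, h.modEq_gcd_iff hq, h.dvd_m_iff hq h0 hm]
    constructor
    · intro h3 i g hg hg1 hl
      refine (h.fract_lt_half_iff hq h0 hg).1 (h3 ?_ i ⟨?_, ?_⟩)
      · intro h4
        have := h4 i
        rw [hg, ← WithZero.coe_one, WithZero.coe_inj] at this
        exact this.elim WithZero.coe_ne_zero hg1
      · rw [hg, ← WithZero.coe_one, WithZero.coe_inj]
        exact fun h => h.elim WithZero.coe_ne_zero hg1
      · intro l hl'
        by_contra hlt
        exact hl' (hl l (not_le.1 hlt))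
    · rintro h3 - k ⟨hk1, hk2⟩
      push Not at hk1
      obtain ⟨g, hg⟩ := (eq_zero_or_eq_coe (y k)).resolve_left hk1.1
      refine (h.fract_lt_half_iff hq h0 hg).2 (h3 k g hg ?_ ?_)
      · rintro rfl
        exact hk1.2 hg
      · intro l hl
        by_contra h5
        exact absurd (hk2 h5) (not_le.2 hl)
  rw [M, Set.mem_ofPred_eq, h1, h2, h.dvd_m_iff hq h0 hm, h.J'_eq hq]
  exact ⟨fun h => ⟨h.2.1, h.2.2.1, h.2.2.2⟩, fun h => ⟨hX, h.1, h.2, h.3⟩⟩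

end Representatives

end

end ShortStickelberger

/-! ### Generation of all `θ_m(a)` by the `α_m(b)` and the elements at single coordinates -/

namespace ShortStickelberger

noncomputable section

open Finset Function

section Generation

variable {t m : ℕ} [NeZero m] {q : Fin t → ℕ} {y : ∀ i, WithZero (ZMod (q i))ˣ} {a : ℤ} {b : ℕ}

omit [NeZero m] in
theorem IsRep.congr (hq : IsOrderedFactorization m q) {a' : ℤ} (h : IsRep q y a)
    (ha : a ≡ a' [ZMOD m]) : IsRep q y a' := fun i => by
  rw [← (hq.modEq_iff _ _).1 ha i, h i]

theorem IsRep.exists_nat (hq : IsOrderedFactorization m q) (h : IsRep q y a)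
    (hy : (supp y).Nonempty) : ∃ b : ℕ, 0 < b ∧ b < m ∧ a ≡ b [ZMOD m] ∧ IsRep q y (b : ℤ) := by
  have hm : (0 : ℤ) < m := by exact_mod_cast NeZero.pos m
  obtain ⟨i, hi⟩ := hy
  have h0 : a % m ≠ 0 := fun h0 => by
    have := (Int.natCast_dvd_natCast.2 (hq.dvd i)).trans (Int.dvd_of_emod_eq_zero h0)
    exact (mem_supp.1 hi) ((h.dvd_iff hq i).1 this)
  have h1 := Int.emod_nonneg a hm.ne'
  have h2 := Int.emod_lt_of_pos a hm
  have h3 : a ≡ ((a % m).toNat : ℕ) [ZMOD m] := by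
    rw [Int.toNat_of_nonneg h1]
    exact (Int.mod_modEq a m).symm
  exact ⟨(a % m).toNat, by omega, by omega, h3, h.congr hq h3⟩

theorem exists_alpha_eq (hq : IsOrderedFactorization m q) (hc : 1 < #(J' q b)) :
    ∃ j ∈ J' q b, ∃ (v : ℕ) (x y : ℤ), m = q j * rPart q b * v ∧ q j * x + v * y = -1 ∧
      alpha m q b = theta m b + theta m (b * q j * x) + theta m (b * v * y) - normElt m := by
  have h : (J' q b).Nonempty := card_pos.1 (by omega)
  have hj := min'_mem _ h
  set j := (J' q b).min' h with hjdef
  set v := m / (q j * rPart q b) with hv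
  have hcop : (q j).Coprime v := coprime_cofactor hq b j hj
  have hxy : (q j : ℤ) * (-Nat.gcdA (q j) v) + v * (-Nat.gcdB (q j) v) = -1 := by
    have := Nat.gcd_eq_gcd_ab (q j) v
    rw [hcop.gcd_eq_one, Nat.cast_one] at this
    linarith
  exact ⟨j, hj, v, _, _, (Nat.mul_div_cancel' (mul_rPart_dvd hq b j hj)).symm, hxy,
    alpha_eq hq b h hc _ v rfl hv _ _ hxy⟩

/-- Modulo the `q i` the number `b u x` is `-b` except for 0 at `j`, and `b v y` is `-b` at `j` and
0 elsewhere. So `α_m(b)` differs from `oddTheta m b` by values at smaller supports and `½ N_m`. -/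
theorem IsRep.alpha_eq (hq : IsOrderedFactorization m q) (h : IsRep q y b) (hc : 1 < #(supp y)) :
    ∃ z₁ z₂, supp z₁ ⊂ supp y ∧ supp z₂ ⊂ supp y ∧
      alpha m q b = oddTheta m b + thetaAt hq z₁ + thetaAt hq z₂ + (1 / 2 : ℚ) • normElt m := by
  obtain ⟨j, hj, v, x, x', hm, hx, hα⟩ := exists_alpha_eq hq (h.J'_eq hq ▸ hc : 1 < #(J' q b))
  have hjy : y j ≠ 0 := by rwa [h.J'_eq hq, mem_supp] at hj
  have hb : ∀ i, (b : ZMod (q i)) = 0 ∨ IsUnit (b : ZMod (q i)) := fun i => by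
    by_cases hi : y i = 0
    · exact Or.inl (by simpa [hi] using h i)
    · exact Or.inr (by simpa using h.isUnit hq hi)
  have hv : ∀ i, i ≠ j → y i ≠ 0 → (v : ZMod (q i)) = 0 := fun i hij hi => by
    rw [ZMod.natCast_eq_zero_iff]
    have h1 : (q i).Coprime (q j * rPart q b) := by
      refine Nat.Coprime.mul_right (hq.coprime hij) (Nat.Coprime.prod_right fun l hl => ?_)
      refine hq.coprime ?_
      rintro rfl
      rw [h.J_eq hq, mem_compl, mem_supp, not_not] at hl
      exact hi hl
    exact h1.dvd_of_dvd_mul_left (hm ▸ hq.dvd i)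
  have hxi : ∀ i, (q j : ZMod (q i)) * x + v * x' = -1 := fun i => by
    exact_mod_cast congrArg (Int.cast (R := ZMod (q i))) hx
  have h1 : ∀ i, ((b * q j * x : ℤ) : ZMod (q i)) = if i = j then 0 else -(b : ZMod (q i)) := fun i => by
    push_cast
    split_ifs with hij
    · subst hij; simp
    · by_cases hi : y i = 0
      · have : (b : ZMod (q i)) = 0 := by simpa [hi] using h i
        simp [this]
      · have := hxi i
        rw [hv i hij hi, zero_mul, add_zero] at this
        rw [mul_assoc, this, mul_neg_one]
  have h2 : ∀ i, ((b * v * x' : ℤ) : ZMod (q i)) = if i = j then -(b : ZMod (q i)) else 0 := fun i => by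
    push_cast
    split_ifs with hij
    · subst hij
      have := hxi i
      rw [ZMod.natCast_self, zero_mul, zero_add] at this
      rw [mul_assoc, this, mul_neg_one]
    · by_cases hi : y i = 0
      · have : (b : ZMod (q i)) = 0 := by simpa [hi] using h i
        simp [this]
      · simp [hv i hij hi]
  have hunit : ∀ {i} (c : ZMod (q i)), c = 0 ∨ IsUnit c → -c = 0 ∨ IsUnit (-c) := fun c hc =>
    hc.imp neg_eq_zero.2 IsUnit.neg
  obtain ⟨z₁, hz₁⟩ := exists_isRep_of_forall hq (a := b * q j * x) fun i => by
    rw [h1]; split_ifs with hij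
    · exact Or.inl rfl
    · exact hunit _ (hb i)
  obtain ⟨z₂, hz₂⟩ := exists_isRep_of_forall hq (a := b * v * x') fun i => by
    rw [h2]; split_ifs with hij
    · exact hunit _ (hb i)
    · exact Or.inl rfl
  have hby : ∀ i, (b : ZMod (q i)) = 0 ↔ y i = 0 := fun i => by
    rw [← h.dvd_iff hq i, ← ZMod.intCast_zmod_eq_zero_iff_dvd, Int.cast_natCast]
  have hz₁0 : ∀ i, z₁ i = 0 ↔ i = j ∨ y i = 0 := fun i => by
    rw [← hz₁.dvd_iff hq i, ← ZMod.intCast_zmod_eq_zero_iff_dvd, h1]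
    split_ifs with hij
    · simp [hij]
    · simp [hij, hby]
  have hz₂0 : ∀ i, z₂ i = 0 ↔ i ≠ j ∨ y i = 0 := fun i => by
    rw [← hz₂.dvd_iff hq i, ← ZMod.intCast_zmod_eq_zero_iff_dvd, h2]
    split_ifs with hij
    · simp [hij, hby]
    · simp [hij]
  obtain ⟨i', hi', hij'⟩ := exists_mem_ne hc j
  have hs₁ : supp z₁ ⊂ supp y := by
    rw [ssubset_iff_of_subset fun i => by rw [mem_supp, mem_supp, Ne, hz₁0]; tauto]
    exact ⟨j, mem_supp.2 hjy, by rw [mem_supp, not_not, hz₁0]; exact Or.inl rfl⟩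
  have hs₂ : supp z₂ ⊂ supp y := by
    rw [ssubset_iff_of_subset fun i => by rw [mem_supp, mem_supp, Ne, hz₂0]; tauto]
    exact ⟨i', hi', by rw [mem_supp, not_not, hz₂0]; exact Or.inl hij'⟩
  have hnd : ∀ {z : ∀ i, WithZero (ZMod (q i))ˣ} {c : ℤ} (i : Fin t), IsRep q z c → z i ≠ 0 →
      ¬ (m : ℤ) ∣ c := fun i hz hi hc =>
    hi ((hz.dvd_iff hq i).1 ((Int.natCast_dvd_natCast.2 (hq.dvd i)).trans hc))
  refine ⟨z₁, z₂, hs₁, hs₂, ?_⟩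
  rw [hα, thetaAt_eq hq hz₁, thetaAt_eq hq hz₂, theta_eq_oddTheta_add m (hnd j h hjy),
    theta_eq_oddTheta_add m (hnd i' hz₁ (by
      rw [Ne, hz₁0]; exact fun h => h.elim hij' (mem_supp.1 hi'))),
    theta_eq_oddTheta_add m (hnd j hz₂ (by rw [Ne, hz₂0]; exact fun h => h.elim (· rfl) hjy))]
  module

/-- Everything follows from the elements `theta m a` with `a` divisible by all but one of the
`q i`, and from the elements `alpha m q a` that belong to the other members of `M`. -/
theorem theta_mem_of_forall (hq : IsOrderedFactorization m q)
    {W : AddSubgroup (MonoidAlgebra ℚ (GalCyc m))} (hN : (1 / 2 : ℚ) • normElt m ∈ W)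
    (hα : ∀ b ∈ M m q, (∀ i, ¬ m / q i ∣ b) → alpha m q b ∈ W)
    (hs : ∀ j, ∀ c : ℤ, theta m ((m / q j : ℕ) * c) ∈ W) (a : ℤ) : theta m a ∈ W := by
  have := hq.neZero
  have : IsAddTorsionFree (MonoidAlgebra ℚ (GalCyc m)) := .of_module_rat _
  have hodd : ∀ a, theta m a ∈ W ↔ oddTheta m a ∈ W := fun a => by
    rw [oddTheta]
    split_ifs
    · rw [sub_zero]
    · exact ⟨fun h => sub_mem h hN, fun h => by simpa using add_mem h hN⟩
  -- Points with at most one nonzero coordinate are covered by `hs`; for a reduced point with more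
  -- of them, `α_m(b)` has the value there as its leading term.
  have hpt : ∀ y, thetaAt hq y ∈ W := by
    refine (thetaDistribution hq).mem_of_isReduced W ?_ ?_
    · intro y hy
      obtain ⟨a, ha⟩ := hq.exists_isRep y
      change thetaAt hq y ∈ W
      rw [thetaAt_eq hq ha, ← hodd]
      by_cases h0 : supp y = ∅
      · have : (m : ℤ) ∣ a := (hq.dvd_iff a).2 fun i => (ha.dvd_iff hq i).2 (by
          by_contra h
          have := mem_supp.2 h
          simp [h0] at this)
        rw [theta_eq_zero_of_dvd m this]
        exact zero_mem W
      · obtain ⟨j, hj⟩ := card_eq_one.1 (le_antisymm hy (card_pos.2 (nonempty_iff_ne_empty.2 h0)))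
        have h1 : ((m / q j : ℕ) : ℤ) ∣ a := hq.div_dvd fun l hl => (ha.dvd_iff hq l).2 (by
          by_contra h
          have := mem_supp.2 h
          rw [hj, mem_singleton] at this
          exact hl this)
        obtain ⟨c, rfl⟩ := h1
        exact hs j c
    · intro y hc hy hlow
      obtain ⟨a, ha⟩ := hq.exists_isRep y
      obtain ⟨b, h0, hb, -, hbr⟩ := ha.exists_nat hq (card_pos.1 (by omega))
      obtain ⟨z₁, z₂, hz₁, hz₂, hαb⟩ := hbr.alpha_eq hq hc
      have h1 : alpha m q b ∈ W := by
        refine hα b ((hbr.mem_M_iff hq h0 hb).2 hy) fun i hi => ?_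
        obtain ⟨l, hl, hli⟩ := exists_mem_ne hc i
        exact mem_supp.1 hl ((hbr.dvd_iff hq l).1
          (Int.natCast_dvd_natCast.2 ((hq.dvd_div hli).trans hi)))
      change thetaAt hq y ∈ W
      rw [thetaAt_eq hq hbr]
      have h2 : oddTheta m b = alpha m q b - thetaAt hq z₁ - thetaAt hq z₂
          - (1 / 2 : ℚ) • normElt m := by rw [hαb]; abel
      rw [h2]
      exact sub_mem (sub_mem (sub_mem h1 (hlow z₁ hz₁)) (hlow z₂ hz₂)) hN
  suffices ∀ n : ℕ, ∀ a : ℤ, Int.gcd a m = n → oddTheta m a ∈ W from (hodd a).2 (this _ a rfl)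
  intro n
  induction n using Nat.strong_induction_on with
  | _ n ih =>
  intro a hn
  -- Either `a` represents a point, or some prime `p` divides both `a` and `m/(a,m)`. In the latter
  -- case the relation for `m = p * (m/p)` writes the element as a sum over arguments whose gcd with
  -- `m` is `(a,m)/p`.
  by_cases h : ∀ p : ℕ, p.Prime → (p : ℤ) ∣ a → ¬ p ∣ m / Int.gcd a m
  · obtain ⟨y, hy⟩ := exists_isRep_of_coprime hq h
    rw [← thetaAt_eq hq hy]
    exact hpt y
  · push Not at h
    obtain ⟨p, hp, hpa, hpm⟩ := h
    have hm0 : (m : ℤ) ≠ 0 := by exact_mod_cast NeZero.ne m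
    have hg0 : 0 < Int.gcd a m := Int.gcd_pos_of_ne_zero_right _ hm0
    obtain ⟨m₁, hm₁⟩ : ∃ m₁, m = Int.gcd a m * m₁ := by
      exact_mod_cast Int.gcd_dvd_right a m
    rw [Nat.div_eq_of_eq_mul_right hg0 hm₁] at hpm
    obtain ⟨a₁, ha₁⟩ := Int.gcd_dvd_left a m
    have hpg : p ∣ Int.gcd a m := by
      refine Int.natCast_dvd_natCast.1 (Int.dvd_coe_gcd hpa ?_)
      rw [hm₁]
      exact Int.natCast_dvd_natCast.2 (hpm.mul_left _)
    obtain ⟨d, hd⟩ := hpg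
    have hd0 : 0 < d := Nat.pos_of_ne_zero fun h => hg0.ne' (by rw [hd, h, mul_zero])
    have hcop : IsCoprime a₁ (m₁ : ℤ) := by
      have h1 := Int.gcd_mul_left (Int.gcd a m) a₁ m₁
      rw [Int.isCoprime_iff_gcd_eq_one]
      have h2 : (Int.gcd a m : ℤ) * m₁ = m := by exact_mod_cast hm₁.symm
      rw [← ha₁, h2, Int.natAbs_natCast] at h1
      exact Nat.eq_of_mul_eq_mul_left hg0 (by rw [mul_one]; exact h1.symm)
    have hmp : m = p * (d * m₁) := by rw [← mul_assoc, ← hd, ← hm₁]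
    have hap : a = p * (d * a₁) := by
      rw [← mul_assoc]
      have : (Int.gcd a m : ℤ) = p * d := by exact_mod_cast hd
      rw [← this, ← ha₁]
    rw [hap, ← sum_oddTheta_add m hmp]
    refine sum_mem fun j _ => ih d ?_ _ ?_
    · rw [← hn, hd]
      exact lt_mul_of_one_lt_left hd0 hp.one_lt
    · have h1 : (d : ℤ) * a₁ + j * (d * m₁ : ℕ) = d * (a₁ + j * m₁) := by push_cast; ring
      have h2 : (m : ℤ) = d * (p * m₁) := by rw [hmp]; push_cast; ring
      have h3 : IsCoprime (a₁ + j * m₁) (m₁ : ℤ) := by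
        rw [mul_comm]; exact hcop.add_mul_left_left j
      have h4 : IsCoprime (a₁ + j * m₁) ((p : ℤ) * m₁) :=
        (h3.of_isCoprime_of_dvd_right (Int.natCast_dvd_natCast.2 hpm)).mul_right h3
      rw [h1, h2, Int.gcd_mul_left, Int.isCoprime_iff_gcd_eq_one.1 h4]
      simp

end Generation

end

end ShortStickelberger

/-! ### Multiples of `m / q_j`: the prime power case -/

namespace ShortStickelberger

noncomputable section

open Finset Function

section PrimePower

variable {m : ℕ} [NeZero m] {U : AddSubgroup (MonoidAlgebra ℚ (GalCyc m))}

theorem normElt_eq_add (m : ℕ) [NeZero m] :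
    normElt m = (1 / 2 : ℚ) • normElt m + (1 / 2 : ℚ) • normElt m := by
  rw [← add_smul]; norm_num

theorem theta_neg_mem (hN : (1 / 2 : ℚ) • normElt m ∈ U) {a : ℤ} (h : theta m a ∈ U) :
    theta m (-a) ∈ U := by
  by_cases ha : (m : ℤ) ∣ a
  · rw [theta_eq_zero_of_dvd m (by rwa [dvd_neg])]; exact zero_mem U
  · rw [theta_neg m ha, normElt_eq_add m]
    exact sub_mem (add_mem hN hN) h

/-- The bound in `hs` says `c ≤ φ(p ^ k) / 2`. Periodicity and the reflection `c ↦ -c` reduce to `0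
≤ c ≤ p ^ k / 2`; the remaining top range is handled by the distribution relation for `p`, by
induction on how far `c` is from divisibility by `p ^ k`. -/
theorem theta_mul_mem {p k c₀ : ℕ} (hp : p.Prime) (hk : 0 < k) (hm : m = p ^ k * c₀)
    (hN : (1 / 2 : ℚ) • normElt m ∈ U)
    (hs : ∀ c : ℕ, 0 < c → 2 * c + p ^ (k - 1) ≤ p ^ k → theta m (c₀ * c) ∈ U) (c : ℤ) :
    theta m (c₀ * c) ∈ U := by
  have hpk : p ^ k = p * p ^ (k - 1) := by rw [← pow_succ', Nat.sub_add_cancel hk]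
  have hmz : (m : ℤ) = c₀ * (p ^ k : ℕ) := by rw [hm]; push_cast; ring
  have hnat : ∀ c : ℤ, theta m (c₀ * (c.natAbs : ℤ)) ∈ U → theta m (c₀ * c) ∈ U := by
    intro c hc
    rcases Int.natAbs_eq c with h | h
    · rw [h]; exact hc
    · rw [h, mul_neg]; exact theta_neg_mem hN hc
  have hsmall : ∀ c : ℤ, 2 * (c.natAbs : ℤ) + (p ^ (k - 1) : ℕ) ≤ (p ^ k : ℕ) →
      theta m (c₀ * c) ∈ U := by
    intro c hc
    apply hnat
    rcases Nat.eq_zero_or_pos c.natAbs with h | h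
    · rw [h, Nat.cast_zero, mul_zero, theta_eq_zero_of_dvd m (dvd_zero _)]; exact zero_mem U
    · exact hs _ h (by exact_mod_cast hc)
  have hconst : ((p - 1) / 2 : ℚ) • normElt m ∈ U := by
    have : ((p - 1) / 2 : ℚ) • normElt m = (p - 1) • (1 / 2 : ℚ) • normElt m := by
      rw [← Nat.cast_smul_eq_nsmul ℚ, smul_smul, Nat.cast_sub hp.one_le]
      congr 1
      push_cast
      ring
    rw [this]
    exact nsmul_mem hN _
  suffices ∀ n ≤ k, ∀ c : ℤ, ((p ^ (k - n) : ℕ) : ℤ) ∣ c → theta m (c₀ * c) ∈ U from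
    this k le_rfl c (by simp)
  intro n
  induction n with
  | zero =>
    intro _ c hc
    rw [theta_eq_zero_of_dvd m (by rw [hmz]; exact mul_dvd_mul_left _ hc)]
    exact zero_mem U
  | succ n ih =>
    intro hn c hc
    have hbm : c.bmod (p ^ k) ≡ c [ZMOD (p ^ k : ℕ)] := Int.bmod_emod
    have hred : theta m (c₀ * c) = theta m (c₀ * c.bmod (p ^ k)) :=
      (theta_congr m (by rw [hmz]; exact hbm.mul_left')).symm
    have hdvd : ((p ^ (k - (n + 1)) : ℕ) : ℤ) ∣ c.bmod (p ^ k) := by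
      obtain ⟨e, he⟩ := hbm.symm.dvd
      have h1 : c.bmod (p ^ k) = c + (p ^ k : ℕ) * e := by linarith
      rw [h1]
      exact dvd_add hc (Dvd.dvd.mul_right
        (Int.natCast_dvd_natCast.2 (pow_dvd_pow p (Nat.sub_le _ _))) e)
    rw [hred]
    apply hnat
    set d := (c.bmod (p ^ k)).natAbs with hd
    have hd2 : 2 * d ≤ p ^ k := by
      have hpos : 0 < p ^ k := pow_pos hp.pos k
      have h1 := Int.le_bmod (x := c) hpos
      have h2 := Int.bmod_le (x := c) hpos
      omega
    by_cases hle : 2 * d + p ^ (k - 1) ≤ p ^ k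
    · have hle' : (2 * d + (p ^ (k - 1) : ℕ) : ℤ) ≤ (p ^ k : ℕ) := by exact_mod_cast hle
      exact hsmall d (by simpa using hle')
    · have hr : m = p * (p ^ (k - 1) * c₀) := by rw [hm, hpk, mul_assoc]
      -- The progression is placed so that its last term is `d`. Its other terms `d - i * p ^ (k -
      -- 1)`, `1 ≤ i ≤ p - 1`, are small enough in absolute value for `hsmall`, and its sum involves
      -- `p * d`, divisible by a higher power of `p`.
      have hsum := sum_theta_add m hr (c₀ * (d - (p - 1 : ℕ) * (p ^ (k - 1) : ℕ)))
      obtain ⟨p', rfl⟩ : ∃ p', p = p' + 1 := ⟨p - 1, (Nat.sub_add_cancel hp.one_le).symm⟩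
      rw [sum_range_succ] at hsum
      have hlast : (c₀ : ℤ) * (d - (p' + 1 - 1 : ℕ) * ((p' + 1) ^ (k - 1) : ℕ))
          + p' * ((p' + 1) ^ (k - 1) * c₀ : ℕ) = c₀ * d := by
        rw [Nat.add_sub_cancel]; push_cast; ring
      have hmul : theta m ((p' + 1 : ℕ) * (c₀ * (d - (p' + 1 - 1 : ℕ) * ((p' + 1) ^ (k - 1) : ℕ))))
          = theta m (c₀ * ((p' + 1 : ℕ) * d)) := by
        refine theta_congr m ?_
        rw [Int.modEq_iff_dvd]
        refine ⟨p', ?_⟩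
        rw [hr, Nat.add_sub_cancel]
        push_cast
        ring
      rw [hlast, hmul, ← eq_sub_iff_add_eq'] at hsum
      rw [hsum]
      refine sub_mem (add_mem (ih (by omega) _ ?_) hconst) (sum_mem fun j hj => ?_)
      · have h1 : k - n = k - (n + 1) + 1 := by omega
        rw [h1, pow_succ', Nat.cast_mul]
        refine mul_dvd_mul_left _ ?_
        exact Int.natCast_dvd_natCast.2 (Int.natCast_dvd.1 hdvd)
      · rw [mem_range] at hj
        have harg : (c₀ : ℤ) * (d - (p' + 1 - 1 : ℕ) * ((p' + 1) ^ (k - 1) : ℕ))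
          + j * ((p' + 1) ^ (k - 1) * c₀ : ℕ)
          = c₀ * (d - (p' - j : ℕ) * ((p' + 1) ^ (k - 1) : ℕ)) := by
          rw [Nat.add_sub_cancel, Nat.cast_sub hj.le]; push_cast; ring
        rw [harg]
        apply hsmall
        set r := (p' + 1) ^ (k - 1) with hrdef
        have h1 : 1 * r ≤ (p' - j) * r := Nat.mul_le_mul_right _ (by omega)
        have h2 : (p' - j) * r ≤ p' * r := Nat.mul_le_mul_right _ (by omega)
        have h3 : (p' + 1) ^ k = p' * r + r := by rw [hpk]; ring
        have h4 : (((p' - j : ℕ) : ℤ) * (r : ℤ)) = (((p' - j) * r : ℕ) : ℤ) := by push_cast; rfl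
        rw [h4]
        omega

end PrimePower

section Singles

variable {t m : ℕ} [NeZero m] {q : Fin t → ℕ}

omit [NeZero m] in
theorem J'_div_mul (hq : IsOrderedFactorization m q) (j : Fin t) {c : ℕ} (h0 : 0 < c)
    (h : c < q j) : J' q (m / q j * c) = {j} := by
  ext i
  simp only [J', mem_filter, mem_univ, true_and, mem_singleton]
  constructor
  · intro hi
    by_contra hij
    exact hi ((hq.dvd_div hij).mul_right c)
  · rintro rfl hi
    have hcop : (q i).Coprime (m / q i) := by
      rw [hq.div_eq_prod]
      exact Nat.Coprime.prod_right fun l hl => hq.coprime (mem_erase.1 hl).1.symm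
    exact (Nat.le_of_dvd h0 (hcop.dvd_of_dvd_mul_left hi)).not_gt h

theorem alpha_div_mul (hq : IsOrderedFactorization m q) (j : Fin t) {c : ℕ} (h1 : 1 < c)
    (h : c < q j) : alpha m q (m / q j * c) = theta m (-(m / q j * c : ℕ))
      + theta m ((m / q j * c : ℕ) - (m / q j : ℕ)) + theta m (m / q j : ℕ) - normElt m := by
  have hJ := J'_div_mul hq j (by omega) h
  have hne : (J' q (m / q j * c)).Nonempty := by rw [hJ]; exact singleton_nonempty j
  have hmin : (J' q (m / q j * c)).min' hne = j :=
    mem_singleton.1 ((Finset.ext_iff.1 hJ _).1 (min'_mem _ hne))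
  have hcard : ¬ 1 < #(J' q (m / q j * c)) := by rw [hJ, card_singleton]; omega
  have hm0 : 0 < m / q j := Nat.div_pos (Nat.le_of_dvd (NeZero.pos m) (hq.dvd j)) (by omega)
  have hb : m / q j * c ≠ m / q j := by
    intro h2
    have := Nat.eq_of_mul_eq_mul_left hm0 (h2.trans (mul_one _).symm)
    omega
  simp only [alpha, dif_pos hne, hmin, if_neg hcard, if_neg hb]

theorem alpha_div (hq : IsOrderedFactorization m q) (j : Fin t) :
    alpha m q (m / q j) = (2 : ℚ) • theta m (m / q j * ((q j).totient / 2) : ℕ)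
      + theta m (m / (q j).minFac : ℕ) - normElt m := by
  have hJ := J'_div_mul hq j one_pos ((Nat.lt_succ_self 1).trans (hq.two_lt j))
  rw [mul_one] at hJ
  have hne : (J' q (m / q j)).Nonempty := by rw [hJ]; exact singleton_nonempty j
  have hmin : (J' q (m / q j)).min' hne = j :=
    mem_singleton.1 ((Finset.ext_iff.1 hJ _).1 (min'_mem _ hne))
  have hcard : ¬ 1 < #(J' q (m / q j)) := by rw [hJ, card_singleton]; omega
  simp only [alpha, dif_pos hne, hmin, if_neg hcard, if_true]

end Singles

end

end ShortStickelberger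

/-! ### `S''_m` as the kernel of `kappa` on `S'_m`, and the index -/

namespace ShortStickelberger

noncomputable section

open Finset Function

section Index

variable {t m : ℕ} [NeZero m] {q : Fin t → ℕ}

/-- Twice the coefficient at the identity, modulo the integers. -/
def kappa (m : ℕ) [NeZero m] : MonoidAlgebra ℚ (GalCyc m) →+ AddCircle (1 : ℚ) where
  toFun x := ((2 * coeffEquiv m x 1 : ℚ) : AddCircle (1 : ℚ))
  map_zero' := by simp
  map_add' x y := by rw [map_add, Pi.add_apply, mul_add, AddCircle.coe_add]

theorem kappa_apply (x : MonoidAlgebra ℚ (GalCyc m)) :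
    kappa m x = ((2 * coeffEquiv m x 1 : ℚ) : AddCircle (1 : ℚ)) := rfl

theorem addCircle_coe_eq_zero_iff (x : ℚ) : (x : AddCircle (1 : ℚ)) = 0 ↔ ∃ n : ℤ, (n : ℚ) = x := by
  rw [AddCircle.coe_eq_zero_iff]
  simp

theorem kappa_theta (hm : 1 < m) (a : ℤ) :
    kappa m (theta m a) = a • ((-(2 / m) : ℚ) : AddCircle (1 : ℚ)) := by
  have : Fact (1 < m) := ⟨hm⟩
  rw [kappa_apply, coeffEquiv_theta, thetaFun, Units.val_one, ZMod.val_one, ← AddCircle.coe_zsmul,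
    ← sub_eq_zero, ← AddCircle.coe_sub, addCircle_coe_eq_zero_iff]
  refine ⟨-2 * ⌊-((a : ℚ) * (1 : ℕ) / m)⌋, ?_⟩
  rw [Int.fract, zsmul_eq_mul]
  push_cast
  ring

theorem kappa_half_normElt : kappa m ((1 / 2 : ℚ) • normElt m) = 0 := by
  rw [kappa_apply, map_smul, coeffEquiv_normElt, addCircle_coe_eq_zero_iff]
  exact ⟨1, by simp⟩

theorem kappa_normElt : kappa m (normElt m) = 0 := by
  rw [normElt_eq_add, map_add, kappa_half_normElt, add_zero]

theorem normElt_mem_thetaGroup (m : ℕ) [NeZero m] : normElt m ∈ thetaGroup m := by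
  rw [normElt_eq_add]
  exact add_mem (half_normElt_mem_thetaGroup m) (half_normElt_mem_thetaGroup m)

theorem alpha_mem_thetaGroup (b : ℕ) : alpha m q b ∈ thetaGroup m := by
  have hθ := theta_mem_thetaGroup m
  have hN := normElt_mem_thetaGroup m
  unfold alpha
  dsimp only
  split_ifs
  · exact sub_mem (add_mem (add_mem (hθ _) (hθ _)) (hθ _)) hN
  · rw [two_smul]
    exact sub_mem (add_mem (add_mem (hθ _) (hθ _)) (hθ _)) hN
  · exact sub_mem (add_mem (add_mem (hθ _) (hθ _)) (hθ _)) hN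
  · exact zero_mem _

theorem SDoublePrime_le_thetaGroup : SDoublePrime m q ≤ thetaGroup m := by
  refine (AddSubgroup.closure_le _).2 ?_
  rintro _ (⟨b, _, rfl⟩ | rfl)
  · exact alpha_mem_thetaGroup b
  · exact half_normElt_mem_thetaGroup m

theorem half_normElt_mem_SDoublePrime : (1 / 2 : ℚ) • normElt m ∈ SDoublePrime m q :=
  AddSubgroup.subset_closure (Or.inr rfl)

theorem normElt_mem_SDoublePrime : normElt m ∈ SDoublePrime m q := by
  rw [normElt_eq_add]
  exact add_mem half_normElt_mem_SDoublePrime half_normElt_mem_SDoublePrime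

theorem alpha_mem_SDoublePrime {b : ℕ} (hb : b ∈ M' m q) : alpha m q b ∈ SDoublePrime m q :=
  AddSubgroup.subset_closure (Or.inl ⟨b, hb, rfl⟩)

omit [NeZero m] in
/-- A number `b` in `M` not divisible by any `m / q i` is not divisible by two of the `q i`. -/
theorem one_lt_card_J' (hq : IsOrderedFactorization m q) {b : ℕ} (hb : b ∈ X m)
    (hd : ∀ i, ¬ m / q i ∣ b) : 1 < #(J' q b) := by
  obtain ⟨j, hj⟩ : ∃ j, ¬ (q j : ℤ) ∣ b := by
    by_contra! h
    exact (Nat.le_of_dvd hb.1 (Int.natCast_dvd_natCast.1 ((hq.dvd_iff b).2 h))).not_gt hb.2.1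
  have hjJ : j ∈ J' q b := mem_filter.2 ⟨mem_univ j, fun h => hj (Int.natCast_dvd_natCast.2 h)⟩
  by_contra hc
  refine hd j (Int.natCast_dvd_natCast.1 (hq.div_dvd fun l hl => ?_))
  by_contra h
  have hlJ : l ∈ J' q b := mem_filter.2 ⟨mem_univ l, fun h' => h (Int.natCast_dvd_natCast.2 h')⟩
  exact hc (one_lt_card.2 ⟨l, hlJ, j, hjJ, hl⟩)

theorem totient_add_pow {p k n : ℕ} (hp : p.Prime) (hk : 0 < k) (h : p ^ k = n) :
    n.totient + p ^ (k - 1) = n := by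
  rw [← h, Nat.totient_prime_pow hp hk, ← Nat.mul_succ, Nat.succ_eq_add_one,
    Nat.sub_add_cancel hp.one_le, ← pow_succ, Nat.sub_add_cancel hk]

/-- As `kappa` is linear in the argument of `θ`, it suffices to add up the arguments in `α`: the
total is 0, or `m` in the exceptional case `b = m / q j`, because `φ(q) + q / p = q`. -/
theorem kappa_alpha (hm : 1 < m) (hq : IsOrderedFactorization m q) {b : ℕ} (hb : b ∈ M' m q) :
    kappa m (alpha m q b) = 0 := by
  rcases hb with ⟨hbM, hbd⟩ | hb
  · obtain ⟨j, -, v, x, y, -, hxy, hα⟩ := exists_alpha_eq hq (one_lt_card_J' hq hbM.1 hbd)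
    rw [hα, map_sub, map_add, map_add, kappa_normElt, sub_zero, kappa_theta hm, kappa_theta hm,
      kappa_theta hm, ← add_smul, ← add_smul]
    have : (b : ℤ) + b * q j * x + b * v * y = 0 := by linear_combination (b : ℤ) * hxy
    rw [this, zero_smul]
  · obtain ⟨j, c, h1, h2, rfl⟩ := Set.mem_iUnion.1 hb
    have hlt : c < q j := by
      have := Nat.totient_lt (q j) ((Nat.lt_succ_self 1).trans (hq.two_lt j))
      omega
    rcases h1.eq_or_lt with rfl | h1
    · rw [mul_one, alpha_div hq, map_sub, map_add, kappa_normElt, sub_zero, two_smul, map_add,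
        kappa_theta hm, kappa_theta hm, ← add_smul, ← add_smul]
      obtain ⟨p, k, hp, hk, hpk⟩ := (isPrimePow_nat_iff _).1 (hq.isPrimePow j)
      have hmin : (q j).minFac = p := minFac_eq_of_pow_eq hp hk.ne' hpk
      have htot := totient_add_pow hp hk hpk
      have heven : (q j).totient = 2 * ((q j).totient / 2) :=
        (Nat.mul_div_cancel' (Nat.totient_even (hq.two_lt j)).two_dvd).symm
      have hdiv : m / (q j).minFac = m / q j * p ^ (k - 1) := by
        rw [hmin]
        refine Nat.div_eq_of_eq_mul_left hp.pos ?_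
        rw [mul_assoc, ← pow_succ, Nat.sub_add_cancel hk, hpk, Nat.div_mul_cancel (hq.dvd j)]
      have : ((m / q j * ((q j).totient / 2) : ℕ) : ℤ) + (m / q j * ((q j).totient / 2) : ℕ)
          + (m / (q j).minFac : ℕ) = m := by
        rw [hdiv]
        norm_cast
        rw [← mul_add, ← mul_add, ← two_mul, ← heven, htot, Nat.div_mul_cancel (hq.dvd j)]
      rw [this, ← AddCircle.coe_zsmul, addCircle_coe_eq_zero_iff]
      refine ⟨-2, ?_⟩
      have h2 : (m : ℚ) ≠ 0 := by exact_mod_cast NeZero.ne m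
      rw [zsmul_eq_mul]
      push_cast
      field_simp
    · rw [alpha_div_mul hq j h1 hlt, map_sub, map_add, map_add, kappa_normElt, sub_zero,
        kappa_theta hm, kappa_theta hm, kappa_theta hm, ← add_smul, ← add_smul]
      rw [show (-((m / q j * c : ℕ) : ℤ) + ((m / q j * c : ℕ) - (m / q j : ℕ)) + (m / q j : ℕ)) = 0
        by ring, zero_smul]

theorem SDoublePrime_le_ker (hm : 1 < m) (hq : IsOrderedFactorization m q) :
    SDoublePrime m q ≤ (kappa m).ker := by
  refine (AddSubgroup.closure_le _).2 ?_
  rintro _ (⟨b, hb, rfl⟩ | rfl)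
  · exact kappa_alpha hm hq hb
  · exact kappa_half_normElt

omit [NeZero m] in
theorem div_mul_mem_M' {j : Fin t} {c : ℕ} (h1 : 1 ≤ c) (h2 : c ≤ (q j).totient / 2) :
    m / q j * c ∈ M' m q :=
  Or.inr (Set.mem_iUnion.2 ⟨j, c, h1, h2, rfl⟩)

omit [NeZero m] in
theorem not_dvd_div_mul (hq : IsOrderedFactorization m q) (j : Fin t) {c : ℕ} (h0 : 0 < c)
    (h : c < q j) : ¬ (m : ℤ) ∣ (m / q j * c : ℕ) := by
  rw [Int.natCast_dvd_natCast]
  intro hd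
  have : j ∈ J' q (m / q j * c) := by rw [J'_div_mul hq j h0 h]; exact mem_singleton_self j
  exact (mem_filter.1 this).2 ((hq.dvd j).trans hd)

/-- For `c > 1` the element `α_m(c m/q_j)` is `-θ(c m/q_j) + θ((c-1) m/q_j) + θ(m/q_j)`, so modulo
`S''` the θ's grow linearly in `c`. -/
theorem theta_sub_nsmul_mem (hq : IsOrderedFactorization m q) (j : Fin t) :
    ∀ c ≤ (q j).totient / 2,
      theta m (m / q j * c : ℕ) - c • theta m (m / q j : ℕ) ∈ SDoublePrime m q := by
  intro c
  induction c with
  | zero =>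
    intro _
    rw [mul_zero, Nat.cast_zero, theta_eq_zero_of_dvd m (dvd_zero _), zero_smul, sub_zero]
    exact zero_mem _
  | succ c ih =>
    intro hc
    rcases Nat.eq_zero_or_pos c with rfl | h0
    · simp
    · have hlt : c + 1 < q j := by
        have := Nat.totient_lt (q j) ((Nat.lt_succ_self 1).trans (hq.two_lt j))
        omega
      have hα := alpha_div_mul hq j (by omega : 1 < c + 1) hlt
      rw [theta_neg m (not_dvd_div_mul hq j (by omega) hlt),
        show ((m / q j * (c + 1) : ℕ) : ℤ) - (m / q j : ℕ) = (m / q j * c : ℕ) by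
          push_cast; ring] at hα
      have : theta m (m / q j * (c + 1) : ℕ) - (c + 1) • theta m (m / q j : ℕ)
          = (theta m (m / q j * c : ℕ) - c • theta m (m / q j : ℕ))
            - alpha m q (m / q j * (c + 1)) := by
        rw [hα, succ_nsmul]; abel
      rw [this]
      exact sub_mem (ih (by omega)) (alpha_mem_SDoublePrime (div_mul_mem_M' (by omega) hc))

/-- Modulo `S''` linearity turns `α_m(m/q_j)` into `(φ(q) + q/p) θ(m/q_j) = q θ(m/q_j)` if `p` is
odd, where `q/p ≤ φ(q)/2`. For `p = 2` the term `θ(m/2)` is `½ N_m` and only `φ(q) = q/2` remains.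
-/
theorem nsmul_theta_mem (hq : IsOrderedFactorization m q) (j : Fin t) :
    (if Even (q j) then q j / 2 else q j) • theta m (m / q j : ℕ) ∈ SDoublePrime m q := by
  obtain ⟨p, k, hp, hk, hpk⟩ := (isPrimePow_nat_iff _).1 (hq.isPrimePow j)
  have h2 := hq.two_lt j
  have hmin : (q j).minFac = p := minFac_eq_of_pow_eq hp hk.ne' hpk
  have htot := totient_add_pow hp hk hpk
  have heven : (q j).totient = 2 * ((q j).totient / 2) :=
    (Nat.mul_div_cancel' (Nat.totient_even (hq.two_lt j)).two_dvd).symm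
  have hpos : 0 < (q j).totient := Nat.totient_pos.2 (by omega)
  have hqp : q j = p * p ^ (k - 1) := by rw [← hpk, ← pow_succ', Nat.sub_add_cancel hk]
  have hdiv : m / (q j).minFac = m / q j * p ^ (k - 1) := by
    rw [hmin]
    refine Nat.div_eq_of_eq_mul_left hp.pos ?_
    rw [mul_assoc, ← pow_succ, Nat.sub_add_cancel hk, hpk, Nat.div_mul_cancel (hq.dvd j)]
  have hα := alpha_mem_SDoublePrime 
    (div_mul_mem_M' (m := m) (q := q) (j := j) le_rfl (by omega))
  rw [mul_one, alpha_div hq, hdiv, two_smul] at hα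
  have h3 := add_mem hα (normElt_mem_SDoublePrime (m := m) (q := q))
  rw [sub_add_cancel] at h3
  have h4 := theta_sub_nsmul_mem hq j _ (le_refl ((q j).totient / 2))
  rcases hp.eq_two_or_odd' with rfl | hodd
  · rw [if_pos (hqp ▸ even_two_mul _)]
    -- Since `-m/2 ≡ m/2` modulo `m`, the reflection formula makes this element equal to its own
    -- complement in `N_m`.
    have h5 : theta m (m / q j * 2 ^ (k - 1) : ℕ) = (1 / 2 : ℚ) • normElt m := by
      have h6 := theta_neg m (not_dvd_div_mul hq j (pow_pos two_pos (k - 1))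
        (by have := pow_pos two_pos (k - 1) (a := 2); omega))
      rw [theta_congr m (b := (m / q j * 2 ^ (k - 1) : ℕ)) (by
        rw [Int.modEq_iff_dvd]
        refine ⟨1, ?_⟩
        rw [sub_neg_eq_add, ← Nat.cast_add, ← mul_add, ← two_mul, ← hqp,
          Nat.div_mul_cancel (hq.dvd j), mul_one])] at h6
      rw [eq_sub_iff_add_eq, ← two_smul ℚ] at h6
      rw [← h6, smul_smul]
      norm_num
    rw [h5] at h3
    have h6 := sub_mem (sub_mem (sub_mem h3 half_normElt_mem_SDoublePrime) h4) h4
    have h7 : q j / 2 = (q j).totient / 2 + (q j).totient / 2 := by omega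
    rw [h7, add_smul]
    convert h6 using 1
    abel
  · have hp3 : 3 ≤ p := by
      rcases hodd with ⟨r, hr⟩
      have := hp.two_le
      omega
    have hqodd : ¬ Even (q j) := by
      rw [Nat.not_even_iff_odd, ← hpk]
      exact hodd.pow
    rw [if_neg hqodd]
    have h5 : p ^ (k - 1) ≤ (q j).totient / 2 := by
      have : 3 * p ^ (k - 1) ≤ p * p ^ (k - 1) := Nat.mul_le_mul_right _ hp3
      omega
    have h6 := sub_mem (sub_mem (sub_mem h3 h4) h4) (theta_sub_nsmul_mem hq j _ h5)
    have h7 : q j = (q j).totient / 2 + (q j).totient / 2 + p ^ (k - 1) := by omega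
    convert h6 using 1
    conv_lhs => rw [h7, add_smul, add_smul]
    rw [← h7]
    abel

/-- The group on the right contains `θ(c m/q_j)` for `c ≤ φ(q_j)/2`, hence for all `c` by
`theta_mul_mem`, hence all `θ_m(a)` by `theta_mem_of_forall`. -/
theorem exists_eq_add_sum (hq : IsOrderedFactorization m q) {x : MonoidAlgebra ℚ (GalCyc m)}
    (hx : x ∈ thetaGroup m) : ∃ s ∈ SDoublePrime m q, ∃ n : Fin t → ℤ,
      s + ∑ j, n j • theta m (m / q j : ℕ) = x := by
  set L := Fintype.linearCombination ℤ (fun j => theta m (m / q j : ℕ)) with hL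
  set T := SDoublePrime m q ⊔ (LinearMap.range L).toAddSubgroup with hT
  have hS : SDoublePrime m q ≤ T := le_sup_left
  have hf : ∀ j, theta m (m / q j : ℕ) ∈ T := fun j =>
    le_sup_right (a := SDoublePrime m q) ⟨Pi.single j 1, by
      simp [hL, Fintype.linearCombination_apply_single]⟩
  have hN : (1 / 2 : ℚ) • normElt m ∈ T := hS half_normElt_mem_SDoublePrime
  have hle : thetaGroup m ≤ T := by
    refine (AddSubgroup.closure_le _).2 ?_
    rintro _ (⟨a, rfl⟩ | rfl)
    · refine theta_mem_of_forall hq hN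
        (fun b hb hd => hS (alpha_mem_SDoublePrime (Or.inl ⟨hb, hd⟩))) (fun j => ?_) a
      obtain ⟨p, k, hp, hk, hpk⟩ := (isPrimePow_nat_iff _).1 (hq.isPrimePow j)
      refine theta_mul_mem hp hk (by rw [hpk, Nat.mul_div_cancel' (hq.dvd j)]) hN fun c h0 hc => ?_
      have htot := totient_add_pow hp hk hpk
      have h1 := add_mem (hS (theta_sub_nsmul_mem hq j c (by omega))) (nsmul_mem (hf j) c)
      rwa [sub_add_cancel, Nat.cast_mul] at h1
    · exact hN
  obtain ⟨s, hs, _, ⟨n, rfl⟩, hsn⟩ := AddSubgroup.mem_sup.1 (hle hx)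
  exact ⟨s, hs, n, by rw [← hsn, hL, Fintype.linearCombination_apply]⟩

/-- For an element of the kernel the coefficients `n j` of the `θ(m/q_j)` satisfy `m ∣ 2 Σ n j (m /
q j)`. Looking modulo `q j` isolates `n j`, and the resulting divisibility is the one
`nsmul_theta_mem` asks for. -/
theorem SDoublePrime_eq (hm : 1 < m) (hq : IsOrderedFactorization m q) :
    SDoublePrime m q = (kappa m).ker ⊓ thetaGroup m := by
  refine le_antisymm (le_inf (SDoublePrime_le_ker hm hq) SDoublePrime_le_thetaGroup) ?_
  rintro x ⟨hx, hxθ⟩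
  obtain ⟨s, hs, n, rfl⟩ := exists_eq_add_sum hq hxθ
  refine add_mem hs (sum_mem fun j _ => ?_)
  have h1 : kappa m (∑ j, n j • theta m (m / q j : ℕ)) = 0 := by
    have h2 : kappa m s = 0 := SDoublePrime_le_ker hm hq hs
    have h3 : kappa m (s + ∑ j, n j • theta m (m / q j : ℕ)) = 0 := hx
    rwa [map_add, h2, zero_add] at h3
  have hm0 : (m : ℚ) ≠ 0 := by exact_mod_cast NeZero.ne m
  simp only [map_sum, map_zsmul, kappa_theta hm, smul_smul] at h1
  rw [← sum_smul, ← AddCircle.coe_zsmul, addCircle_coe_eq_zero_iff] at h1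
  obtain ⟨z, hz⟩ := h1
  have h2 : (m : ℤ) ∣ 2 * ∑ l, n l * (m / q l : ℕ) := by
    refine ⟨-z, ?_⟩
    rw [zsmul_eq_mul] at hz
    field_simp at hz
    exact_mod_cast (by linarith : (2 : ℚ) * ((∑ l, n l * (m / q l : ℕ) : ℤ) : ℚ) = m * -z)
  have h3 : (q j : ℤ) ∣ 2 * (n j * (m / q j : ℕ)) := by
    have h4 := (Int.natCast_dvd_natCast.2 (hq.dvd j)).trans h2
    rw [← add_sum_erase _ _ (mem_univ j), mul_add] at h4
    refine (dvd_add_left (Dvd.dvd.mul_left (dvd_sum fun l hl => ?_) 2)).1 h4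
    exact Dvd.dvd.mul_left (Int.natCast_dvd_natCast.2 (hq.dvd_div (mem_erase.1 hl).1.symm)) _
  have h4 : IsCoprime (q j : ℤ) ((m / q j : ℕ) : ℤ) := by
    rw [hq.div_eq_prod, Nat.isCoprime_iff_coprime]
    exact Nat.Coprime.prod_right fun l hl => hq.coprime (mem_erase.1 hl).1.symm
  have h5 : (q j : ℤ) ∣ 2 * n j := h4.dvd_of_dvd_mul_right (by rwa [mul_assoc])
  have h6 : ((if Even (q j) then q j / 2 else q j : ℕ) : ℤ) ∣ n j := by
    split_ifs with he
    · obtain ⟨r, hr⟩ := he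
      rw [hr, ← two_mul, Nat.mul_div_cancel_left _ two_pos]
      rw [hr, ← two_mul, Nat.cast_mul, Nat.cast_two] at h5
      exact (mul_dvd_mul_iff_left two_ne_zero).1 h5
    · have h7 : IsCoprime (q j : ℤ) 2 := by
        exact_mod_cast Nat.isCoprime_iff_coprime.2
          (Nat.coprime_two_right.2 (Nat.not_even_iff_odd.1 he))
      exact h7.dvd_of_dvd_mul_left h5
  obtain ⟨c, hc⟩ := h6
  rw [hc, mul_comm, mul_smul, natCast_zsmul]
  exact zsmul_mem (nsmul_theta_mem hq j) c

theorem map_kappa_thetaGroup (hm : 1 < m) :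
    (thetaGroup m).map (kappa m)
      = AddSubgroup.zmultiples ((-(2 / m) : ℚ) : AddCircle (1 : ℚ)) := by
  refine le_antisymm ?_ ?_
  · rw [AddSubgroup.map_le_iff_le_comap]
    refine (AddSubgroup.closure_le _).2 ?_
    rintro _ (⟨a, rfl⟩ | rfl)
    · exact ⟨a, (kappa_theta hm a).symm⟩
    · rw [SetLike.mem_coe, AddSubgroup.mem_comap, kappa_half_normElt]
      exact zero_mem _
  · rw [AddSubgroup.zmultiples_le]
    exact ⟨theta m 1, theta_mem_thetaGroup m 1, by rw [kappa_theta hm, one_smul]⟩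

/-- The relative index of a kernel is the size of the image, here the order of `2/m` in `ℚ/ℤ`. -/
theorem relIndex_SDoublePrime (hm : 1 < m) (hq : IsOrderedFactorization m q) :
    (SDoublePrime m q).relIndex (SPrime m) = if Even m then m / 2 else m := by
  rw [SPrime_eq_thetaGroup, SDoublePrime_eq hm hq, AddSubgroup.inf_relIndex_right,
    AddSubgroup.relIndex_ker, map_kappa_thetaGroup hm, Nat.card_zmultiples, AddCircle.coe_neg,
    addOrderOf_neg]
  have h1 := AddCircle.gcd_mul_addOrderOf_div_eq (1 : ℚ) 2 (NeZero.pos m)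
  rw [mul_one, Nat.cast_two] at h1
  split_ifs with he
  · rw [Nat.gcd_eq_left he.two_dvd] at h1
    omega
  · rw [(Nat.coprime_two_left.2 (Nat.not_even_iff_odd.1 he)).gcd_eq_one, one_mul] at h1
    exact h1

end Index

end

end ShortStickelberger

/-! ### An upper bound for the number of elements of `M'_m` -/

namespace ShortStickelberger

noncomputable section

open Finset Function
open scoped Classical

section Counting

theorem card_lowUnits {n : ℕ} [NeZero n] (hn : 2 < n) :
    2 * #{g : (ZMod n)ˣ | g ∈ lowUnits n} = n.totient := by
  rw [← ZMod.card_units_eq_totient, ← card_univ,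
    ← card_filter_add_card_filter_not (s := univ) fun g : (ZMod n)ˣ => g ∈ lowUnits n, two_mul]
  congr 1
  refine card_nbij' (fun g => -1 * g) (fun g => -1 * g) ?_ ?_ ?_ ?_
  · intro g hg
    simp only [coe_filter, mem_univ, true_and, Set.mem_ofPred_eq] at hg ⊢
    rw [neg_mul_mem_lowUnits hn, not_not]
    exact hg
  · intro g hg
    simp only [coe_filter, mem_univ, true_and, Set.mem_ofPred_eq] at hg ⊢
    rwa [neg_mul_mem_lowUnits hn]
  · intro g _; simp
  · intro g _; simp

theorem neg_one_not_mem_lowUnits {n : ℕ} (hn : 2 < n) : (-1 : (ZMod n)ˣ) ∉ lowUnits n := by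
  have := (neg_mul_mem_lowUnits hn (-1)).1
  rw [neg_mul_neg, one_mul] at this
  exact this (one_mem_lowUnits hn)

variable {t m : ℕ} {q : Fin t → ℕ}

/-- The coordinates of `g` other than `1` and `-1`. -/
def middle (g : ∀ i, (ZMod (q i))ˣ) : Finset (Fin t) := {i | g i ≠ 1 ∧ g i ≠ -1}

/-- The coordinates of `g` other than `-1`. -/
def present (g : ∀ i, (ZMod (q i))ˣ) : Finset (Fin t) := {i | g i ≠ -1}

theorem mem_middle {g : ∀ i, (ZMod (q i))ˣ} {i : Fin t} :
    i ∈ middle g ↔ g i ≠ 1 ∧ g i ≠ -1 := by simp [middle]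

theorem mem_present {g : ∀ i, (ZMod (q i))ˣ} {i : Fin t} : i ∈ present g ↔ g i ≠ -1 := by
  simp [present]

/-- The last coordinate other than `1` and `-1` belongs to `lowUnits`; if there is no such
coordinate, then `1` occurs an odd number of times. -/
structure IsReducedCode (g : ∀ i, (ZMod (q i))ˣ) : Prop where
  mem_low : ∀ i ∈ middle g, (∀ l, i < l → l ∉ middle g) → g i ∈ lowUnits (q i)
  odd : middle g = ∅ → Odd #(present g)

/-- The coordinate that `flip` negates. -/
def pivot [NeZero t] (g : ∀ i, (ZMod (q i))ˣ) : Fin t :=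
  if h : (middle g).Nonempty then (middle g).max' h else 0

/-- Negates one coordinate, the last one other than `1` and `-1` if there is one. -/
def flip [NeZero t] (g : ∀ i, (ZMod (q i))ˣ) : ∀ i, (ZMod (q i))ˣ :=
  update g (pivot g) (-1 * g (pivot g))

theorem middle_flip [NeZero t] (g : ∀ i, (ZMod (q i))ˣ) : middle (flip g) = middle g := by
  ext i
  rw [mem_middle, mem_middle, flip]
  by_cases h : i = pivot g
  · subst h
    rw [update_self, neg_one_mul, Ne, Ne, neg_eq_iff_eq_neg, neg_inj]
    tauto
  · rw [update_of_ne h]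

theorem pivot_flip [NeZero t] (g : ∀ i, (ZMod (q i))ˣ) : pivot (flip g) = pivot g := by
  simp only [pivot, middle_flip]

theorem flip_flip [NeZero t] (g : ∀ i, (ZMod (q i))ˣ) : flip (flip g) = g := by
  conv_lhs => rw [flip, pivot_flip]
  rw [flip, update_self, update_idem, ← mul_assoc, neg_mul_neg, one_mul, one_mul, update_eq_self]

/-- Negating the last coordinate other than ±1 moves it out of `lowUnits`; if there is none,
negating any coordinate changes the parity of the number of coordinates 1. -/
theorem not_isReducedCode_flip [NeZero t] (hq : IsOrderedFactorization m q)
    {g : ∀ i, (ZMod (q i))ˣ} (hg : IsReducedCode g) : ¬ IsReducedCode (flip g) := by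
  intro hf
  by_cases h : (middle g).Nonempty
  · have hp : pivot g = (middle g).max' h := by rw [pivot, dif_pos h]
    have hmem : pivot g ∈ middle g := hp ▸ max'_mem _ h
    have hlast : ∀ l, pivot g < l → l ∉ middle g := fun l hl hlm =>
      (hp ▸ le_max' _ l hlm : l ≤ pivot g).not_gt hl
    have h1 := hg.mem_low _ hmem hlast
    have h2 := hf.mem_low (pivot g) (by rwa [middle_flip]) (by rwa [middle_flip])
    rw [flip, update_self, neg_mul_mem_lowUnits (hq.two_lt _)] at h2
    exact h2 h1
  · rw [not_nonempty_iff_eq_empty] at h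
    have h1 := hg.odd h
    have h2 := hf.odd (by rwa [middle_flip])
    have hne : (1 : (ZMod (q (pivot g)))ˣ) ≠ -1 := fun he =>
      neg_one_not_mem_lowUnits (hq.two_lt (pivot g)) (he ▸ one_mem_lowUnits (hq.two_lt (pivot g)))
    by_cases hp : g (pivot g) = -1
    · have : present (flip g) = insert (pivot g) (present g) := by
        ext i
        rw [mem_insert, mem_present, mem_present, flip]
        by_cases hi : i = pivot g
        · subst hi
          rw [update_self, hp, neg_mul_neg, one_mul]
          simp [hne]
        · rw [update_of_ne hi]; simp [hi]
      rw [this, card_insert_of_notMem (by simp [mem_present, hp])] at h2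
      exact (Nat.not_even_iff_odd.2 h2) h1.add_one
    · have hp1 : g (pivot g) = 1 := by
        by_contra h3
        have := mem_middle.2 ⟨h3, hp⟩
        simp [h] at this
      have : present g = insert (pivot g) (present (flip g)) := by
        ext i
        rw [mem_insert, mem_present, mem_present, flip]
        by_cases hi : i = pivot g
        · subst hi
          rw [update_self, hp1]
          simp [hne]
        · rw [update_of_ne hi]; simp [hi]
      rw [this, card_insert_of_notMem (by simp [mem_present, flip, hp1])] at h1
      exact (Nat.not_even_iff_odd.2 h1) h2.add_one

theorem totient_prod {ι : Type*} {S : Finset ι} {f : ι → ℕ}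
    (h : Pairwise fun i j => (f i).Coprime (f j)) :
    (∏ i ∈ S, f i).totient = ∏ i ∈ S, (f i).totient := by
  induction S using Finset.induction_on with
  | empty => simp
  | insert i S hi ih =>
    rw [prod_insert hi, prod_insert hi, Nat.totient_mul, ih]
    refine Nat.Coprime.prod_right fun l hl => h ?_
    rintro rfl
    exact hi hl

theorem two_mul_card_isReducedCode_le [∀ i, NeZero (q i)] [NeZero t]
    (hq : IsOrderedFactorization m q) :
    2 * #{g : ∀ i, (ZMod (q i))ˣ | IsReducedCode g} ≤ m.totient := by
  have hcard : Fintype.card (∀ i, (ZMod (q i))ˣ) = m.totient := by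
    rw [Fintype.card_pi]
    simp only [ZMod.card_units_eq_totient]
    rw [← hq.prod_eq, totient_prod hq.coprime]
  set R : Finset (∀ i, (ZMod (q i))ˣ) := {g | IsReducedCode g} with hR
  have h1 : #(R.image flip) = #R :=
    card_image_of_injective _ (LeftInverse.injective flip_flip)
  have h2 : Disjoint R (R.image flip) := by
    rw [disjoint_left]
    intro g hg hg'
    obtain ⟨g₁, hg₁, rfl⟩ := mem_image.1 hg'
    exact not_isReducedCode_flip hq (mem_filter.1 hg₁).2 (mem_filter.1 hg).2
  rw [← hcard, ← card_univ, two_mul]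
  nth_rewrite 2 [← h1]
  rw [← card_union_of_disjoint h2]
  exact card_le_card (subset_univ _)

/-- There are `φ(n)/2` low units; they serve as labels for the numbers `1 ≤ c ≤ φ(n)/2`. -/
theorem exists_surjOn_lowUnits {n : ℕ} [NeZero n] (hn : 2 < n) :
    ∃ f : (ZMod n)ˣ → ℕ, ∀ c, 1 ≤ c → c ≤ n.totient / 2 → ∃ g ∈ lowUnits n, f g = c := by
  have h := card_lowUnits hn
  have h1 : Fintype.card (Icc 1 (n.totient / 2))
      ≤ Fintype.card ({g : (ZMod n)ˣ | g ∈ lowUnits n} : Finset _) := by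
    rw [Fintype.card_coe, Fintype.card_coe, Nat.card_Icc]
    omega
  obtain ⟨e⟩ := Function.Embedding.nonempty_of_card_le h1
  refine ⟨extend (fun c => (e c : (ZMod n)ˣ)) (fun c => (c : ℕ)) 0, fun c h1 h2 => ?_⟩
  refine ⟨e ⟨c, mem_Icc.2 ⟨h1, h2⟩⟩, ?_, ?_⟩
  · exact (mem_filter.1 (e ⟨c, mem_Icc.2 ⟨h1, h2⟩⟩).2).2
  · exact Injective.extend_apply (Subtype.val_injective.comp e.injective) _ _ _

/-- The point whose coordinates are those of `g`, with `-1` replaced by zero. -/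
def codePoint (g : ∀ i, (ZMod (q i))ˣ) : ∀ i, WithZero (ZMod (q i))ˣ :=
  fun i => if g i = -1 then 0 else g i

/-- A reduced point never has a coordinate -1, so that value is free to encode zero. -/
theorem exists_code [NeZero m] [∀ i, NeZero (q i)] (hq : IsOrderedFactorization m q)
    {y : ∀ i, WithZero (ZMod (q i))ˣ} (hy : (thetaDistribution hq).IsReduced y) :
    ∃ g, IsReducedCode g ∧ codePoint g = y ∧ present g = supp y := by
  have key : ∀ i, ∃ u : (ZMod (q i))ˣ, (u = -1 ∧ y i = 0) ∨ (u ≠ -1 ∧ y i = u) := fun i => by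
    rcases eq_zero_or_eq_coe (y i) with h | ⟨u, hu⟩
    · exact ⟨-1, Or.inl ⟨rfl, h⟩⟩
    · refine ⟨u, Or.inr ⟨?_, hu⟩⟩
      rintro rfl
      exact hy.ne_neg i hu
  choose g hg using key
  have hpt : codePoint g = y := by
    funext i
    rcases hg i with h | h
    · rw [codePoint, if_pos h.1, h.2]
    · rw [codePoint, if_neg h.1, h.2]
  have hpres : present g = supp y := by
    ext i
    rw [mem_present, mem_supp]
    rcases hg i with h | h
    · simp [h.1, h.2]
    · rw [h.2]; simp [h.1]
  have h01 : ∀ i, i ∉ middle g → y i = 0 ∨ y i = 1 := fun i hi => by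
    rcases hg i with h | h
    · exact Or.inl h.2
    · right
      rw [h.2, ← WithZero.coe_one, WithZero.coe_inj]
      by_contra h1
      exact hi (mem_middle.2 ⟨h1, h.1⟩)
  refine ⟨g, ⟨fun i hi hl => ?_, fun h => ?_⟩, hpt, hpres⟩
  · have h1 := mem_middle.1 hi
    have h2 : y i = g i := ((hg i).resolve_left fun h => h1.2 h.1).2
    exact hy.mem_low i (g i) h2 h1.1 fun l hl' => h01 l (hl l hl')
  · rw [hpres]
    exact hy.odd fun i => h01 i (by simp [h])

theorem isReducedCode_update (hq : IsOrderedFactorization m q) (j : Fin t) {u : (ZMod (q j))ˣ}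
    (hu : u ∈ lowUnits (q j)) :
    IsReducedCode (update (fun _ => -1) j u) ∧
      present (update (fun _ => -1) j u : ∀ i, (ZMod (q i))ˣ) = {j} := by
  have hne : u ≠ -1 := by
    rintro rfl
    exact neg_one_not_mem_lowUnits (hq.two_lt j) hu
  have hp : present (update (fun _ => -1) j u : ∀ i, (ZMod (q i))ˣ) = {j} := by
    ext i
    rw [mem_present, mem_singleton]
    by_cases h : i = j
    · subst h; simp [hne]
    · simp [h]
  refine ⟨⟨fun i hi _ => ?_, fun _ => by rw [hp, card_singleton]; exact odd_one⟩, hp⟩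
  have hij : i = j := by
    rw [← mem_singleton, ← hp, mem_present]
    exact (mem_middle.1 hi).2
  subst hij
  rwa [update_self]

theorem IsRep.eq_of_lt (hq : IsOrderedFactorization m q)
    {y : ∀ i, WithZero (ZMod (q i))ˣ}
    {a b : ℕ} (ha : IsRep q y a) (hb : IsRep q y b) (ham : a < m) (hbm : b < m) : a = b := by
  have h : (a : ℤ) ≡ b [ZMOD m] := (hq.modEq_iff _ _).2 fun i => by rw [ha i, hb i]
  exact Nat.ModEq.eq_of_lt_of_lt (Int.natCast_modEq_iff.1 h) ham hbm

theorem finite_M' [NeZero m] (hq : IsOrderedFactorization m q) : (M' m q).Finite := by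
  refine (Set.finite_lt_nat m).subset ?_
  rintro b (hb | hb)
  · exact hb.1.1.2.1
  · obtain ⟨j, c, h1, h2, rfl⟩ := Set.mem_iUnion.1 hb
    have hlt : c < q j := by
      have := Nat.totient_lt (q j) ((Nat.lt_succ_self 1).trans (hq.two_lt j))
      omega
    have h0 : 0 < m / q j :=
      Nat.div_pos (Nat.le_of_dvd (NeZero.pos m) (hq.dvd j)) (by omega)
    calc m / q j * c < m / q j * q j := Nat.mul_lt_mul_of_pos_left hlt h0
      _ = m := Nat.div_mul_cancel (hq.dvd j)

/-- The first kind of elements of `M'` goes to codes with at least two coordinates other than -1,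
the multiples of `m / q j` to codes with exactly one. In both cases the code determines the number,
so the map is injective. -/
theorem two_mul_card_M'_le [NeZero m] (hm : 1 < m) (hq : IsOrderedFactorization m q) :
    2 * (M' m q).ncard ≤ m.totient := by
  have := hq.neZero
  have : NeZero t := ⟨by
    rintro rfl
    have := hq.prod_eq
    simp at this
    omega⟩
  refine le_trans ?_ (two_mul_card_isReducedCode_le hq)
  have hf := fun i => exists_surjOn_lowUnits (hq.two_lt i)
  choose f hf using hf
  have key : ∀ b ∈ M' m q, ∃ g : ∀ i, (ZMod (q i))ˣ, IsReducedCode g ∧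
      ((1 < #(present g) ∧ b < m ∧ IsRep q (codePoint g) b) ∨
        ∃ j, present g = {j} ∧ b = m / q j * f j (g j)) := by
    rintro b (⟨hbM, hbd⟩ | hb)
    · obtain ⟨y, hy⟩ := exists_isRep_of_mem_X hq hbM.1
      obtain ⟨g, hg, hgy, hgp⟩ := exists_code hq ((hy.mem_M_iff hq hbM.1.1 hbM.1.2.1).1 hbM)
      refine ⟨g, hg, Or.inl ⟨?_, hbM.1.2.1, by rwa [hgy]⟩⟩
      rw [hgp, ← hy.J'_eq hq]
      exact one_lt_card_J' hq hbM.1 hbd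
    · obtain ⟨j, c, h1, h2, rfl⟩ := Set.mem_iUnion.1 hb
      obtain ⟨u, hu, rfl⟩ := hf j c h1 h2
      obtain ⟨h3, h4⟩ := isReducedCode_update hq j hu
      exact ⟨_, h3, Or.inr ⟨j, h4, by rw [update_self]⟩⟩
  choose! F hF using key
  have h1 : (M' m q).ncard ≤ (({g | IsReducedCode g} : Finset (∀ i, (ZMod (q i))ˣ)) :
      Set (∀ i, (ZMod (q i))ˣ)).ncard := by
    refine Set.ncard_le_ncard_of_injOn F (fun b hb => by simpa using (hF b hb).1) ?_
    intro a ha b hb hab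
    obtain ⟨-, h1⟩ := hF a ha
    obtain ⟨-, h2⟩ := hF b hb
    rw [hab] at h1
    rcases h1 with h1 | ⟨j, h1, h1'⟩ <;> rcases h2 with h2 | ⟨j', h2, h2'⟩
    · exact IsRep.eq_of_lt hq h1.2.2 h2.2.2 h1.2.1 h2.2.1
    · rw [h2, card_singleton] at h1
      exact absurd h1.1 (lt_irrefl 1)
    · rw [h1, card_singleton] at h2
      exact absurd h2.1 (lt_irrefl 1)
    · rw [h1, singleton_inj] at h2
      subst h2
      exact h1'.trans h2'.symm
  rw [Set.ncard_coe_finset] at h1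
  omega

end Counting

end

end ShortStickelberger

/-! ### The rank of `S''_m` and its basis -/

namespace ShortStickelberger

noncomputable section

open Finset Function
open scoped Classical

section Rank

variable {m : ℕ} [NeZero m]

theorem dual_apply_eq_sum (l : Module.Dual ℚ (MonoidAlgebra ℚ (GalCyc m)))
    (x : MonoidAlgebra ℚ (GalCyc m)) :
    l x = ∑ u, l ((coeffEquiv m).symm (Pi.single u 1)) * coeffEquiv m x u := by
  obtain ⟨f, rfl⟩ := (coeffEquiv m).symm.surjective x
  rw [LinearEquiv.apply_symm_apply]
  conv_lhs => rw [← univ_sum_single f]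
  rw [map_sum, map_sum]
  refine sum_congr rfl fun u _ => ?_
  rw [show Pi.single u (f u) = f u • (Pi.single u (1 : ℚ) : (ZMod m)ˣ → ℚ) by
    rw [← Pi.single_smul, smul_eq_mul, mul_one], map_smul, map_smul, smul_eq_mul, mul_comm]

/-- A functional that vanishes on `N` and on all `θ(a)` has even coefficients with sum zero. -/
theorem dual_coeff_neg {l : Module.Dual ℚ (MonoidAlgebra ℚ (GalCyc m))}
    (hN : l (normElt m) = 0) (hθ : ∀ a, l (theta m a) = 0) (u : (ZMod m)ˣ) :
    l ((coeffEquiv m).symm (Pi.single (-u) 1)) = l ((coeffEquiv m).symm (Pi.single u 1)) := by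
  set w : (ZMod m)ˣ → ℚ := fun u => l ((coeffEquiv m).symm (Pi.single u 1)) with hw
  have hodd : ∀ a : ℤ, ∑ u, w u * saw (-(a * (u : ZMod m)) : ZMod m) = 0 := fun a => by
    have h1 : l (oddTheta m a) = 0 := by
      rw [oddTheta]
      split_ifs
      · rw [sub_zero, hθ]
      · rw [map_sub, hθ, map_smul, hN, smul_zero, sub_zero]
    rw [dual_apply_eq_sum] at h1
    simpa only [coeffEquiv_oddTheta] using h1
  -- The odd part of `w` is orthogonal to all dilated sawtooth functions, hence zero.
  have h0 : (fun u => w u - w (-u)) = 0 := by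
    refine eq_zero_of_sum_mul_saw_eq_zero _ (fun u => by rw [neg_neg, neg_sub]) fun a => ?_
    obtain ⟨a, rfl⟩ := ZMod.intCast_surjective a
    have h1 : ∑ u : (ZMod m)ˣ, w (-u) * saw ((a : ZMod m) * (u : ZMod m))
        = ∑ u : (ZMod m)ˣ, w u * saw (-((a : ZMod m) * (u : ZMod m))) := by
      rw [← Equiv.sum_comp (Equiv.neg (ZMod m)ˣ)]
      simp
    have h2 : ∑ u : (ZMod m)ˣ, w u * saw ((a : ZMod m) * (u : ZMod m)) = 0 := by
      have := hodd (-a)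
      simpa using this
    simp only [sub_mul, sum_sub_distrib]
    rw [h1, h2, hodd, sub_zero]
  exact (sub_eq_zero.1 (congrFun h0 u)).symm

/-- The annihilator of `W` consists of functionals with even coefficients of sum zero, a space of
dimension at most `φ(m)/2 - 1`. -/
theorem totient_lt_two_mul_finrank (hm : 2 < m)
    {W : Submodule ℚ (MonoidAlgebra ℚ (GalCyc m))} (hN : normElt m ∈ W)
    (hθ : ∀ a, theta m a ∈ W) : m.totient + 2 ≤ 2 * Module.finrank ℚ W := by
  have hfin : Module.Finite ℚ (MonoidAlgebra ℚ (GalCyc m)) :=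
    Module.Finite.equiv (coeffEquiv m).symm
  have hV : Module.finrank ℚ (MonoidAlgebra ℚ (GalCyc m)) = m.totient := by
    rw [(coeffEquiv m).finrank_eq, Module.finrank_fintype_fun_eq_card, ZMod.card_units_eq_totient]
  have hsum := Subspace.finrank_add_finrank_dualAnnihilator_eq W
  set H : Finset (ZMod m)ˣ := {u | u ∈ lowUnits m} with hH
  have h1H : (1 : (ZMod m)ˣ) ∈ H := by rw [hH, mem_filter]; exact ⟨mem_univ _, one_mem_lowUnits hm⟩
  -- Evenness leaves one value for each pair `{u, -u}`, and the zero sum determines the value at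
  -- `{1, -1}`.
  let Ψ : W.dualAnnihilator →ₗ[ℚ] (H.erase 1 → ℚ) :=
    { toFun := fun l u => (l : Module.Dual ℚ _) ((coeffEquiv m).symm (Pi.single (u : (ZMod m)ˣ) 1))
      map_add' := fun _ _ => rfl
      map_smul' := fun _ _ => rfl }
  have hΨ : Injective Ψ := by
    rw [← LinearMap.ker_eq_bot, LinearMap.ker_eq_bot']
    rintro ⟨l, hl⟩ h0
    rw [Submodule.mem_dualAnnihilator] at hl
    set w : (ZMod m)ˣ → ℚ := fun u => l ((coeffEquiv m).symm (Pi.single u 1)) with hw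
    have heven : ∀ u, w (-u) = w u := dual_coeff_neg (hl _ hN) fun a => hl _ (hθ a)
    have hz : ∀ u ∈ H, u ≠ 1 → w u = 0 := fun u hu h1 =>
      congrFun h0 ⟨u, mem_erase.2 ⟨h1, hu⟩⟩
    have hnot : ∀ u, u ∉ H → -u ∈ H := fun u hu => by
      simp only [hH, mem_filter, mem_univ, true_and] at hu ⊢
      rw [← neg_one_mul, neg_mul_mem_lowUnits hm]
      exact hu
    have hne : (-1 : (ZMod m)ˣ) ≠ 1 := fun h =>
      neg_one_not_mem_lowUnits hm (h.symm ▸ one_mem_lowUnits hm)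
    have hz' : ∀ u, u ≠ 1 → u ≠ -1 → w u = 0 := fun u h1 h2 => by
      by_cases hu : u ∈ H
      · exact hz u hu h1
      · rw [← heven]
        exact hz _ (hnot u hu) fun h => h2 (by rw [← h, neg_neg])
    have hw1 : w 1 = 0 := by
      have h1 := hl _ hN
      rw [dual_apply_eq_sum] at h1
      simp only [coeffEquiv_normElt, Pi.one_apply, mul_one] at h1
      change ∑ u, w u = 0 at h1
      rw [← add_sum_erase _ _ (mem_univ 1), ← add_sum_erase _ _ (mem_erase.2 ⟨hne, mem_univ _⟩),
        sum_eq_zero, heven] at h1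
      · linarith
      · intro u hu
        rw [mem_erase, mem_erase] at hu
        exact hz' u hu.2.1 hu.1
    have hw0 : ∀ u, w u = 0 := fun u => by
      by_cases h1 : u = 1
      · rw [h1, hw1]
      · by_cases h2 : u = -1
        · rw [h2, heven, hw1]
        · exact hz' u h1 h2
    refine Subtype.ext (LinearMap.ext fun x => ?_)
    change l x = 0
    rw [dual_apply_eq_sum]
    exact sum_eq_zero fun u _ => by
      change w u * _ = 0
      rw [hw0, zero_mul]
  have hle := LinearMap.finrank_le_finrank_of_injective hΨ
  rw [Module.finrank_fintype_fun_eq_card, Fintype.card_coe, card_erase_of_mem h1H] at hle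
  have hcard : 2 * #H = m.totient := card_lowUnits hm
  have hpos : 0 < #H := card_pos.2 ⟨1, h1H⟩
  omega

variable {t : ℕ} {q : Fin t → ℕ}

/-- The elements `α_m(a)`, for `a` in `M'`, and `½ N_m`. -/
def generator (m : ℕ) [NeZero m] (q : Fin t → ℕ) : Option (M' m q) → MonoidAlgebra ℚ (GalCyc m)
  | none => (1 / 2 : ℚ) • normElt m
  | some a => alpha m q a

theorem SDoublePrime_eq_closure :
    SDoublePrime m q = AddSubgroup.closure (Set.range (generator m q)) := by
  rw [SDoublePrime]
  congr 1
  ext x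
  constructor
  · rintro (⟨a, ha, rfl⟩ | rfl)
    · exact ⟨some ⟨a, ha⟩, rfl⟩
    · exact ⟨none, rfl⟩
  · rintro ⟨_ | a, rfl⟩
    · exact Or.inr rfl
    · exact Or.inl ⟨a, a.2, rfl⟩

/-- The generators number at most `φ(m)/2 + 1`, which does not exceed the dimension of their span.
-/
theorem linearIndependent_generator (hm : 1 < m) (hq : IsOrderedFactorization m q) :
    LinearIndependent ℚ (generator m q) := by
  have : Finite (M' m q) := (finite_M' hq).to_subtype
  have := Fintype.ofFinite (M' m q)
  rw [linearIndependent_iff_card_le_finrank_span, Fintype.card_option]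
  set W := Submodule.span ℚ (Set.range (generator m q)) with hW
  have hS : SDoublePrime m q ≤ W.toAddSubgroup := by
    rw [SDoublePrime_eq_closure, AddSubgroup.closure_le]
    exact Submodule.subset_span
  have hθ : ∀ a, theta m a ∈ W := fun a => by
    obtain ⟨s, hs, n, hsn⟩ := exists_eq_add_sum hq (theta_mem_thetaGroup m a)
    rw [← hsn]
    refine add_mem (hS hs) (sum_mem fun j _ => zsmul_mem ?_ _)
    -- A positive multiple of `θ(m/q_j)` lies in `S''`, so the rational span contains `θ(m/q_j)`
    -- itself.
    have h1 : _ ∈ W := hS (nsmul_theta_mem hq j)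
    rw [← Nat.cast_smul_eq_nsmul ℚ] at h1
    refine (W.smul_mem_iff ?_).1 h1
    have h2 := hq.two_lt j
    norm_cast
    split_ifs <;> omega
  have hN : normElt m ∈ W := hS normElt_mem_SDoublePrime
  have hm2 : 2 < m := by
    obtain ⟨j⟩ : Nonempty (Fin t) := by
      by_contra h
      rw [not_nonempty_iff] at h
      have := hq.prod_eq
      simp at this
      omega
    exact (hq.two_lt j).trans_le (Nat.le_of_dvd (NeZero.pos m) (hq.dvd j))
  have h1 := totient_lt_two_mul_finrank hm2 hN hθ
  have h2 := two_mul_card_M'_le hm hq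
  rw [← Nat.card_coe_set_eq, Nat.card_eq_fintype_card] at h2
  change _ ≤ Module.finrank ℚ W
  omega

theorem exists_basis (hm : 1 < m) (hq : IsOrderedFactorization m q) :
    ∃ B : Module.Basis (Option (M' m q)) ℤ (SDoublePrime m q),
      ∀ o, (B o : MonoidAlgebra ℚ (GalCyc m)) = generator m q o := by
  have hmem : ∀ o, generator m q o ∈ SDoublePrime m q := fun o => by
    rw [SDoublePrime_eq_closure]
    exact AddSubgroup.subset_closure ⟨o, rfl⟩
  let v : Option (M' m q) → SDoublePrime m q := fun o => ⟨generator m q o, hmem o⟩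
  have hli : LinearIndependent ℤ v := by
    refine LinearIndependent.of_comp (SDoublePrime m q).subtype.toIntLinearMap ?_
    exact (linearIndependent_generator hm hq).restrict_scalars (by
      intro a b h
      simpa using h)
  have hsp : ⊤ ≤ Submodule.span ℤ (Set.range v) := by
    rintro ⟨x, hx⟩ -
    have h1 : SDoublePrime m q
        ≤ (Submodule.span ℤ (Set.range v)).toAddSubgroup.map (SDoublePrime m q).subtype := by
      conv_lhs => rw [SDoublePrime_eq_closure]
      rw [AddSubgroup.closure_le]
      rintro _ ⟨o, rfl⟩
      exact ⟨v o, Submodule.subset_span ⟨o, rfl⟩, rfl⟩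
    obtain ⟨y, hy, hyx⟩ := h1 hx
    have : y = ⟨x, hx⟩ := Subtype.ext hyx
    exact this ▸ hy
  exact ⟨Module.Basis.mk hli hsp, fun o => by rw [Module.Basis.mk_apply]⟩

end Rank

end

end ShortStickelberger

theorem mainTheorem9 (m : ℕ) [NeZero m] (hm : 1 < m) (hm4 : m % 4 ≠ 2) (t : ℕ) (q : Fin t → ℕ)
    (hq : ShortStickelberger.IsOrderedFactorization m q) :
    ShortStickelberger.SDoublePrime m q ≤ ShortStickelberger.SPrime m ∧
    (∃ B : Module.Basis (Option (ShortStickelberger.M' m q)) ℤ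
        (ShortStickelberger.SDoublePrime m q),
      (∀ a : ShortStickelberger.M' m q,
        (B (some a) : MonoidAlgebra ℚ (ShortStickelberger.GalCyc m)) =
          ShortStickelberger.alpha m q a) ∧
      (B none : MonoidAlgebra ℚ (ShortStickelberger.GalCyc m)) =
        (1 / 2 : ℚ) • ShortStickelberger.normElt m) ∧
    (ShortStickelberger.SDoublePrime m q).relIndex (ShortStickelberger.SPrime m) =
      if Even m then m / 2 else m := by
  obtain ⟨B, hB⟩ := ShortStickelberger.exists_basis hm hq
  refine ⟨?_, ⟨B, fun a => hB (some a), hB none⟩, ShortStickelberger.relIndex_SDoublePrime hm hq⟩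
  rw [ShortStickelberger.SPrime_eq_thetaGroup]
  exact ShortStickelberger.SDoublePrime_le_thetaGroup
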